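/- **Setting.** Let $G=(V,E)$ be a finite tree, $L$ a set of links (unordered pairs of distinct nodes of $V$) and $c\in\mathbb R^L$ link costs with $1\le c_\ell\le M$ for all $\ell\in L$, where $M\ge 1$; let $0<\varepsilon\le 1$. For a pair $\ell=uv$ let $P_\ell$ be the edge set of the $u$–$v$ path in $G$; $\ell$ covers the edges in $P_\ell$, and $\mathrm{cov}(F)$ is the set of links covering at least one edge of $F$ ($\mathrm{cov}(e)=\mathrm{cov}(\{e\})$). The instance is shadow-complete: if $\ell\in L$ and $\ell'$ is a pair of distinct nodes with $P_{\ell'}\subseteq P_\ell$, then $\ell'\in L$ and $c_{\ell'}\le c_\ell$. Write $x(A)=\sum_{\ell\in A}x_\ell$, $c(A)=\sum_{\ell\in A}c_\ell$. For $B\subseteq E$ let $\mathrm{OPT}(B)$ be the minimum of $c(S)$ over the sets $S\subseteq L$ covering every edge of $B$. A $\gamma$-bundle is the union of the edge sets of $\gamma$ (not necessarily distinct) paths of $G$. For a subtree $H$ of a contraction of $G$ (edges keep their identity under contraction), a vector $x\ge 0$ is feasible for the *odd-cut LP* for $H$ if $\sum_{\ell}\lceil\tfrac12|P_\ell\cap\delta_H(S)|\rceil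 x_\ell\ge\tfrac12(|\delta_H(S)|+1)$ for each set $S$ of nodes of $H$ with $|\delta_H(S)|$ odd, the sum being over the links with both ends in $H$. A vector $x$ is feasible for the *odd-cut bundle LP* of $G$ with parameter $\gamma$ if it is feasible for the odd-cut LP for $G$ and $\sum_{\ell\in\mathrm{cov}(B)}c_\ell x_\ell\ge\mathrm{OPT}(B)$ for all $\gamma$-bundles $B$ of $G$. Let $x$ be feasible for the odd-cut bundle LP with $\gamma=\lceil 28M/\varepsilon^2\rceil$, and let $E^h=\{e\in E: x(\mathrm{cov}(e))\ge 2/\varepsilon\}$. **Decomposition.** Let $L^h\subseteq L$ be any set of links covering $E^h$, and let $\overline G$ arise from $G$ by contracting all edges of $\bigcup_{\ell\in L^h}P_\ell$. An edge $e=\{u,v\}$ of a subtree $H$ of $\overline G$ is $\alpha$-thin with respect to $x$ if each of the two components $H^u\ni u$, $H^v\ni v$ of $H-e$ satisfies $\sum_{\ell\subseteq V[\cdot]}c_\ell x_\ell\ge\alpha$, the sum being over links with both ends in that component. Splitting $(H,x)$ along $e$ yields $(H^u,x^u)$ and $(H^v,x^v)$: with $u,v\in V$ the ends of $e$ in $G$,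 $x^u$ keeps $x_\ell$ for the links with both ends in $H^u$, is $0$ on all other links, and for each link $\ell'=pq\in\mathrm{cov}(e)$ with $p$ in $H^u$ and $p\neq u$ the amount $\tfrac{c_{\ell'}}{c_{\ell}}x_{\ell'}$ is added at the link $\ell=pu$; $x^v$ is defined symmetrically. Starting from $(\overline G,x)$, split repeatedly along $\tfrac{4M}{\varepsilon^2}$-thin edges (with respect to the current vectors), in any order, until no pair has one. Let $(G^i,x^i)$, $i=1,\dots,k$, be the resulting pairs and $E^s$ the set of edges along which splits were made. **Claim.** For every such decomposition: 1. each $x^i$ is feasible for the odd-cut LP for $G^i$, and $\sum_{\ell\in\mathrm{cov}(B)}c_\ell x^i_\ell\ge\mathrm{OPT}(B)$ for every $B\subseteq E[G^i]$ that is a $\gamma$-bundle of $G$; 2. $\mathrm{supp}(x^i)\cap\mathrm{supp}(x^j)=\emptyset$ for $i\ne j$; 3. each $(G^i,x^i)$ is $\lceil\tfrac{10M}{\varepsilon^2}\rceil$-simple, that is, $G^i$ has a node $v$ (a center) such that each tree $K$ of the forest $G^i-v$ has at most $\lceil\tfrac{10M}{\varepsilon^2}\rceil$ leaves and $\sum_{\ell\subseteq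 V[K]}c_\ell x^i_\ell\le\lceil\tfrac{10M}{\varepsilon^2}\rceil$; moreover $v$ can be chosen such that in addition $\sum_{\ell\subseteq V[K]}c_\ell x^i_\ell\le\tfrac{4M}{\varepsilon^2}$ and at most $\tfrac{10M}{\varepsilon^2}$ leaves of $G^i$ lie in $K$, for each such $K$ (leaves are nodes of degree at most one); 4. $\sum_{i=1}^k c^{\mathsf T}x^i\le(1+\varepsilon)\,c^{\mathsf T}x$; 5. one can compute efficiently a set of links $L^h\subseteq L$ covering $E^h$ with $c(L^h)\le\varepsilon\,c^{\mathsf T}x$ and, for every decomposition as above, a set of links $L^s\subseteq L$ covering $E^s$ with $c(L^s)\le C\varepsilon\sum_{i=1}^k c^{\mathsf T}x^i$, where $C$ is an absolute constant. Here "efficiently" means: there are two fixed programs of a random access machine that adds, subtracts and compares natural and real numbers at unit cost, and a fixed polynomial $q$, such that the programs return such sets $L^h$ and $L^s$ within $q(|V|)$ steps, the first on input $G,L,c,x,2/\varepsilon$, the second on input $G,L,c,E^s$, for every numbering of the nodes. -/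

import Mathlib

/-! ### Weighted tree augmentation -/

namespace TreeAug

/-- An instance of the weighted tree augmentation problem on the node set `V`: a tree, a finite set
of links (unordered pairs of distinct nodes; a link may be parallel to a tree edge), and link costs.
Only the values of `cost` at links matter. -/
structure WTAP (V : Type*) where
  graph : SimpleGraph V
  isTree : graph.IsTree
  links : Finset (Sym2 V)
  loopless : ∀ l ∈ links, ¬ l.IsDiag
  cost : Sym2 V → ℝ

variable {V : Type*}

/-- The edge set `P_l` of the path of the tree `G` that joins the two end nodes of the pair `l`. -/
def pathEdges (G : SimpleGraph V) (l : Sym2 V) : Set (Sym2 V) :=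
  {e | ∃ u v : V, l = s(u, v) ∧ ∃ p : G.Walk u v, p.IsPath ∧ e ∈ p.edges}

/-- Both end nodes of the link `l` lie in `U`. -/
def Inside (U : Set V) (l : Sym2 V) : Prop := ∀ w ∈ l, w ∈ U

/-- Every shadow of a link is a link, and it is not more expensive. -/
def WTAP.ShadowComplete (I : WTAP V) : Prop :=
  ∀ l ∈ I.links, ∀ l' : Sym2 V, ¬ l'.IsDiag → pathEdges I.graph l' ⊆ pathEdges I.graph l →
    l' ∈ I.links ∧ I.cost l' ≤ I.cost l

/-- The links that cover at least one edge of `F`. -/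
noncomputable def WTAP.cov (I : WTAP V) (F : Set (Sym2 V)) : Finset (Sym2 V) :=
  open Classical in I.links.filter fun l => (pathEdges I.graph l ∩ F).Nonempty

/-- The links with both end nodes in `U`. -/
noncomputable def WTAP.linksIn (I : WTAP V) (U : Set V) : Finset (Sym2 V) :=
  open Classical in I.links.filter fun l => Inside U l

/-- The link set `S` covers every edge of `F`. -/
def WTAP.Covers (I : WTAP V) (S : Finset (Sym2 V)) (F : Set (Sym2 V)) : Prop :=
  ∀ e ∈ F, ∃ l ∈ S, e ∈ pathEdges I.graph l

/-- The cost `c(S)` of a set of links. -/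
noncomputable def WTAP.setCost (I : WTAP V) (S : Finset (Sym2 V)) : ℝ := ∑ l ∈ S, I.cost l

/-- The cost `cᵀ x` of a fractional vector. -/
noncomputable def WTAP.fracCost (I : WTAP V) (x : Sym2 V → ℝ) : ℝ := ∑ l ∈ I.links, I.cost l * x l

/-- The `x`-cost of the links with both end nodes in `U`. -/
noncomputable def WTAP.costIn (I : WTAP V) (x : Sym2 V → ℝ) (U : Set V) : ℝ :=
  ∑ l ∈ I.linksIn U, I.cost l * x l

/-- The support of `x`, as a set of links. -/
def WTAP.supp (I : WTAP V) (x : Sym2 V → ℝ) : Set (Sym2 V) := {l | l ∈ I.links ∧ 0 < x l}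

/-- `OPT(B)`: the least cost of a set of links that covers `B`. The set of these costs is finite;
it is nonempty whenever every edge of the tree is covered by some link, and this is forced
by the odd-cut constraints. -/
noncomputable def WTAP.opt (I : WTAP V) (B : Set (Sym2 V)) : ℝ :=
  sInf {r | ∃ S : Finset (Sym2 V), S ⊆ I.links ∧ I.Covers S B ∧ r = I.setCost S}

/-- `B` is a `γ`-bundle: the union of the edge sets of `γ` (not necessarily distinct) paths. -/
def IsBundle (G : SimpleGraph V) (γ : ℕ) (B : Set (Sym2 V)) : Prop :=
  ∃ f : Fin γ → Set (Sym2 V),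
    (∀ i, ∃ (u v : V) (p : G.Walk u v), p.IsPath ∧ f i = {e | e ∈ p.edges}) ∧ B = ⋃ i, f i

/-! ### Contractions and subtrees of contracted trees

Let `D` be a set of edges of the tree `G`. A node of the contracted tree `G/D` is a class of nodes of
`G`, two nodes being in the same class if edges of `D` connect them. A subtree `H` of `G/D` is
recorded by `D` and the set `U` of all nodes of `G` that lie in the nodes of `H`. The
edges of `H` are the edges of `G` inside `U` that are not in `D` (edges keep their identity under
contraction), and the links of `H` are the links with both ends in `U` (some may be loops
of `H`). The tree `G` itself is the case `D = ∅`, `U = V`. -/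

/-- The node of the contracted tree `G/D` that contains `v`. -/
def node (D : Set (Sym2 V)) (v : V) : Set V :=
  {w | (SimpleGraph.fromEdgeSet D).Reachable v w}

/-- The edges of the contracted subtree `(D, U)`. -/
def edgesIn (G : SimpleGraph V) (D : Set (Sym2 V)) (U : Set V) : Set (Sym2 V) :=
  {e | e ∈ G.edgeSet ∧ e ∉ D ∧ Inside U e}

/-- The edges of the contracted subtree `(D, U)` with exactly one end in `S`. -/
def cut (G : SimpleGraph V) (D : Set (Sym2 V)) (U S : Set V) : Set (Sym2 V) :=
  {e | e ∈ edgesIn G D U ∧ ∃ a b : V, a ∈ S ∧ b ∉ S ∧ e = s(a, b)}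

/-- `S` is a set of nodes of the contracted subtree `(D, U)`, that is, a union of classes in `U`. -/
def IsNodeSet (D : Set (Sym2 V)) (U S : Set V) : Prop :=
  S ⊆ U ∧ ∀ a ∈ S, node D a ⊆ S

/-- `x` is feasible for the odd-cut LP of the contracted subtree `H = (D, U)`: it is nonnegative, and
`x(π(S)) ≥ (|δ_H(S)| + 1) / 2` for every set `S` of nodes of `H` with `|δ_H(S)|` odd, where the link
`l` has multiplicity `⌈|P_l ∩ δ_H(S)| / 2⌉` in `π(S)`. -/
def WTAP.OddCutFeasible (I : WTAP V) (D : Set (Sym2 V)) (U : Set V) (x : Sym2 V → ℝ) : Prop :=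
  (∀ l ∈ I.links, 0 ≤ x l) ∧
  ∀ S : Set V, IsNodeSet D U S → Odd (cut I.graph D U S).ncard →
    (((cut I.graph D U S).ncard : ℝ) + 1) / 2 ≤
      ∑ l ∈ I.linksIn U,
        (⌈((pathEdges I.graph l ∩ cut I.graph D U S).ncard : ℝ) / 2⌉₊ : ℝ) * x l

/-- The bundle constraints of `x` for all edge sets of the contracted subtree `(D, U)` that are
`γ`-bundles in the original tree. -/
def WTAP.BundleFeasible (I : WTAP V) (γ : ℕ) (D : Set (Sym2 V)) (U : Set V)
    (x : Sym2 V → ℝ) : Prop :=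
  ∀ B : Set (Sym2 V), IsBundle I.graph γ B → B ⊆ edgesIn I.graph D U →
    I.opt B ≤ ∑ l ∈ I.cov B, I.cost l * x l

/-- `x` is feasible for the odd-cut bundle LP of the whole instance. -/
def WTAP.OddCutBundleFeasible (I : WTAP V) (γ : ℕ) (x : Sym2 V → ℝ) : Prop :=
  I.OddCutFeasible ∅ Set.univ x ∧ I.BundleFeasible γ ∅ Set.univ x

/-- The heavily covered edges `E^h`: those with `x(cov(e)) ≥ 2/ε`. -/
def WTAP.heavy (I : WTAP V) (ε : ℝ) (x : Sym2 V → ℝ) : Set (Sym2 V) :=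
  {e | e ∈ I.graph.edgeSet ∧ 2 / ε ≤ ∑ l ∈ I.cov {e}, x l}

/-- The edges that are contracted when the links of `S` are contracted. -/
def WTAP.contracted (I : WTAP V) (S : Finset (Sym2 V)) : Set (Sym2 V) :=
  ⋃ l ∈ S, pathEdges I.graph l

/-! ### Splitting along thin edges -/

/-- The nodes in `U` on the side of `u` after the deletion of the edge `uv`. -/
def side (G : SimpleGraph V) (U : Set V) (u v : V) : Set V :=
  {w | w ∈ U ∧ (G.deleteEdges {s(u, v)}).Reachable u w}

/-- The edge `uv` of the contracted subtree `(D, U)` is `α`-thin with respect to `x`. -/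
def WTAP.IsThin (I : WTAP V) (α : ℝ) (D : Set (Sym2 V)) (U : Set V) (x : Sym2 V → ℝ)
    (u v : V) : Prop :=
  s(u, v) ∈ edgesIn I.graph D U ∧
    α ≤ I.costIn x (side I.graph U u v) ∧ α ≤ I.costIn x (side I.graph U v u)

/-- The vector `x^u` that arises by splitting along `e = uv`: links inside the side of `u` keep their
value, and for each link `l' = pq` covering `e`, with `p` on the side of `u`, the amount
`(c_{l'} / c_l) x_{l'}` is added at its shadow `l = pu` (nothing is added if `p = u`, since `uu` is no
link); all other entries are zero. Here `u` and `v` are the ends of `e` in the original tree. -/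
noncomputable def WTAP.split (I : WTAP V) (U : Set V) (x : Sym2 V → ℝ) (u v : V) : Sym2 V → ℝ :=
  open Classical in fun l =>
    (if Inside (side I.graph U u v) l then x l else 0) +
      ∑ l' ∈ (I.cov {s(u, v)}).filter
          (fun l' => ∃ p ∈ side I.graph U u v, p ∈ l' ∧ l = s(p, u)),
        I.cost l' / I.cost l * x l'

/-- `I.ThinDecomp α D U x P E`: starting from the contracted subtree `(D, U)` with the vector `x`,
repeated splitting along `α`-thin edges, until none is left, can end with the list `P` of
pairs `(U^i, x^i)`, having split along exactly the edges in `E`. -/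
inductive WTAP.ThinDecomp (I : WTAP V) (α : ℝ) (D : Set (Sym2 V)) :
    Set V → (Sym2 V → ℝ) → List (Set V × (Sym2 V → ℝ)) → Set (Sym2 V) → Prop
  | done (U : Set V) (x : Sym2 V → ℝ) (h : ∀ u v : V, ¬ I.IsThin α D U x u v) :
      I.ThinDecomp α D U x [(U, x)] ∅
  | step (U : Set V) (x : Sym2 V → ℝ) (u v : V) (h : I.IsThin α D U x u v)
      (P₁ P₂ : List (Set V × (Sym2 V → ℝ))) (E₁ E₂ : Set (Sym2 V))
      (h₁ : I.ThinDecomp α D (side I.graph U u v) (I.split U x u v) P₁ E₁)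
      (h₂ : I.ThinDecomp α D (side I.graph U v u) (I.split U x v u) P₂ E₂) :
      I.ThinDecomp α D U x (P₁ ++ P₂) (insert s(u, v) (E₁ ∪ E₂))

/-! ### Simple pairs -/

/-- `K` is (the set of original nodes of) one of the trees into which the removal of the node
containing `v` decomposes the contracted subtree `(D, U)`. -/
def IsBranch (G : SimpleGraph V) (D : Set (Sym2 V)) (U : Set V) (v : V) (K : Set V) : Prop :=
  ∃ C : (G.induce (U \ node D v)).ConnectedComponent, K = Subtype.val '' C.supp

/-- The nodes in `K` of degree at most one in the contracted subtree `(D, U)`. For `U = K` these are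
the leaves of the contracted tree `K`; a tree with only one node has one leaf. -/
def leavesIn (G : SimpleGraph V) (D : Set (Sym2 V)) (U K : Set V) : Set (Set V) :=
  {a | ∃ w ∈ K, a = node D w ∧ {e | e ∈ edgesIn G D U ∧ ∃ z ∈ a, z ∈ e}.ncard ≤ 1}

/-- The node containing `v` is a `β`-center of the contracted subtree `(D, U)` with vector `x`. -/
def WTAP.IsCenter (I : WTAP V) (β : ℕ) (D : Set (Sym2 V)) (U : Set V) (x : Sym2 V → ℝ)
    (v : V) : Prop :=
  v ∈ U ∧ ∀ K : Set V, IsBranch I.graph D U v K →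
    I.costIn x K ≤ β ∧ (leavesIn I.graph D K K).ncard ≤ β

/-! ### Algorithms

A random access machine with unit costs. The memory consists of two-dimensional arrays
of natural numbers, used for indices and flags, and of two-dimensional arrays of real numbers, used
for the data. Numbers can only be added, subtracted and compared; in particular, on rational data
a polynomial number of steps involves only numbers of polynomial bit length. -/

/-- The memory: `nat a i j` and `real a i j` are the entries `(i, j)` of the arrays number `a`. -/
@[ext] structure Store where
  nat : ℕ → ℕ → ℕ → ℕ
  real : ℕ → ℕ → ℕ → ℝ

inductive NatExpr
  | const (k : ℕ)
  | get (a : ℕ) (i j : NatExpr)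
  | add (e f : NatExpr)
  | sub (e f : NatExpr)

def NatExpr.eval (s : Store) : NatExpr → ℕ
  | const k => k
  | get a i j => s.nat a (i.eval s) (j.eval s)
  | add e f => e.eval s + f.eval s
  | sub e f => e.eval s - f.eval s

inductive RealExpr
  | zero
  | one
  | get (a : ℕ) (i j : NatExpr)
  | add (e f : RealExpr)
  | sub (e f : RealExpr)

noncomputable def RealExpr.eval (s : Store) : RealExpr → ℝ
  | zero => 0
  | one => 1
  | get a i j => s.real a (i.eval s) (j.eval s)
  | add e f => e.eval s + f.eval s
  | sub e f => e.eval s - f.eval s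

inductive Test
  | natLe (e f : NatExpr)
  | realLe (e f : RealExpr)
  | not (t : Test)
  | and (t t' : Test)

def Test.Holds (s : Store) : Test → Prop
  | natLe e f => e.eval s ≤ f.eval s
  | realLe e f => e.eval s ≤ f.eval s
  | not t => ¬ t.Holds s
  | and t t' => t.Holds s ∧ t'.Holds s

inductive Prog
  | setNat (a : ℕ) (i j e : NatExpr)
  | setReal (a : ℕ) (i j : NatExpr) (e : RealExpr)
  | seq (p q : Prog)
  | ite (t : Test) (p q : Prog)
  | while (t : Test) (p : Prog)

def Store.setNat (s : Store) (a i j k : ℕ) : Store where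
  nat b i' j' := if b = a ∧ i' = i ∧ j' = j then k else s.nat b i' j'
  real := s.real

noncomputable def Store.setReal (s : Store) (a i j : ℕ) (r : ℝ) : Store where
  nat := s.nat
  real b i' j' := if b = a ∧ i' = i ∧ j' = j then r else s.real b i' j'

/-- `Run p s t s'`: started with memory `s`, the program `p` halts with memory `s'` after `t` steps,
where each executed assignment and each evaluated test is one step. (The size of a single
expression is a constant of the program.) -/
inductive Run : Prog → Store → ℕ → Store → Prop
  | setNat (s : Store) (a : ℕ) (i j e : NatExpr) :
      Run (.setNat a i j e) s 1 (s.setNat a (i.eval s) (j.eval s) (e.eval s))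
  | setReal (s : Store) (a : ℕ) (i j : NatExpr) (e : RealExpr) :
      Run (.setReal a i j e) s 1 (s.setReal a (i.eval s) (j.eval s) (e.eval s))
  | seq {p q : Prog} {s s' s'' : Store} {t t' : ℕ} (h : Run p s t s') (h' : Run q s' t' s'') :
      Run (.seq p q) s (t + t') s''
  | ite_pos {b : Test} {p q : Prog} {s s' : Store} {t : ℕ} (hb : b.Holds s) (h : Run p s t s') :
      Run (.ite b p q) s (t + 1) s'
  | ite_neg {b : Test} {p q : Prog} {s s' : Store} {t : ℕ} (hb : ¬ b.Holds s) (h : Run q s t s') :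
      Run (.ite b p q) s (t + 1) s'
  | while_pos {b : Test} {p : Prog} {s s' s'' : Store} {t t' : ℕ} (hb : b.Holds s)
      (h : Run p s t s') (h' : Run (.while b p) s' t' s'') :
      Run (.while b p) s (t + t' + 1) s''
  | while_neg {b : Test} {p : Prog} {s : Store} (hb : ¬ b.Holds s) :
      Run (.while b p) s 1 s

/-- The matrix of a function on pairs of nodes, for the numbering `σ` of the nodes. -/
noncomputable def matrixOf {R : Type*} [Zero R] {n : ℕ} (σ : V ≃ Fin n) (f : Sym2 V → R) :
    ℕ → ℕ → R :=
  fun i j => if h : i < n ∧ j < n then f s(σ.symm ⟨i, h.1⟩, σ.symm ⟨j, h.2⟩) else 0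

/-- The indicator function of a set of pairs. -/
noncomputable def indicatorOf (A : Set (Sym2 V)) : Sym2 V → ℕ :=
  open Classical in fun e => if e ∈ A then 1 else 0

/-- The input memory for an instance, a set `F` of edges, a vector `x` and a number `θ`. The number of
nodes is the entry `(0, 0)` of the natural array `0`; the natural arrays `1`, `2`, `3` are the
indicator matrices of the tree edges, of the links, and of `F`. The real arrays `0` and `1` are
the matrices of the link costs and of `x`; the entry `(0, 0)` of the real array `2` is `θ`.
All other entries are zero. -/
noncomputable def WTAP.input (I : WTAP V) {n : ℕ} (σ : V ≃ Fin n) (F : Set (Sym2 V))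
    (x : Sym2 V → ℝ) (θ : ℝ) : Store where
  nat a := match a with
    | 0 => fun i j => if i = 0 ∧ j = 0 then n else 0
    | 1 => matrixOf σ (indicatorOf I.graph.edgeSet)
    | 2 => matrixOf σ (indicatorOf {l | l ∈ I.links})
    | 3 => matrixOf σ (indicatorOf F)
    | _ => fun _ _ => 0
  real a := match a with
    | 0 => matrixOf σ (open Classical in fun l => if l ∈ I.links then I.cost l else 0)
    | 1 => matrixOf σ (open Classical in fun l => if l ∈ I.links then x l else 0)
    | 2 => fun i j => if i = 0 ∧ j = 0 then θ else 0
    | _ => fun _ _ => 0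

/-- The set of pairs that a halted computation returns: the nonzero entries of natural array `4`. -/
def Store.output (s : Store) {n : ℕ} (σ : V ≃ Fin n) : Set (Sym2 V) :=
  {l | ∃ u v : V, l = s(u, v) ∧ s.nat 4 (σ u) (σ v) ≠ 0}

/-- The program `p`, started on the memory `s`, halts after at most `T` steps and returns `S`. -/
def Computes (p : Prog) (s : Store) (T : ℕ) {n : ℕ} (σ : V ≃ Fin n) (S : Finset (Sym2 V)) : Prop :=
  ∃ (t : ℕ) (s' : Store), Run p s t s' ∧ t ≤ T ∧ s'.output σ = {l | l ∈ S}

end TreeAug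

open TreeAug

/-! Feasibility. When a piece is split along `uv`, a link covering `uv` is replaced on the side of
`u` by its `shadow`, which covers exactly the same edges of that side. The value is scaled by the
ratio of the costs, so cost-weighted sums over the links covering edges of that side do not change
(`sum_cost_split_eq`). The ratio is at least one, so the sums in the odd-cut constraints do not
decrease (`sum_le_sum_split`). A cut of one side is also a cut of the whole piece (`cut_side`).
Hence odd-cut and bundle constraints are inherited, and so is the bound `2M/ε` on the cost of the
links covering an edge, which holds initially because heavy edges are contracted (`isPiece_univ`,
`WTAP.IsPiece.split`).

Cost. A split adds less than `2M/ε` to the total, whereas each piece produced by splitting costs at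
least `4M/ε²`. Charging the splits to the pieces gives the factor `1 + ε`. Each split edge is itself
a link of cost at most `M` (`edge_mem_links`), so the split edges serve as their own cover, with
constant one.

Simplicity. Without thin edges, each edge has at most one heavy side. A smallest heavy side shows
where the center is: all branches there are light (`exists_light_center`). The odd-cut constraint of
a leaf demands links of total value one ending in it, so a light branch has few leaves
(`ncard_leaves_le`).

Heavy edges. Root the tree and represent an edge by its lower end. Each link is the union of two
up-links, from its ends to their lowest common ancestor, so up-links cost at most a factor two,
which the threshold `2/ε` pays for. For up-links a primal-dual algorithm is exact. Going bottom-up,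
the dual variable of each heavy node is raised until some up-link over it is tight. Going top-down,
the tight up-link of a node is selected if the node is not yet covered. Then each positive dual
variable is paid for by at most one selected up-link (`sum_selection_le`), and weak duality
(`dual_value_le`) bounds the dual value by `ε` times the cost of `x`.

Programs. Natural array `5` holds distances, `6` marks heavy nodes, `7` and `8` hold the chosen
up-links, `9` marks covered nodes; arrays `10` to `14` hold loop variables. Real array `0` starts
with the costs and is turned into slacks. The proofs combine loop invariants with a frame rule for
the arrays not written. -/

namespace TreeAug

open SimpleGraph

/-! ### Paths, separation by an edge, and classes of contracted edges -/

section Tree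

variable {V : Type*} {G : SimpleGraph V}

/-- The nodes `u` and `w` lie on the same side of the edge `e`. -/
abbrev Conn (G : SimpleGraph V) (e : Sym2 V) (u w : V) : Prop := (G.deleteEdges {e}).Reachable u w

/-- A walk that avoids `e` shortens to a path that avoids `e`, and paths in a tree are unique.
Questions on paths thus become questions on reachability in `G - e`. -/
theorem conn_iff_path (hG : G.IsTree) {e : Sym2 V} {u w : V} {p : G.Walk u w} (hp : p.IsPath) :
    Conn G e u w ↔ e ∉ p.edges := by
  classical
  constructor
  · rintro ⟨q⟩ he
    have hle : G.deleteEdges {e} ≤ G := deleteEdges_le _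
    have h1 : (q.mapLe hle).bypass = p :=
      (hG.existsUnique_path u w).unique (Walk.bypass_isPath _) hp
    have h2 : e ∈ (q.mapLe hle).edges := Walk.edges_bypass_subset_edges _ (h1 ▸ he)
    rw [Walk.edges_mapLe_eq_edges] at h2
    have h3 := Walk.edges_subset_edgeSet q h2
    simp at h3
  · intro he
    refine ⟨p.toDeleteEdges {e} ?_⟩
    intro f hf hfe
    rw [Set.mem_singleton_iff] at hfe
    exact he (hfe ▸ hf)

theorem mem_pathEdges (hG : G.IsTree) {e : Sym2 V} {u w : V} :
    e ∈ pathEdges G s(u, w) ↔ ¬ Conn G e u w := by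
  constructor
  · rintro ⟨a, b, hab, p, hp, he⟩ hc
    rcases Sym2.eq_iff.1 hab with ⟨rfl, rfl⟩ | ⟨rfl, rfl⟩
    · exact (conn_iff_path hG hp).1 hc he
    · exact (conn_iff_path hG hp).1 hc.symm he
  · intro h
    obtain ⟨p, hp, -⟩ := hG.existsUnique_path u w
    exact ⟨u, w, rfl, p, hp, by simpa using mt (conn_iff_path hG hp).2 h⟩

theorem pathEdges_subset (l : Sym2 V) : pathEdges G l ⊆ G.edgeSet := by
  rintro e ⟨a, b, -, p, -, he⟩
  exact Walk.edges_subset_edgeSet p he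

theorem not_conn_edge (hG : G.IsTree) {u v : V} (h : G.Adj u v) : ¬ Conn G s(u, v) u v := by
  have hp : (Walk.cons h Walk.nil).IsPath := by simp [h.ne]
  rw [conn_iff_path hG hp]
  simp

theorem conn_of_adj {e : Sym2 V} {a b : V} (h : G.Adj a b) (hne : s(a, b) ≠ e) : Conn G e a b :=
  Adj.reachable (by simp [h, hne])

/-- If the path from `u` to `w` uses `uv`, its part after `v` cannot use `uv` again, because it
would visit `u` twice. -/
theorem conn_or_conn (hG : G.IsTree) {u v : V} (w : V) :
    Conn G s(u, v) u w ∨ Conn G s(u, v) v w := by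
  classical
  obtain ⟨p, hp, -⟩ := hG.existsUnique_path u w
  by_cases hv : v ∈ p.support
  · by_cases he : s(u, v) ∈ p.edges
    · right
      rw [conn_iff_path hG (hp.dropUntil hv)]
      intro h
      have h1 := Walk.fst_mem_support_of_mem_edges _ h
      have huv : G.Adj u v := Walk.adj_of_mem_edges _ he
      have h4 : p.support = (p.takeUntil v hv).support ++ (p.dropUntil v hv).support.tail := by
        rw [← Walk.support_append, Walk.take_spec]
      have h5 : u ∈ (p.dropUntil v hv).support.tail := by
        rw [← Walk.cons_tail_support] at h1
        exact (List.mem_cons.1 h1).resolve_left huv.ne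
      have h6 := hp.support_nodup
      rw [h4, List.nodup_append'] at h6
      exact h6.2.2 (Walk.start_mem_support _) h5
    · left; exact (conn_iff_path hG hp).2 he
  · left
    rw [conn_iff_path hG hp]
    exact fun h => hv (Walk.snd_mem_support_of_mem_edges _ h)

/-- Two nodes that are separated from a third one by an edge are on the same side of the edge. -/
theorem conn_of_not_conn (hG : G.IsTree) {e : Sym2 V} {p q z : V} (h1 : ¬ Conn G e p q)
    (h2 : ¬ Conn G e q z) : Conn G e p z := by
  induction e using Sym2.ind with
  | _ u v =>
    rcases conn_or_conn hG (u := u) (v := v) p with hp | hp <;>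
    rcases conn_or_conn hG (u := u) (v := v) q with hq | hq <;>
    rcases conn_or_conn hG (u := u) (v := v) z with hz | hz
    all_goals first
      | exact hp.symm.trans hz
      | exact absurd (hp.symm.trans hq) h1
      | exact absurd (hq.symm.trans hz) h2

/-- An edge on the side of `u` of the edge `uv` does not separate `u` from the side of `v`. -/
theorem conn_across (hG : G.IsTree) {u v a b q : V} (huv : G.Adj u v) (hne : s(a, b) ≠ s(u, v))
    (ha : Conn G s(u, v) u a) (hq : ¬ Conn G s(u, v) u q) : Conn G s(a, b) u q := by
  classical
  have hvq : Conn G s(u, v) v q := (conn_or_conn hG q).resolve_left hq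
  refine (conn_of_adj huv hne.symm).trans ?_
  obtain ⟨p, hp, -⟩ := hG.existsUnique_path v q
  refine (conn_iff_path hG hp).2 fun h => ?_
  have hs := Walk.fst_mem_support_of_mem_edges _ h
  -- If the path from `v` to `q` visited `a`, then `a` would lie on the side of `v`.
  have : Conn G s(u, v) v a := by
    rw [conn_iff_path hG (hp.takeUntil hs)]
    exact fun h' => (conn_iff_path hG hp).1 hvq (Walk.edges_takeUntil_subset_edges _ hs h')
  exact not_conn_edge hG huv (ha.trans this.symm)

/-- A class is connected by edges of `D`, and `e` is none of them. -/
theorem conn_of_mem_node {D : Set (Sym2 V)} (hD : D ⊆ G.edgeSet) {e : Sym2 V} (he : e ∉ D)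
    {a w : V} (h : w ∈ node D a) : Conn G e a w := by
  refine Reachable.mono ?_ h
  intro x y hxy
  rw [fromEdgeSet_adj] at hxy
  have h2 : G.Adj x y := hD hxy.1
  simp only [deleteEdges_adj, h2, Set.mem_singleton_iff, true_and]
  rintro rfl
  exact he hxy.1

theorem mem_node_self (D : Set (Sym2 V)) (a : V) : a ∈ node D a := Reachable.refl a

theorem node_eq {D : Set (Sym2 V)} {a b : V} (h : b ∈ node D a) : node D b = node D a :=
  Set.ext fun _ => ⟨fun hw => Reachable.trans h hw, fun hw => Reachable.trans (Reachable.symm h) hw⟩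

theorem mem_node_of_mem {D : Set (Sym2 V)} {a b : V} (h : s(a, b) ∈ D) : b ∈ node D a := by
  by_cases hab : a = b
  · subst hab; exact mem_node_self D a
  · exact Adj.reachable (by simp [h, hab])

theorem node_empty (a : V) : node (∅ : Set (Sym2 V)) a = {a} := by
  ext w
  simp [node, eq_comm]

/-! ### Ancestors with respect to a root -/

/-- `a` lies on the path from the root `r` to `b`. -/
def Anc (G : SimpleGraph V) (r a b : V) : Prop := G.dist r a + G.dist a b ≤ G.dist r b

theorem Anc.refl (r a : V) : Anc G r a a := by simp [Anc]

theorem Anc.trans (hG : G.IsTree) {r a b c : V} (h1 : Anc G r a b) (h2 : Anc G r b c) :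
    Anc G r a c := by
  have := hG.1.dist_triangle (u := a) (v := b) (w := c)
  unfold Anc at *
  omega

theorem anc_root (r a : V) : Anc G r r a := by simp [Anc]

theorem Anc.dist_lt (hG : G.IsTree) {r a b : V} (h : Anc G r a b) (hne : a ≠ b) :
    G.dist r a < G.dist r b := by
  have := hG.1.pos_dist_of_ne hne
  unfold Anc at h
  omega

theorem length_eq_dist (hG : G.IsTree) {u v : V} {p : G.Walk u v} (hp : p.IsPath) :
    p.length = G.dist u v := by
  obtain ⟨q, hq, hl⟩ := hG.1.exists_path_of_dist u v
  rw [(hG.existsUnique_path u v).unique hp hq, hl]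

theorem anc_iff_mem_support (hG : G.IsTree) {r a b : V} {p : G.Walk r b} (hp : p.IsPath) :
    Anc G r a b ↔ a ∈ p.support := by
  classical
  constructor
  · intro h
    obtain ⟨q1, hq1, h1⟩ := hG.1.exists_path_of_dist r a
    obtain ⟨q2, hq2, h2⟩ := hG.1.exists_path_of_dist a b
    have h3 : (q1.append q2).length = G.dist r b := by
      have := hG.1.dist_triangle (u := r) (v := a) (w := b)
      unfold Anc at h
      rw [Walk.length_append]
      omega
    have h4 := (hG.existsUnique_path r b).unique (Walk.isPath_of_length_eq_dist _ h3) hp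
    rw [← h4, Walk.mem_support_append_iff]
    left
    exact Walk.end_mem_support _
  · intro h
    have h1 := length_eq_dist hG hp
    have h2 := length_eq_dist hG (hp.takeUntil h)
    have h3 := length_eq_dist hG (hp.dropUntil h)
    have h4 := congrArg Walk.length (p.take_spec h)
    rw [Walk.length_append] at h4
    unfold Anc
    omega

theorem Anc.total (hG : G.IsTree) {r a b c : V} (h1 : Anc G r a c) (h2 : Anc G r b c) :
    Anc G r a b ∨ Anc G r b a := by
  classical
  obtain ⟨p, hp, -⟩ := hG.existsUnique_path r c
  rw [anc_iff_mem_support hG hp] at h1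
  have h2' := (anc_iff_mem_support hG hp).1 h2
  rw [← p.take_spec h1, Walk.mem_support_append_iff] at h2'
  rcases h2' with h | h
  · right
    exact (anc_iff_mem_support hG (hp.takeUntil h1)).2 h
  · left
    have h3 := length_eq_dist hG hp
    have h4 := length_eq_dist hG (hp.takeUntil h1)
    have h5 := length_eq_dist hG (hp.dropUntil h1)
    have h6 := congrArg Walk.length (p.take_spec h1)
    have h7 := length_eq_dist hG ((hp.dropUntil h1).takeUntil h)
    have h8 := length_eq_dist hG ((hp.dropUntil h1).dropUntil h)
    have h9 := congrArg Walk.length ((p.dropUntil a h1).take_spec h)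
    rw [Walk.length_append] at h6 h9
    have := hG.1.dist_triangle (u := r) (v := b) (w := c)
    unfold Anc
    omega

/-- `g` is the end of `e` farther from the root: the path from `r` to `p` uses `e` exactly if it
visits this end. -/
theorem exists_anc_iff_not_conn (hG : G.IsTree) (r : V) {e : Sym2 V} (he : e ∈ G.edgeSet) :
    ∃ g, ∀ p, Anc G r g p ↔ ¬ Conn G e r p := by
  classical
  suffices key : ∀ a b, G.Adj a b → Conn G s(a, b) r a → ∀ p, Anc G r b p ↔ ¬ Conn G s(a, b) r p by
    induction e using Sym2.ind with
    | _ a b =>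
      have hab : G.Adj a b := he
      rcases conn_or_conn hG (u := a) (v := b) r with h | h
      · exact ⟨b, key a b hab h.symm⟩
      · refine ⟨a, ?_⟩
        have := key b a hab.symm
        rw [Sym2.eq_swap] at this
        exact this h.symm
  intro a b hab ha p
  obtain ⟨w, hw, -⟩ := hG.existsUnique_path r p
  rw [anc_iff_mem_support hG hw, conn_iff_path hG hw, not_not]
  constructor
  · intro h
    have h1 : ¬ Conn G s(a, b) r b := fun h => not_conn_edge hG hab (ha.symm.trans h)
    rw [conn_iff_path hG (hw.takeUntil h), not_not] at h1
    exact Walk.edges_takeUntil_subset_edges _ h h1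
  · exact fun h => Walk.snd_mem_support_of_mem_edges _ h

/-- Represents the edge by its lower end `g`, so that covering becomes a condition on ancestors
only: exactly one end of the pair lies below `g`. -/
theorem exists_mem_pathEdges_iff (hG : G.IsTree) (r : V) {e : Sym2 V} (he : e ∈ G.edgeSet) :
    ∃ g, ∀ p q, e ∈ pathEdges G s(p, q) ↔ ¬ (Anc G r g p ↔ Anc G r g q) := by
  obtain ⟨g, hg⟩ := exists_anc_iff_not_conn hG r he
  refine ⟨g, fun p q => ?_⟩
  rw [mem_pathEdges hG, hg, hg]
  constructor
  · intro h h2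
    by_cases hp : Conn G e r p
    · exact h (hp.symm.trans (by tauto))
    · exact h (conn_of_not_conn hG (fun h' => hp h'.symm) (by tauto))
  · intro h h2
    apply h
    exact ⟨fun h3 h4 => h3 (h4.trans h2.symm), fun h3 h4 => h3 (h4.trans h2)⟩

/-- The lowest common ancestor. -/
theorem exists_lca [Finite V] (hG : G.IsTree) (r p q : V) :
    ∃ a, Anc G r a p ∧ ∀ g, Anc G r g p → (Anc G r g a ↔ Anc G r g q) := by
  -- The deepest common ancestor; the root shows that there is one.
  obtain ⟨a, ⟨ha1, ha2⟩, hmax⟩ := Set.exists_max_image {g | Anc G r g p ∧ Anc G r g q}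
    (fun g => G.dist r g) (Set.toFinite _) ⟨r, anc_root r p, anc_root r q⟩
  refine ⟨a, ha1, fun g hg => ⟨fun h => h.trans hG ha2, fun h => ?_⟩⟩
  rcases Anc.total hG hg ha1 with h1 | h1
  · exact h1
  · by_cases hne : a = g
    · subst hne; exact h1
    · exact absurd (h1.dist_lt hG hne) (not_lt.2 (hmax g ⟨hg, h⟩))

end Tree

/-! ### Shadows and the effect of one split on weighted sums -/

section Split

variable {V : Type*} {I : WTAP V}

theorem mem_cov {F : Set (Sym2 V)} {l : Sym2 V} :
    l ∈ I.cov F ↔ l ∈ I.links ∧ (pathEdges I.graph l ∩ F).Nonempty := by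
  simp [WTAP.cov]

theorem mem_cov_singleton {e : Sym2 V} {l : Sym2 V} :
    l ∈ I.cov {e} ↔ l ∈ I.links ∧ e ∈ pathEdges I.graph l := by
  simp [mem_cov]

theorem mem_linksIn {U : Set V} {l : Sym2 V} : l ∈ I.linksIn U ↔ l ∈ I.links ∧ Inside U l := by
  simp [WTAP.linksIn]

theorem inside_mk {U : Set V} {p q : V} : Inside U s(p, q) ↔ p ∈ U ∧ q ∈ U := by
  simp [Inside]

theorem mem_side {G : SimpleGraph V} {U : Set V} {u v w : V} :
    w ∈ side G U u v ↔ w ∈ U ∧ Conn G s(u, v) u w := Iff.rfl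

theorem mem_side_swap {G : SimpleGraph V} (hG : G.IsTree) {U : Set V} {u v w : V}
    (huv : G.Adj u v) : w ∈ side G U v u ↔ w ∈ U ∧ ¬ Conn G s(u, v) u w := by
  rw [mem_side, Sym2.eq_swap]
  refine and_congr_right fun _ => ⟨fun h h' => not_conn_edge hG huv (h'.trans h.symm), fun h => ?_⟩
  exact (conn_or_conn hG w).resolve_left h

open Classical in
theorem sum_cov (F : Set (Sym2 V)) (g : Sym2 V → ℝ) :
    ∑ l ∈ I.cov F, g l = ∑ l ∈ I.links, if (pathEdges I.graph l ∩ F).Nonempty then g l else 0 := by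
  rw [WTAP.cov, Finset.sum_filter]

open Classical in
theorem sum_linksIn (U : Set V) (g : Sym2 V → ℝ) :
    ∑ l ∈ I.linksIn U, g l = ∑ l ∈ I.links, if Inside U l then g l else 0 := by
  rw [WTAP.linksIn, Finset.sum_filter]

/-- All links with nonzero value have both ends in `U`. -/
def WTAP.SupportedIn (I : WTAP V) (U : Set V) (x : Sym2 V → ℝ) : Prop :=
  ∀ l ∈ I.links, x l ≠ 0 → Inside U l

/-- Replaces the index set, which changes with `U`, by the fixed set of all links. -/
theorem WTAP.SupportedIn.sum_linksIn {U : Set V} {x : Sym2 V → ℝ} (h : I.SupportedIn U x)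
    (g : Sym2 V → ℝ) : ∑ l ∈ I.linksIn U, g l * x l = ∑ l ∈ I.links, g l * x l := by
  classical
  rw [TreeAug.sum_linksIn]
  refine Finset.sum_congr rfl fun l hl => ?_
  split_ifs with h1
  · rfl
  · rw [not_not.1 (mt (h l hl) h1), mul_zero]

/-- The pair that arises from `l` by moving the ends on the side of `v` to `u`. -/
noncomputable def shadow (G : SimpleGraph V) (u v : V) (l : Sym2 V) : Sym2 V :=
  open Classical in l.map fun w => if Conn G s(u, v) u w then w else u

/-- Orients a link that covers `uv`, so that later arguments need not distinguish its ends. -/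
theorem exists_of_covers {G : SimpleGraph V} (hG : G.IsTree) {u v : V}
    {l : Sym2 V} (hl : s(u, v) ∈ pathEdges G l) :
    ∃ p q, l = s(p, q) ∧ Conn G s(u, v) u p ∧ ¬ Conn G s(u, v) u q ∧
      shadow G u v l = s(p, u) := by
  induction l using Sym2.ind with
  | _ p q =>
    rw [mem_pathEdges hG] at hl
    by_cases hp : Conn G s(u, v) u p
    · have hq : ¬ Conn G s(u, v) u q := fun hq => hl (hp.symm.trans hq)
      exact ⟨p, q, rfl, hp, hq, by simp [shadow, hp, hq]⟩
    · have hq : Conn G s(u, v) u q :=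
        conn_of_not_conn hG (fun h => hp h) hl
      exact ⟨q, p, Sym2.eq_swap, hq, hp, by simp [shadow, hp, hq, Sym2.eq_swap]⟩

/-- Moving the far end `q` to `u` is invisible to an edge on the side of `u`, since such an edge
does not separate `u` from `q`. -/
theorem mem_pathEdges_shadow_iff {G : SimpleGraph V} (hG : G.IsTree) {u v : V} (huv : G.Adj u v)
    {l : Sym2 V} (hl : s(u, v) ∈ pathEdges G l) {a b : V} (hne : s(a, b) ≠ s(u, v))
    (ha : Conn G s(u, v) u a) :
    s(a, b) ∈ pathEdges G (shadow G u v l) ↔ s(a, b) ∈ pathEdges G l := by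
  obtain ⟨p, q, rfl, hp, hq, hs⟩ := exists_of_covers hG hl
  rw [hs, mem_pathEdges hG, mem_pathEdges hG, not_iff_not]
  have h := conn_across hG huv hne ha hq
  exact ⟨fun h1 => h1.trans h, fun h1 => h1.trans h.symm⟩

theorem pathEdges_shadow_subset {G : SimpleGraph V} (hG : G.IsTree) {u v : V} (huv : G.Adj u v)
    {l : Sym2 V} (hl : s(u, v) ∈ pathEdges G l) :
    pathEdges G (shadow G u v l) ⊆ pathEdges G l := by
  intro f hf
  induction f using Sym2.ind with
  | _ a b =>
    have hab : G.Adj a b := pathEdges_subset _ hf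
    by_cases hne : s(a, b) = s(u, v)
    · rwa [hne]
    by_cases ha : Conn G s(u, v) u a
    -- Otherwise the edge lies beyond `uv`, but both ends of the shadow lie on the side of `u`, so
    -- it is not covered.
    · exact (mem_pathEdges_shadow_iff hG huv hl hne ha).1 hf
    · exfalso
      obtain ⟨p, q, rfl, hp, hq, hs⟩ := exists_of_covers hG hl
      rw [hs, mem_pathEdges hG] at hf
      have h1 : Conn G s(v, u) v a := by
        rw [Sym2.eq_swap]; exact (conn_or_conn hG a).resolve_left ha
      have h2 : ¬ Conn G s(v, u) v p := by
        rw [Sym2.eq_swap]; exact fun h => not_conn_edge hG huv (hp.trans h.symm)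
      have h3 := conn_across hG huv.symm (by rwa [Sym2.eq_swap (a := v)]) h1 h2
      exact hf (h3.symm.trans (conn_of_adj huv.symm (by rw [Sym2.eq_swap (a := v)]; exact fun h => hne h.symm)))

theorem shadow_mem_links (hs : I.ShadowComplete) {u v : V} (huv : I.graph.Adj u v) {l : Sym2 V}
    (hl : l ∈ I.cov {s(u, v)}) (hd : ¬ (shadow I.graph u v l).IsDiag) :
    shadow I.graph u v l ∈ I.links ∧ I.cost (shadow I.graph u v l) ≤ I.cost l := by
  rw [mem_cov_singleton] at hl
  exact hs l hl.1 _ hd (pathEdges_shadow_subset I.isTree huv hl.2)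

-- Transposes the definition of `WTAP.split`: rather than collecting at each link what it receives,
-- each covering link sends its amount to its shadow. A shadow that degenerates to a single node
-- receives nothing.
open Classical in
theorem sum_mul_split (hs : I.ShadowComplete) {U : Set V} {x : Sym2 V → ℝ}
    (hx : I.SupportedIn U x) {u v : V} (huv : I.graph.Adj u v) (g : Sym2 V → ℝ) :
    ∑ l ∈ I.links, g l * I.split U x u v l =
      ∑ l ∈ I.linksIn (side I.graph U u v), g l * x l +
      ∑ l ∈ I.cov {s(u, v)}, if (shadow I.graph u v l).IsDiag then 0 else
        g (shadow I.graph u v l) * (I.cost l / I.cost (shadow I.graph u v l) * x l) := by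
  have h1 : ∀ l, I.split U x u v l = (if Inside (side I.graph U u v) l then x l else 0) +
      ∑ l' ∈ I.cov {s(u, v)}, if l = shadow I.graph u v l' then
        I.cost l' / I.cost l * x l' else 0 := by
    intro l
    unfold WTAP.split
    congr 1
    rw [Finset.sum_filter]
    refine Finset.sum_congr rfl fun l' hl' => ?_
    -- If `x l'` is nonzero, both ends of `l'` lie in `U`, and exactly one is on the side of `u`.
    -- The condition in `WTAP.split` then says that `l` is the shadow of `l'`.
    by_cases h0 : x l' = 0
    · simp [h0]
    rw [mem_cov_singleton] at hl'
    have hin := hx l' hl'.1 h0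
    obtain ⟨p, q, rfl, hp, hq, hsh⟩ := exists_of_covers I.isTree hl'.2
    rw [inside_mk] at hin
    rw [hsh]
    refine if_congr ?_ rfl rfl
    constructor
    · rintro ⟨p', hp', hpm, rfl⟩
      rcases Sym2.mem_iff.1 hpm with rfl | rfl
      · rfl
      · exact absurd hp'.2 hq
    · rintro rfl
      exact ⟨p, ⟨hin.1, hp⟩, by simp, rfl⟩
  simp_rw [h1, mul_add, Finset.sum_add_distrib]
  congr 1
  · rw [sum_linksIn]
    refine Finset.sum_congr rfl fun l _ => ?_
    split_ifs <;> simp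
  · simp_rw [Finset.mul_sum]
    rw [Finset.sum_comm]
    refine Finset.sum_congr rfl fun l hl => ?_
    simp only [mul_ite, mul_zero, Finset.sum_ite_eq']
    by_cases hd : (shadow I.graph u v l).IsDiag
    · rw [if_pos hd, if_neg fun h => I.loopless _ h hd]
    · rw [if_neg hd, if_pos (shadow_mem_links hs huv hl hd).1]

/-- The links with nonzero value are split into those on either side of the edge and those that
cover it. -/
theorem sum_partition {U : Set V} {x : Sym2 V → ℝ} (hx : I.SupportedIn U x) {u v : V}
    (huv : I.graph.Adj u v) (g : Sym2 V → ℝ) :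
    ∑ l ∈ I.links, g l * x l = ∑ l ∈ I.linksIn (side I.graph U u v), g l * x l +
      ∑ l ∈ I.linksIn (side I.graph U v u), g l * x l + ∑ l ∈ I.cov {s(u, v)}, g l * x l := by
  classical
  rw [sum_linksIn, sum_linksIn, sum_cov, ← Finset.sum_add_distrib, ← Finset.sum_add_distrib]
  refine Finset.sum_congr rfl fun l hl => ?_
  by_cases h0 : x l = 0
  · simp [h0]
  have hin := hx l hl h0
  induction l using Sym2.ind with
  | _ p q =>
    rw [inside_mk] at hin
    simp only [inside_mk, mem_side_swap I.isTree huv, mem_side, hin.1, hin.2, true_and,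
      Set.inter_singleton_nonempty, mem_pathEdges I.isTree]
    by_cases hp : Conn I.graph s(u, v) u p <;> by_cases hq : Conn I.graph s(u, v) u q
    · have := hp.symm.trans hq
      simp [hp, hq, this]
    · have : ¬ Conn I.graph s(u, v) p q := fun h => hq (hp.trans h)
      simp [hp, hq, this]
    · have : ¬ Conn I.graph s(u, v) p q := fun h => hp (hq.trans h.symm)
      simp [hp, hq, this]
    · have : Conn I.graph s(u, v) p q :=
        conn_of_not_conn I.isTree (fun h => hp h.symm) hq
      simp [hp, hq, this]

/-- Splitting along `uv` does not change sums weighted by costs, if the weights do not see the side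
of `v`. -/
theorem sum_cost_split_eq (hs : I.ShadowComplete) (hc : ∀ l ∈ I.links, 1 ≤ I.cost l) {U : Set V}
    {x : Sym2 V → ℝ} (hx : I.SupportedIn U x) {u v : V} (huv : I.graph.Adj u v) (m : Sym2 V → ℝ)
    (h1 : ∀ l, Inside (side I.graph U v u) l → m l = 0) (h2 : ∀ l : Sym2 V, l.IsDiag → m l = 0)
    (h3 : ∀ l ∈ I.cov {s(u, v)}, m (shadow I.graph u v l) = m l) :
    ∑ l ∈ I.links, m l * (I.cost l * I.split U x u v l) =
      ∑ l ∈ I.links, m l * (I.cost l * x l) := by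
  classical
  simp_rw [← mul_assoc]
  rw [sum_mul_split hs hx huv, sum_partition hx huv]
  have h4 : ∑ l ∈ I.linksIn (side I.graph U v u), m l * I.cost l * x l = 0 :=
    Finset.sum_eq_zero fun l hl => by rw [h1 l (mem_linksIn.1 hl).2]; ring
  rw [h4, add_zero]
  congr 1
  refine Finset.sum_congr rfl fun l hl => ?_
  split_ifs with hd
  · rw [← h3 l hl, h2 _ hd]; ring
  · have h5 := hc _ (shadow_mem_links hs huv hl hd).1
    rw [h3 l hl]
    -- The scaling factor cancels the cost of the shadow.
    field_simp

/-- Splitting along `uv` does not decrease sums with weights that do not see the side of `v`. -/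
theorem sum_le_sum_split (hs : I.ShadowComplete) (hc : ∀ l ∈ I.links, 1 ≤ I.cost l) {U : Set V}
    {x : Sym2 V → ℝ} (hx : I.SupportedIn U x) (hx0 : ∀ l ∈ I.links, 0 ≤ x l) {u v : V}
    (huv : I.graph.Adj u v) (m : Sym2 V → ℝ) (h0 : ∀ l, 0 ≤ m l)
    (h1 : ∀ l, Inside (side I.graph U v u) l → m l = 0) (h2 : ∀ l : Sym2 V, l.IsDiag → m l = 0)
    (h3 : ∀ l ∈ I.cov {s(u, v)}, m (shadow I.graph u v l) = m l) :
    ∑ l ∈ I.links, m l * x l ≤ ∑ l ∈ I.links, m l * I.split U x u v l := by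
  classical
  rw [sum_mul_split hs hx huv, sum_partition hx huv]
  have h4 : ∑ l ∈ I.linksIn (side I.graph U v u), m l * x l = 0 :=
    Finset.sum_eq_zero fun l hl => by rw [h1 l (mem_linksIn.1 hl).2]; ring
  rw [h4, add_zero]
  gcongr with l hl
  split_ifs with hd
  · rw [← h3 l hl, h2 _ hd]; simp
  · have h5 := shadow_mem_links hs huv hl hd
    have h6 := hc _ h5.1
    rw [h3 l hl]
    refine mul_le_mul_of_nonneg_left ?_ (h0 l)
    -- The scaling factor is at least one, as a shadow is not more expensive than its link.
    refine le_mul_of_one_le_left (hx0 l (mem_cov.1 hl).1) ?_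
    rw [one_le_div (by linarith)]
    exact h5.2

theorem split_nonneg (hc : ∀ l ∈ I.links, 1 ≤ I.cost l) {U : Set V} {x : Sym2 V → ℝ}
    (hx0 : ∀ l ∈ I.links, 0 ≤ x l) {u v : V} : ∀ l ∈ I.links, 0 ≤ I.split U x u v l := by
  classical
  intro l hl
  unfold WTAP.split
  refine add_nonneg ?_ (Finset.sum_nonneg fun l' hl' => ?_)
  · split_ifs
    · exact hx0 l hl
    · exact le_rfl
  · have h1 := (mem_cov.1 (Finset.mem_filter.1 hl').1).1
    have := hc l hl
    have := hc l' h1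
    have := hx0 l' h1
    positivity

theorem split_supportedIn {U : Set V} {x : Sym2 V → ℝ} {u v : V} (hu : u ∈ U) :
    I.SupportedIn (side I.graph U u v) (I.split U x u v) := by
  classical
  intro l _ h
  by_contra hin
  apply h
  unfold WTAP.split
  rw [if_neg hin, zero_add]
  refine Finset.sum_eq_zero fun l' hl' => ?_
  obtain ⟨-, p, hp, -, rfl⟩ := Finset.mem_filter.1 hl'
  exact absurd (inside_mk.2 ⟨hp, hu, Reachable.refl _⟩) hin

theorem costIn_le_fracCost (hc : ∀ l ∈ I.links, 1 ≤ I.cost l) {x : Sym2 V → ℝ}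
    (hx0 : ∀ l ∈ I.links, 0 ≤ x l) (W : Set V) : I.costIn x W ≤ I.fracCost x := by
  classical
  refine Finset.sum_le_sum_of_subset_of_nonneg (Finset.filter_subset _ _) fun l hl _ => ?_
  have := hc l hl
  have := hx0 l hl
  positivity

/-- Links inside the side keep their values; the shadows only add cost. Hence a thin edge leaves two
expensive pieces. -/
theorem costIn_le_fracCost_split (hs : I.ShadowComplete) (hc : ∀ l ∈ I.links, 1 ≤ I.cost l)
    {U : Set V} {x : Sym2 V → ℝ} (hx : I.SupportedIn U x) (hx0 : ∀ l ∈ I.links, 0 ≤ x l) {u v : V}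
    (huv : I.graph.Adj u v) :
    I.costIn x (side I.graph U u v) ≤ I.fracCost (I.split U x u v) := by
  classical
  unfold WTAP.costIn WTAP.fracCost
  rw [sum_mul_split hs hx huv]
  refine le_add_of_nonneg_right (Finset.sum_nonneg fun l hl => ?_)
  split_ifs with hd
  · exact le_rfl
  · have h1 := hc _ (shadow_mem_links hs huv hl hd).1
    have h2 := hc _ (mem_cov.1 hl).1
    have h3 := hx0 _ (mem_cov.1 hl).1
    positivity

/-- A covering link carries its cost over to its shadow unchanged, or loses it if the shadow
degenerates. -/
theorem fracCost_split_le (hs : I.ShadowComplete) (hc : ∀ l ∈ I.links, 1 ≤ I.cost l)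
    {U : Set V} {x : Sym2 V → ℝ} (hx : I.SupportedIn U x) (hx0 : ∀ l ∈ I.links, 0 ≤ x l) {u v : V}
    (huv : I.graph.Adj u v) :
    I.fracCost (I.split U x u v) ≤ I.costIn x (side I.graph U u v) +
      ∑ l ∈ I.cov {s(u, v)}, I.cost l * x l := by
  classical
  unfold WTAP.costIn WTAP.fracCost
  rw [sum_mul_split hs hx huv]
  gcongr with l hl
  have h2 := hc _ (mem_cov.1 hl).1
  have h3 := hx0 _ (mem_cov.1 hl).1
  split_ifs with hd
  · positivity
  · have h1 := hc _ (shadow_mem_links hs huv hl hd).1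
    apply le_of_eq
    field_simp

/-- The two vectors that arise by splitting along `uv` together cost at most the cost of the
vector plus that of the links that cover `uv`. -/
theorem fracCost_split_add_le (hs : I.ShadowComplete) (hc : ∀ l ∈ I.links, 1 ≤ I.cost l)
    {U : Set V} {x : Sym2 V → ℝ} (hx : I.SupportedIn U x) (hx0 : ∀ l ∈ I.links, 0 ≤ x l) {u v : V}
    (huv : I.graph.Adj u v) :
    I.fracCost (I.split U x u v) + I.fracCost (I.split U x v u) ≤
      I.fracCost x + ∑ l ∈ I.cov {s(u, v)}, I.cost l * x l := by
  have h1 := fracCost_split_le hs hc hx hx0 huv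
  have h2 := fracCost_split_le hs hc hx hx0 huv.symm
  have h3 : I.fracCost x = _ := sum_partition hx huv I.cost
  rw [Sym2.eq_swap] at h2
  unfold WTAP.costIn at h1 h2
  linarith

end Split

/-! ### Invariants of pieces and the cost of a decomposition -/

section Decomposition

variable {V : Type*} {I : WTAP V}

/-- The properties of the pairs `(U, x)` of a decomposition that splitting preserves. -/
structure WTAP.IsPiece (I : WTAP V) (γ : ℕ) (D : Set (Sym2 V)) (μ : ℝ) (U : Set V)
    (x : Sym2 V → ℝ) : Prop where
  nonempty : U.Nonempty
  convex : ∀ a ∈ U, ∀ b ∈ U, ∀ p : I.graph.Walk a b, p.IsPath → ∀ w ∈ p.support, w ∈ U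
  closed : ∀ a ∈ U, node D a ⊆ U
  supported : I.SupportedIn U x
  oddCut : I.OddCutFeasible D U x
  bundle : I.BundleFeasible γ D U x
  coverCost : ∀ f ∈ edgesIn I.graph D U, ∑ l ∈ I.cov {f}, I.cost l * x l < μ

theorem contracted_subset (S : Finset (Sym2 V)) : I.contracted S ⊆ I.graph.edgeSet := by
  refine Set.iUnion₂_subset fun l _ => pathEdges_subset l

/-- An edge other than `uv` has both ends on the same side, so it suffices to locate one of them. -/
theorem edgesIn_side {D : Set (Sym2 V)} {U : Set V} {u v a b : V} :
    s(a, b) ∈ edgesIn I.graph D (side I.graph U u v) ↔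
      s(a, b) ∈ edgesIn I.graph D U ∧ s(a, b) ≠ s(u, v) ∧ Conn I.graph s(u, v) u a := by
  simp only [edgesIn, Set.mem_ofPred_eq, inside_mk, mem_side]
  constructor
  · rintro ⟨h1, h2, ⟨h3, h4⟩, h5, h6⟩
    refine ⟨⟨h1, h2, h3, h5⟩, fun h => ?_, h4⟩
    have h7 : Conn I.graph s(a, b) a b := by rw [h]; exact h4.symm.trans h6
    exact not_conn_edge I.isTree h1 h7
  · rintro ⟨⟨h1, h2, h3, h5⟩, h6, h4⟩
    exact ⟨h1, h2, ⟨h3, h4⟩, h5, h4.trans (conn_of_adj h1 h6)⟩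

theorem pathEdges_inter_eq {D : Set (Sym2 V)} {U : Set V} {u v : V} (huv : I.graph.Adj u v)
    {F : Set (Sym2 V)} (hF : F ⊆ edgesIn I.graph D (side I.graph U u v)) {l : Sym2 V}
    (hl : s(u, v) ∈ pathEdges I.graph l) :
    pathEdges I.graph (shadow I.graph u v l) ∩ F = pathEdges I.graph l ∩ F := by
  ext f
  refine and_congr_left fun hf => ?_
  induction f using Sym2.ind with
  | _ a b =>
    obtain ⟨-, h2, h3⟩ := edgesIn_side.1 (hF hf)
    exact mem_pathEdges_shadow_iff I.isTree huv hl h2 h3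

theorem pathEdges_inter_eq_empty {D : Set (Sym2 V)} {U : Set V} {u v : V} (huv : I.graph.Adj u v)
    {F : Set (Sym2 V)} (hF : F ⊆ edgesIn I.graph D (side I.graph U u v)) {l : Sym2 V}
    (hl : Inside (side I.graph U v u) l) : pathEdges I.graph l ∩ F = ∅ := by
  ext f
  simp only [Set.mem_inter_iff, Set.mem_empty_iff_false, iff_false, not_and]
  intro h hf
  induction f using Sym2.ind with
  | _ a b =>
    obtain ⟨-, h2, h3⟩ := edgesIn_side.1 (hF hf)
    induction l using Sym2.ind with
    | _ p q =>
      rw [inside_mk, mem_side_swap I.isTree huv, mem_side_swap I.isTree huv] at hl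
      rw [mem_pathEdges I.isTree] at h
      exact h ((conn_across I.isTree huv h2 h3 hl.1.2).symm.trans
        (conn_across I.isTree huv h2 h3 hl.2.2))

theorem pathEdges_diag {G : SimpleGraph V} (hG : G.IsTree) {l : Sym2 V} (hl : l.IsDiag) :
    pathEdges G l = ∅ := by
  induction l using Sym2.ind with
  | _ p q =>
    obtain rfl : p = q := by simpa using hl
    ext f
    simp [mem_pathEdges hG]

/-- The side of `v` joins `S` exactly if `u` does, so neither `uv` nor an edge beyond it is cut. -/
theorem cut_side {D : Set (Sym2 V)} {U S : Set V} {u v : V} (huv : I.graph.Adj u v)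
    (hS : S ⊆ side I.graph U u v) :
    cut I.graph D U (S ∪ {w | w ∈ side I.graph U v u ∧ u ∈ S}) =
      cut I.graph D (side I.graph U u v) S := by
  ext f
  constructor
  · rintro ⟨hf, a, b, ha, hb, rfl⟩
    have hin := inside_mk.1 hf.2.2
    simp only [Set.mem_union, Set.mem_ofPred_eq, not_or, not_and,
      mem_side_swap I.isTree huv] at ha hb
    have hne : s(a, b) ≠ s(u, v) := by
      intro h
      rcases Sym2.eq_iff.1 h with ⟨rfl, rfl⟩ | ⟨rfl, rfl⟩
      · rcases ha with ha | ha
        · exact hb.2 ⟨hin.2, not_conn_edge I.isTree huv⟩ ha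
        · exact hb.2 ⟨hin.2, not_conn_edge I.isTree huv⟩ ha.2
      · rcases ha with ha | ha
        · exact not_conn_edge I.isTree huv (hS ha).2
        · exact hb.1 ha.2
    have hab := conn_of_adj hf.1 hne
    rcases ha with ha | ha
    · exact ⟨edgesIn_side.2 ⟨hf, hne, (hS ha).2⟩, a, b, ha, hb.1, rfl⟩
    · exact absurd ha.2 (hb.2 ⟨hin.2, fun h => ha.1.2 (h.trans hab.symm)⟩)
  · rintro ⟨hf, a, b, ha, hb, rfl⟩
    have h1 := edgesIn_side.1 hf
    refine ⟨h1.1, a, b, Or.inl ha, ?_, rfl⟩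
    simp only [Set.mem_union, Set.mem_ofPred_eq, not_or, not_and, mem_side_swap I.isTree huv]
    exact ⟨hb, fun h => absurd (h1.2.2.trans (conn_of_adj h1.1.1 h1.2.1)) h.2⟩

theorem WTAP.IsPiece.nonneg {γ : ℕ} {D : Set (Sym2 V)} {μ : ℝ} {U : Set V} {x : Sym2 V → ℝ}
    (h : I.IsPiece γ D μ U x) : ∀ l ∈ I.links, 0 ≤ x l := h.oddCut.1

theorem side_closed {D : Set (Sym2 V)} (hD : D ⊆ I.graph.edgeSet) {U : Set V}
    (hU : ∀ a ∈ U, node D a ⊆ U) {u v : V} (he : s(u, v) ∉ D) :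
    ∀ a ∈ side I.graph U u v, node D a ⊆ side I.graph U u v :=
  fun a ha _ hw => ⟨hU a ha.1 hw, ha.2.trans (conn_of_mem_node hD he hw)⟩

/-- One side of a split is again a piece. -/
theorem WTAP.IsPiece.split [Finite V] (hs : I.ShadowComplete) (hc : ∀ l ∈ I.links, 1 ≤ I.cost l) {γ : ℕ}
    {D : Set (Sym2 V)} (hD : D ⊆ I.graph.edgeSet) {μ : ℝ} {U : Set V} {x : Sym2 V → ℝ}
    (h : I.IsPiece γ D μ U x) {u v : V} (he : s(u, v) ∈ edgesIn I.graph D U) :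
    I.IsPiece γ D μ (side I.graph U u v) (I.split U x u v) := by
  classical
  have huv : I.graph.Adj u v := he.1
  have hin := inside_mk.1 he.2.2
  -- The indicator of covering `F` vanishes on links beyond `uv` and does not change when a link is
  -- replaced by its shadow. This serves both the bundle constraints and the cover cost of single
  -- edges.
  have hcov : ∀ F ⊆ edgesIn I.graph D (side I.graph U u v),
      ∑ l ∈ I.cov F, I.cost l * I.split U x u v l = ∑ l ∈ I.cov F, I.cost l * x l := by
    intro F hF
    have := sum_cost_split_eq hs hc h.supported huv
      (fun l => if (pathEdges I.graph l ∩ F).Nonempty then 1 else 0)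
      (fun l hl => by simp [pathEdges_inter_eq_empty huv hF hl])
      (fun l hl => by simp [pathEdges_diag I.isTree hl])
      (fun l hl => by simp only [pathEdges_inter_eq huv hF (mem_cov_singleton.1 hl).2])
    simpa [sum_cov] using this
  have hclosed := side_closed hD h.closed he.2.1
  have hclosed' := side_closed (I := I) (u := v) (v := u) hD h.closed (by rw [Sym2.eq_swap]; exact he.2.1)
  refine ⟨⟨u, hin.1, Reachable.refl _⟩, ?_, hclosed, split_supportedIn hin.1, ⟨?_, ?_⟩, ?_, ?_⟩
  · intro a ha b hb p hp w hw
    refine ⟨h.convex a ha.1 b hb.1 p hp w hw, ha.2.trans ?_⟩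
    have h1 := (conn_iff_path I.isTree hp).1 (ha.2.symm.trans hb.2)
    exact (conn_iff_path I.isTree (hp.takeUntil hw)).2
      fun h' => h1 (Walk.edges_takeUntil_subset_edges _ hw h')
  · exact split_nonneg hc h.nonneg
  · intro S hS hodd
    rw [(split_supportedIn hin.1).sum_linksIn]
    rw [← cut_side huv hS.1] at hodd
    have h1 := h.oddCut.2 (S ∪ {w | w ∈ side I.graph U v u ∧ u ∈ S}) ⟨?_, ?_⟩ hodd
    · rw [cut_side huv hS.1, h.supported.sum_linksIn] at h1
      have hF : cut I.graph D (side I.graph U u v) S ⊆ edgesIn I.graph D (side I.graph U u v) :=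
        fun f hf => hf.1
      refine h1.trans (sum_le_sum_split hs hc h.supported h.nonneg huv _ (fun l => by positivity)
        (fun l hl => ?_) (fun l hl => ?_) (fun l hl => ?_))
      · simp [pathEdges_inter_eq_empty huv hF hl]
      · simp [pathEdges_diag I.isTree hl]
      · simp only [pathEdges_inter_eq huv hF (mem_cov_singleton.1 hl).2]
    · rintro w (hw | hw)
      · exact (hS.1 hw).1
      · exact hw.1.1
    · rintro a (ha | ha) w hw
      · exact Or.inl (hS.2 a ha hw)
      · exact Or.inr ⟨hclosed' a ha.1 hw, ha.2⟩
  · intro B hB hBU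
    rw [hcov B hBU]
    refine h.bundle B hB (hBU.trans fun f hf => ?_)
    induction f using Sym2.ind with
    | _ a b => exact (edgesIn_side.1 hf).1
  · intro f hf
    rw [hcov {f} (by simpa using hf)]
    refine h.coverCost f ?_
    induction f using Sym2.ind with
    | _ a b => exact (edgesIn_side.1 hf).1

/-- The whole contracted tree is a piece. -/
theorem isPiece_univ {γ : ℕ} {x : Sym2 V → ℝ} {M ε : ℝ} (hM : 1 ≤ M)
    (hc : ∀ l ∈ I.links, 1 ≤ I.cost l ∧ I.cost l ≤ M) (hx : I.OddCutBundleFeasible γ x)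
    {Lh : Finset (Sym2 V)} (hLh : I.Covers Lh (I.heavy ε x)) :
    I.IsPiece γ (I.contracted Lh) (2 * M / ε) Set.univ x := by
  have hedges : edgesIn I.graph (I.contracted Lh) Set.univ ⊆ edgesIn I.graph ∅ Set.univ :=
    fun f hf => ⟨hf.1, by simp, hf.2.2⟩
  refine ⟨?_, by simp, by simp, fun l _ _ w _ => Set.mem_univ w, ⟨hx.1.1, ?_⟩, ?_, ?_⟩
  · have := I.isTree.1.nonempty
    exact Set.univ_nonempty
  · intro S hS hodd
    -- A union of contraction classes is never cut by a contracted edge.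
    have hcut : cut I.graph (I.contracted Lh) Set.univ S = cut I.graph ∅ Set.univ S := by
      ext f
      refine ⟨fun hf => ⟨hedges hf.1, hf.2⟩, ?_⟩
      rintro ⟨hf, a, b, ha, hb, rfl⟩
      refine ⟨⟨hf.1, fun h => hb (hS.2 a ha (mem_node_of_mem h)), hf.2.2⟩, a, b, ha, hb, rfl⟩
    rw [hcut] at hodd ⊢
    refine hx.1.2 S ⟨hS.1, fun a ha => ?_⟩ hodd
    simpa [node_empty] using ha
  · exact fun B hB hBU => hx.2 B hB (hBU.trans hedges)
  · intro f hf
    have h1 : ∑ l ∈ I.cov {f}, x l < 2 / ε := by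
      by_contra h
      -- A heavy edge is covered by `Lh`, hence contracted, and cannot be `f`.
      obtain ⟨l, hl, hfl⟩ := hLh f ⟨hf.1, not_lt.1 h⟩
      exact hf.2.1 (Set.mem_biUnion hl hfl)
    calc ∑ l ∈ I.cov {f}, I.cost l * x l ≤ ∑ l ∈ I.cov {f}, M * x l := by
          refine Finset.sum_le_sum fun l hl => ?_
          have hl' := (mem_cov.1 hl).1
          exact mul_le_mul_of_nonneg_right (hc l hl').2 (hx.1.1 l hl')
      _ = M * ∑ l ∈ I.cov {f}, x l := by rw [Finset.mul_sum]
      _ < M * (2 / ε) := by gcongr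
      _ = 2 * M / ε := by ring

/-- An induction principle for decompositions: what holds for the initial pair and is inherited
by both sides of a split holds for all resulting pairs. -/
theorem WTAP.ThinDecomp.forall_piece {α : ℝ} {D : Set (Sym2 V)} {U : Set V} {x : Sym2 V → ℝ}
    {P : List (Set V × (Sym2 V → ℝ))} {E : Set (Sym2 V)} (h : I.ThinDecomp α D U x P E)
    (Q : Set V → (Sym2 V → ℝ) → Prop) (h0 : Q U x)
    (hstep : ∀ U x u v, Q U x → I.IsThin α D U x u v →
      Q (side I.graph U u v) (I.split U x u v)) :
    ∀ H ∈ P, Q H.1 H.2 ∧ ∀ u v, ¬ I.IsThin α D H.1 H.2 u v := by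
  induction h with
  | done U x h => simpa using ⟨h0, h⟩
  | step U x u v ht P₁ P₂ E₁ E₂ _ _ ih₁ ih₂ =>
    intro H hH
    rcases List.mem_append.1 hH with hH | hH
    · exact ih₁ (hstep U x u v h0 ht) H hH
    · refine ih₂ (hstep U x v u h0 ⟨?_, ht.2.2, ht.2.1⟩) H hH
      rw [Sym2.eq_swap]
      exact ht.1

theorem WTAP.ThinDecomp.subset {α : ℝ} {D : Set (Sym2 V)} {U : Set V} {x : Sym2 V → ℝ}
    {P : List (Set V × (Sym2 V → ℝ))} {E : Set (Sym2 V)} (h : I.ThinDecomp α D U x P E) :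
    ∀ H ∈ P, H.1 ⊆ U := by
  intro H hH
  exact (h.forall_piece (fun W _ => W ⊆ U) subset_rfl
    (fun _ _ _ _ h _ => subset_trans (fun _ hw => hw.1) h) H hH).1

theorem WTAP.ThinDecomp.pairwise_disjoint {α : ℝ} {D : Set (Sym2 V)} {U : Set V} {x : Sym2 V → ℝ}
    {P : List (Set V × (Sym2 V → ℝ))} {E : Set (Sym2 V)} (h : I.ThinDecomp α D U x P E) :
    P.Pairwise fun H H' => Disjoint H.1 H'.1 := by
  induction h with
  | done U x h => simp
  | step U x u v ht P₁ P₂ E₁ E₂ h₁ h₂ ih₁ ih₂ =>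
    refine List.pairwise_append.2 ⟨ih₁, ih₂, fun H hH H' hH' => ?_⟩
    refine Set.disjoint_of_subset (h₁.subset H hH) (h₂.subset H' hH') ?_
    rw [Set.disjoint_left]
    intro w hw hw'
    exact ((mem_side_swap I.isTree ht.1.1).1 hw').2 hw.2

theorem disjoint_supp {U W : Set V} {x y : Sym2 V → ℝ} (hx : I.SupportedIn U x)
    (hy : I.SupportedIn W y) (hUW : Disjoint U W) : Disjoint (I.supp x) (I.supp y) := by
  rw [Set.disjoint_left]
  rintro l ⟨hl, h1⟩ ⟨-, h2⟩
  have h3 := hx l hl h1.ne'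
  have h4 := hy l hl h2.ne'
  induction l using Sym2.ind with
  | _ p q => exact Set.disjoint_left.1 hUW (inside_mk.1 h3).1 (inside_mk.1 h4).1

theorem WTAP.ThinDecomp.edges_subset {α : ℝ} {D : Set (Sym2 V)} {U : Set V} {x : Sym2 V → ℝ}
    {P : List (Set V × (Sym2 V → ℝ))} {E : Set (Sym2 V)} (h : I.ThinDecomp α D U x P E) :
    E ⊆ I.graph.edgeSet := by
  induction h with
  | done U x h => simp
  | step U x u v ht P₁ P₂ E₁ E₂ h₁ h₂ ih₁ ih₂ =>
    exact Set.insert_subset ht.1.1 (Set.union_subset ih₁ ih₂)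

/-- Each split raises the number of pairs by one and contributes at most one new edge. -/
theorem WTAP.ThinDecomp.ncard_edges_lt {α : ℝ} {D : Set (Sym2 V)} {U : Set V} {x : Sym2 V → ℝ}
    {P : List (Set V × (Sym2 V → ℝ))} {E : Set (Sym2 V)} (h : I.ThinDecomp α D U x P E) :
    E.ncard + 1 ≤ P.length := by
  induction h with
  | done U x h => simp
  | step U x u v ht P₁ P₂ E₁ E₂ h₁ h₂ ih₁ ih₂ =>
    have h1 := Set.ncard_insert_le s(u, v) (E₁ ∪ E₂)
    have h2 := Set.ncard_union_le E₁ E₂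
    rw [List.length_append]
    omega

/-- There are `P.length - 1` splits, and each duplicates at most the cost of the links covering its
edge, which `coverCost` bounds by `μ`. -/
theorem WTAP.ThinDecomp.sum_fracCost_le [Finite V] (hs : I.ShadowComplete)
    (hc : ∀ l ∈ I.links, 1 ≤ I.cost l) {γ : ℕ} {D : Set (Sym2 V)} (hD : D ⊆ I.graph.edgeSet) {μ : ℝ}
    {α : ℝ} {U : Set V} {x : Sym2 V → ℝ} (hU : I.IsPiece γ D μ U x)
    {P : List (Set V × (Sym2 V → ℝ))} {E : Set (Sym2 V)} (h : I.ThinDecomp α D U x P E) :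
    (P.map fun H => I.fracCost H.2).sum ≤ I.fracCost x + (P.length - 1 : ℝ) * μ := by
  induction h with
  | done U x h => simp
  | step U x u v ht P₁ P₂ E₁ E₂ h₁ h₂ ih₁ ih₂ =>
    have ht' : s(v, u) ∈ edgesIn I.graph D U := by rw [Sym2.eq_swap]; exact ht.1
    have h3 := ih₁ (hU.split hs hc hD ht.1)
    have h4 := ih₂ (hU.split hs hc hD ht')
    have h5 := fracCost_split_add_le hs hc hU.supported hU.nonneg ht.1.1
    have h6 := hU.coverCost _ ht.1
    rw [List.map_append, List.sum_append, List.length_append]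
    push_cast
    linarith

/-- Unless no split is made, each resulting vector costs at least the thinness threshold. -/
theorem WTAP.ThinDecomp.le_fracCost [Finite V] (hs : I.ShadowComplete)
    (hc : ∀ l ∈ I.links, 1 ≤ I.cost l) {γ : ℕ} {D : Set (Sym2 V)} (hD : D ⊆ I.graph.edgeSet) {μ : ℝ}
    {α : ℝ} {U : Set V} {x : Sym2 V → ℝ} (hU : I.IsPiece γ D μ U x)
    {P : List (Set V × (Sym2 V → ℝ))} {E : Set (Sym2 V)} (h : I.ThinDecomp α D U x P E) :
    P = [(U, x)] ∨ ∀ H ∈ P, α ≤ I.fracCost H.2 := by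
  cases h with
  | done _ _ h => exact Or.inl rfl
  | step _ _ u v ht P₁ P₂ E₁ E₂ h₁ h₂ =>
    right
    have ht2 : s(v, u) ∈ edgesIn I.graph D U := by rw [Sym2.eq_swap]; exact ht.1
    -- The invariant "cost at least `α`" is created at the first split and renewed by each later
    -- one, since thinness puts cost `α` strictly inside either side.
    have hstep : ∀ U x u v, (I.IsPiece γ D μ U x ∧ α ≤ I.fracCost x) → I.IsThin α D U x u v →
        (I.IsPiece γ D μ (side I.graph U u v) (I.split U x u v) ∧
          α ≤ I.fracCost (I.split U x u v)) := fun U x u v hU ht =>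
      ⟨hU.1.split hs hc hD ht.1, ht.2.1.trans
        (costIn_le_fracCost_split hs hc hU.1.supported hU.1.nonneg ht.1.1)⟩
    have hU' : I.IsPiece γ D μ U x ∧ α ≤ I.fracCost x :=
      ⟨hU, ht.2.1.trans (costIn_le_fracCost hc hU.nonneg _)⟩
    intro H hH
    rcases List.mem_append.1 hH with hH | hH
    · exact (h₁.forall_piece _ (hstep U x u v hU' ht) hstep H hH).1.2
    · exact (h₂.forall_piece _ (hstep U x v u hU' ⟨ht2, ht.2.2, ht.2.1⟩) hstep H hH).1.2

end Decomposition

/-! ### Light branches, few leaves, and the center -/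

section Simplicity

variable {V : Type*} {I : WTAP V} {γ : ℕ} {D : Set (Sym2 V)} {μ : ℝ} {U : Set V} {x : Sym2 V → ℝ}

/-- Branches are defined as connected components, whereas costs and cuts are controlled for sides of
edges; a branch is the side of the edge that joins it to the node of `v`. -/
theorem exists_edge_of_isBranch (hD : D ⊆ I.graph.edgeSet) (hU : I.IsPiece γ D μ U x) {v : V}
    (hv : v ∈ U) {K : Set V} (hK : IsBranch I.graph D U v K) :
    ∃ a b, b ∈ node D v ∧ s(a, b) ∈ edgesIn I.graph D U ∧ K = side I.graph U a b := by
  classical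
  obtain ⟨C, rfl⟩ := hK
  obtain ⟨w₀, rfl⟩ := C.exists_rep
  obtain ⟨p, hp, -⟩ := I.isTree.existsUnique_path (w₀ : V) v
  have hmemK : ∀ w, w ∈ Subtype.val '' ((I.graph.induce (U \ node D v)).connectedComponentMk w₀).supp ↔
      ∃ h : w ∈ U \ node D v, (I.graph.induce (U \ node D v)).Reachable ⟨w, h⟩ w₀ := by
    intro w
    constructor
    · rintro ⟨w', hw', rfl⟩
      exact ⟨w'.2, ConnectedComponent.exact hw'⟩
    · rintro ⟨h, h'⟩
      exact ⟨⟨w, h⟩, ConnectedComponent.sound h', rfl⟩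
  -- An edge on which the path from `w₀` to `v` leaves the component. Its head belongs to `U` by
  -- convexity, so it must lie in the node of `v`, for otherwise it would be in the component.
  obtain ⟨d, hd, hdK, hdK'⟩ := p.exists_boundary_dart
    (Subtype.val '' ((I.graph.induce (U \ node D v)).connectedComponentMk w₀).supp)
    ((hmemK _).2 ⟨w₀.2, Reachable.refl _⟩) (fun h => ((hmemK _).1 h).1.2 (mem_node_self D v))
  have hsndU : d.snd ∈ U := hU.convex _ w₀.2.1 _ hv p hp _ (Walk.dart_snd_mem_support_of_mem_darts _ hd)
  obtain ⟨ha, hra⟩ := (hmemK _).1 hdK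
  have hb : d.snd ∈ node D v := by
    by_contra hb
    refine hdK' ((hmemK _).2 ⟨⟨hsndU, hb⟩, Reachable.trans (Adj.reachable ?_) hra⟩)
    exact d.adj.symm
  have habD : s(d.fst, d.snd) ∉ D := by
    intro h
    apply ha.2
    rw [← node_eq hb]
    exact mem_node_of_mem (by rwa [Sym2.eq_swap])
  refine ⟨d.fst, d.snd, hb, ⟨d.adj, habD, inside_mk.2 ⟨ha.1, hsndU⟩⟩, ?_⟩
  ext w
  refine (hmemK w).trans ?_
  constructor
  · rintro ⟨hw, hr⟩
    refine ⟨hw.1, ?_⟩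
    let f : (I.graph.induce (U \ node D v)) →g I.graph.deleteEdges {s(d.fst, d.snd)} :=
      ⟨Subtype.val, by
        rintro ⟨y, hy⟩ ⟨z, hz⟩ hyz
        have hyz' : I.graph.Adj y z := hyz
        simp only [deleteEdges_adj, hyz', Set.mem_singleton_iff, true_and]
        intro h
        rcases Sym2.eq_iff.1 h with ⟨-, h⟩ | ⟨h, -⟩
        · exact hz.2 (h ▸ hb)
        · exact hy.2 (h ▸ hb)⟩
    exact Reachable.map f (hra.trans hr.symm)
  · rintro ⟨hw, hr⟩
    obtain ⟨q, hq, -⟩ := I.isTree.existsUnique_path d.fst w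
    have hqe := (conn_iff_path I.isTree hq).1 hr
    have hsup : ∀ z ∈ q.support, z ∈ U \ node D v := by
      intro z hz
      -- If the path met the node of `v`, it could be continued inside this node to `d.snd` without
      -- the edge, which separates `d.fst` from `d.snd`.
      refine ⟨hU.convex _ ha.1 _ hw q hq z hz, fun hzn => ?_⟩
      have h1 : Conn I.graph s(d.fst, d.snd) d.fst z :=
        (conn_iff_path I.isTree (hq.takeUntil hz)).2
          fun h' => hqe (Walk.edges_takeUntil_subset_edges _ hz h')
      have h2 : Conn I.graph s(d.fst, d.snd) d.snd z :=
        conn_of_mem_node hD habD (by rw [node_eq hb]; exact hzn)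
      exact not_conn_edge I.isTree d.adj (h1.trans h2.symm)
    exact ⟨hsup w (Walk.end_mem_support _), Reachable.trans ⟨(q.induce _ hsup).reverse⟩ hra⟩

/-- If there is no thin edge, some node has only light branches. -/
theorem exists_light_center [Finite V] (hD : D ⊆ I.graph.edgeSet) (hU : I.IsPiece γ D μ U x) {α : ℝ}
    (ht : ∀ u v, ¬ I.IsThin α D U x u v) :
    ∃ c ∈ U, ∀ a b, b ∈ node D c → s(a, b) ∈ edgesIn I.graph D U →
      I.costIn x (side I.graph U a b) < α := by
  by_cases hne : ∃ u v, s(u, v) ∈ edgesIn I.graph D U ∧ α ≤ I.costIn x (side I.graph U u v)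
  · obtain ⟨u₀, v₀, h₀⟩ := hne
    -- A heavy side with the fewest nodes; its end `u` becomes the center.
    obtain ⟨⟨u, v⟩, ⟨huv, hheavy⟩, hmin⟩ := Set.exists_min_image
      {q : V × V | s(q.1, q.2) ∈ edgesIn I.graph D U ∧ α ≤ I.costIn x (side I.graph U q.1 q.2)}
      (fun q => (side I.graph U q.1 q.2).ncard) (Set.toFinite _) ⟨(u₀, v₀), h₀⟩
    have hin := inside_mk.1 huv.2.2
    refine ⟨u, hin.1, fun a b hb hab => ?_⟩
    by_contra hcon
    have hin' := inside_mk.1 hab.2.2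
    have hub : Conn I.graph s(u, v) u b := conn_of_mem_node hD huv.2.1 hb
    by_cases hne : s(a, b) = s(u, v)
    · rcases Sym2.eq_iff.1 hne with ⟨-, rfl⟩ | ⟨rfl, rfl⟩
      · exact not_conn_edge I.isTree huv.1 hub
      -- Now `a` is the far end of the chosen edge, so both of its sides are heavy and it would be
      -- thin.
      · exact ht b a ⟨huv, hheavy, not_lt.1 hcon⟩
    · have hua : Conn I.graph s(u, v) u a := hub.trans (conn_of_adj hab.1 hne).symm
      have hbu : Conn I.graph s(a, b) b u := (conn_of_mem_node hD hab.2.1 hb).symm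
      -- A branch pointing into the chosen side is a strictly smaller side, as it misses `u`; it
      -- cannot be heavy by minimality.
      have hlt : side I.graph U a b ⊂ side I.graph U u v := by
        refine ⟨fun w hw => ⟨hw.1, ?_⟩, fun h => ?_⟩
        · by_contra hw'
          have h1 := conn_across I.isTree huv.1 hne hua hw'
          exact not_conn_edge I.isTree hab.1 (hw.2.trans (hbu.trans h1).symm)
        · have h1 := h (show u ∈ side I.graph U u v from ⟨hin.1, Reachable.refl _⟩)
          exact not_conn_edge I.isTree hab.1 (h1.2.trans hbu.symm)
      exact absurd (Set.ncard_lt_ncard hlt (Set.toFinite _))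
        (not_lt.2 (hmin (a, b) ⟨hab, not_lt.1 hcon⟩))
  · push Not at hne
    obtain ⟨c, hc⟩ := hU.nonempty
    exact ⟨c, hc, fun a b _ hab => hne a b hab⟩

theorem cut_subset (S : Set V) :
    cut I.graph D U S ⊆ {e | e ∈ edgesIn I.graph D U ∧ ∃ z ∈ S, z ∈ e} := by
  rintro e ⟨he, a, b, ha, -, rfl⟩
  exact ⟨he, a, ha, by simp⟩

/-- A path inside `U` that leaves a node of the contracted tree crosses its cut. -/
theorem exists_mem_cut (hU : I.IsPiece γ D μ U x) {c w z : V} (hw : w ∈ node D c) (hwU : w ∈ U)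
    (hz : z ∉ node D c) (hzU : z ∈ U) {p : I.graph.Walk w z} (hp : p.IsPath) :
    ∃ e ∈ p.edges, e ∈ cut I.graph D U (node D c) := by
  obtain ⟨d, hd, h1, h2⟩ := p.exists_boundary_dart (node D c) hw hz
  refine ⟨s(d.fst, d.snd), List.mem_map_of_mem hd, ⟨d.adj, fun h => h2 ?_, inside_mk.2 ⟨?_, ?_⟩⟩,
    d.fst, d.snd, h1, h2, rfl⟩
  · rw [← node_eq h1]
    exact mem_node_of_mem h
  · exact hU.convex _ hwU _ hzU p hp _ (Walk.dart_fst_mem_support_of_mem_darts _ hd)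
  · exact hU.convex _ hwU _ hzU p hp _ (Walk.dart_snd_mem_support_of_mem_darts _ hd)

open Classical in
/-- The links that end in a leaf of a contracted subtree with more than one node have
total value at least one. -/
theorem one_le_sum_leaf [Finite V] (hU : I.IsPiece γ D μ U x) {w z : V} (hw : w ∈ U) (hz : z ∈ U)
    (hwz : z ∉ node D w)
    (hleaf : {e | e ∈ edgesIn I.graph D U ∧ ∃ z ∈ node D w, z ∈ e}.ncard ≤ 1) :
    1 ≤ ∑ l ∈ I.links, if ∃ p ∈ l, p ∈ node D w then x l else 0 := by
  obtain ⟨p, hp, -⟩ := I.isTree.existsUnique_path w z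
  obtain ⟨f, -, hf⟩ := exists_mem_cut hU (mem_node_self D w) hw hwz hz hp
  have hcut : cut I.graph D U (node D w) = {f} := by
    refine Set.eq_singleton_iff_unique_mem.2 ⟨hf, fun f' hf' => ?_⟩
    exact (Set.ncard_le_one (Set.toFinite _)).1 hleaf _ (cut_subset _ hf') _ (cut_subset _ hf)
  have h1 := hU.oddCut.2 (node D w) ⟨hU.closed w hw, fun a ha => (node_eq ha).subset⟩
    (by simp [hcut])
  rw [hcut, hU.supported.sum_linksIn, Set.ncard_singleton] at h1
  norm_num at h1
  refine h1.trans (Finset.sum_le_sum fun l hl => ?_)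
  by_cases h0 : x l = 0
  · simp [h0]
  have hin := hU.supported l hl h0
  have hx := hU.nonneg l hl
  by_cases hfl : f ∈ pathEdges I.graph l
  · have h2 : pathEdges I.graph l ∩ {f} = {f} := by simpa using hfl
    have h3 : ⌈(1 / 2 : ℝ)⌉₊ = 1 := by rw [Nat.ceil_eq_iff] <;> norm_num
    rw [h2, Set.ncard_singleton, Nat.cast_one, h3, if_pos, Nat.cast_one, one_mul]
    by_contra hno
    push Not at hno
    obtain ⟨hfU, a, b, ha, hb, rfl⟩ := hf
    -- A path from `a` to a node outside the leaf must use the only cut edge. If no end of `l` were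
    -- in the leaf, both ends would be on the side of `b`, and `l` would not cover the edge.
    have key : ∀ p ∈ l, Conn I.graph s(a, b) b p := by
      intro p hpl
      refine (conn_or_conn I.isTree p).resolve_left fun hap => ?_
      obtain ⟨q, hq, -⟩ := I.isTree.existsUnique_path a p
      obtain ⟨e, he, hec⟩ := exists_mem_cut hU ha (inside_mk.1 hfU.2.2).1 (hno p hpl) (hin p hpl) hq
      rw [hcut, Set.mem_singleton_iff] at hec
      exact (conn_iff_path I.isTree hq).1 hap (hec ▸ he)
    induction l using Sym2.ind with
    | _ p q =>
      rw [mem_pathEdges I.isTree] at hfl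
      exact hfl ((key p (by simp)).symm.trans (key q (by simp)))
  · have h2 : pathEdges I.graph l ∩ {f} = ∅ := by simpa using hfl
    rw [h2]
    simp only [Set.ncard_empty, Nat.cast_zero, zero_div, Nat.ceil_zero, zero_mul]
    split_ifs
    · exact hx
    · exact le_rfl

/-- Double counting: each leaf needs links of total value one. A link with both ends in the branch
serves at most two leaves; one with a single end there serves at most one leaf and covers `ab`.
Costs are at least one. -/
theorem ncard_leaves_le [Finite V] (hD : D ⊆ I.graph.edgeSet) (hc : ∀ l ∈ I.links, 1 ≤ I.cost l)
    (hU : I.IsPiece γ D μ U x) {a b : V} (hab : s(a, b) ∈ edgesIn I.graph D U) :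
    ((leavesIn I.graph D U (side I.graph U a b)).ncard : ℝ) ≤
      2 * I.costIn x (side I.graph U a b) + ∑ l ∈ I.cov {s(a, b)}, I.cost l * x l := by
  classical
  set K := side I.graph U a b with hK
  have hin := inside_mk.1 hab.2.2
  have hclosed : ∀ w ∈ K, node D w ⊆ K := side_closed hD hU.closed hab.2.1
  have hbK : b ∉ K := fun h => not_conn_edge I.isTree hab.1 h.2
  have hfin := Set.toFinite (leavesIn I.graph D U K)
  rw [Set.ncard_eq_toFinset_card _ hfin]
  have h1 : ∀ A ∈ hfin.toFinset, (1 : ℝ) ≤ ∑ l ∈ I.links, if ∃ p ∈ l, p ∈ A then x l else 0 := by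
    intro A hA
    obtain ⟨w, hw, rfl, hle⟩ := hfin.mem_toFinset.1 hA
    exact one_le_sum_leaf hU hw.1 hin.2 (fun h => hbK (hclosed w hw h)) hle
  have h2 := Finset.sum_le_sum h1
  rw [Finset.sum_const, nsmul_eq_mul, mul_one, Finset.sum_comm] at h2
  refine h2.trans ?_
  unfold WTAP.costIn
  rw [sum_linksIn, sum_cov, Finset.mul_sum, ← Finset.sum_add_distrib]
  refine Finset.sum_le_sum fun l hl => ?_
  by_cases h0 : x l = 0
  · simp [h0]
  have hlin := hU.supported l hl h0
  have hx := hU.nonneg l hl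
  have hcx : x l ≤ I.cost l * x l := le_mul_of_one_le_left hx (hc l hl)
  rw [← Finset.sum_filter, Finset.sum_const, nsmul_eq_mul]
  have hsub : ∀ B : Finset (Set V), (∀ A ∈ hfin.toFinset, (∃ p ∈ l, p ∈ A) → A ∈ B) →
      ((hfin.toFinset.filter fun A => ∃ p ∈ l, p ∈ A).card : ℝ) ≤ B.card := by
    intro B hB
    exact_mod_cast Finset.card_le_card fun A hA =>
      hB A (Finset.mem_filter.1 hA).1 (Finset.mem_filter.1 hA).2
  have hnode : ∀ A ∈ hfin.toFinset, ∀ p ∈ A, p ∈ K ∧ A = node D p := by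
    intro A hA p hp
    obtain ⟨w, hw, rfl, -⟩ := hfin.mem_toFinset.1 hA
    exact ⟨hclosed w hw hp, (node_eq hp).symm⟩
  induction l using Sym2.ind with
  | _ p q =>
    have hlin' := inside_mk.1 hlin
    by_cases hp : p ∈ K <;> by_cases hq : q ∈ K
    · have h3 := hsub {node D p, node D q} (by
        rintro A hA ⟨r, hr, hrA⟩
        rcases Sym2.mem_iff.1 hr with rfl | rfl
        · simp [(hnode A hA _ hrA).2]
        · simp [(hnode A hA _ hrA).2])
      have h4 : ((({node D p, node D q} : Finset (Set V)).card : ℕ) : ℝ) ≤ 2 := by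
        exact_mod_cast Finset.card_le_two
      rw [if_pos (inside_mk.2 ⟨hp, hq⟩)]
      have h5 : 0 ≤ if (pathEdges I.graph s(p, q) ∩ {s(a, b)}).Nonempty then
          I.cost s(p, q) * x s(p, q) else 0 := by
        split_ifs
        · exact hx.trans hcx
        · exact le_rfl
      nlinarith
    · have h3 := hsub {node D p} (by
        rintro A hA ⟨r, hr, hrA⟩
        rcases Sym2.mem_iff.1 hr with rfl | rfl
        · simp [(hnode A hA _ hrA).2]
        · exact absurd (hnode A hA _ hrA).1 hq)
      rw [Finset.card_singleton, Nat.cast_one] at h3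
      have h4 : s(a, b) ∈ pathEdges I.graph s(p, q) := by
        rw [mem_pathEdges I.isTree]
        exact fun h => hq ⟨hlin'.2, hp.2.trans h⟩
      rw [if_neg (fun h => hq (inside_mk.1 h).2), if_pos (by simpa using h4)]
      nlinarith
    · have h3 := hsub {node D q} (by
        rintro A hA ⟨r, hr, hrA⟩
        rcases Sym2.mem_iff.1 hr with rfl | rfl
        · exact absurd (hnode A hA _ hrA).1 hp
        · simp [(hnode A hA _ hrA).2])
      rw [Finset.card_singleton, Nat.cast_one] at h3
      have h4 : s(a, b) ∈ pathEdges I.graph s(p, q) := by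
        rw [mem_pathEdges I.isTree]
        exact fun h => hp ⟨hlin'.1, hq.2.trans h.symm⟩
      rw [if_neg (fun h => hp (inside_mk.1 h).1), if_pos (by simpa using h4)]
      nlinarith
    · have h3 := hsub ∅ (by
        rintro A hA ⟨r, hr, hrA⟩
        rcases Sym2.mem_iff.1 hr with rfl | rfl
        · exact absurd (hnode A hA _ hrA).1 hp
        · exact absurd (hnode A hA _ hrA).1 hq)
      rw [Finset.card_empty, Nat.cast_zero] at h3
      have h5 : 0 ≤ if (pathEdges I.graph s(p, q) ∩ {s(a, b)}).Nonempty then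
          I.cost s(p, q) * x s(p, q) else 0 := by
        split_ifs
        · exact hx.trans hcx
        · exact le_rfl
      rw [if_neg (fun h => hp (inside_mk.1 h).1)]
      nlinarith

/-- Cutting off the branch lowers the degree of the node of `a` only, so this is the only possible
new leaf. -/
theorem leavesIn_side_subset [Finite V] (hD : D ⊆ I.graph.edgeSet) (hU : I.IsPiece γ D μ U x)
    {a b : V} (hab : s(a, b) ∈ edgesIn I.graph D U) :
    leavesIn I.graph D (side I.graph U a b) (side I.graph U a b) ⊆
      insert (node D a) (leavesIn I.graph D U (side I.graph U a b)) := by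
  rintro A ⟨w, hw, rfl, hle⟩
  by_cases hwa : a ∈ node D w
  · exact Or.inl (node_eq hwa).symm
  refine Or.inr ⟨w, hw, rfl, le_trans (Set.ncard_le_ncard ?_ (Set.toFinite _)) hle⟩
  rintro e ⟨he, z, hz, hze⟩
  have hzK := side_closed hD hU.closed hab.2.1 w hw hz
  obtain ⟨y, rfl⟩ := hze
  refine ⟨edgesIn_side.2 ⟨he, fun h => ?_, hzK.2⟩, z, hz, by simp⟩
  rcases Sym2.eq_iff.1 h with ⟨rfl, -⟩ | ⟨rfl, -⟩
  · exact hwa hz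
  · exact not_conn_edge I.isTree hab.1 hzK.2

/-- A piece without thin edges is simple. -/
theorem WTAP.IsPiece.exists_isCenter [Finite V] (hD : D ⊆ I.graph.edgeSet) {M ε : ℝ} (hM : 1 ≤ M)
    (hε : 0 < ε) (hε1 : ε ≤ 1) (hc : ∀ l ∈ I.links, 1 ≤ I.cost l)
    (hU : I.IsPiece γ D (2 * M / ε) U x) (ht : ∀ u v, ¬ I.IsThin (4 * M / ε ^ 2) D U x u v) :
    ∃ v : V, I.IsCenter ⌈10 * M / ε ^ 2⌉₊ D U x v ∧
      ∀ K : Set V, IsBranch I.graph D U v K → I.costIn x K ≤ 4 * M / ε ^ 2 ∧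
        ((leavesIn I.graph D U K).ncard : ℝ) ≤ 10 * M / ε ^ 2 := by
  obtain ⟨v, hv, hlight⟩ := exists_light_center hD hU ht
  have hμ : 2 * M / ε ≤ 2 * M / ε ^ 2 := by
    apply div_le_div_of_nonneg_left (by linarith) (by positivity)
    nlinarith
  -- The constant ten: twice the bound on the cost of a branch, plus the bound on the links covering
  -- its edge.
  have h10 : 10 * M / ε ^ 2 = 2 * (4 * M / ε ^ 2) + 2 * M / ε ^ 2 := by ring
  have hpos : 0 ≤ M / ε ^ 2 := by positivity
  have h4 : 4 * M / ε ^ 2 ≤ 10 * M / ε ^ 2 := by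
    have h5 : 4 * M / ε ^ 2 = 4 * (M / ε ^ 2) := by ring
    have h6 : 10 * M / ε ^ 2 = 10 * (M / ε ^ 2) := by ring
    linarith
  have key : ∀ K : Set V, IsBranch I.graph D U v K → I.costIn x K < 4 * M / ε ^ 2 ∧
      ((leavesIn I.graph D U K).ncard : ℝ) < 10 * M / ε ^ 2 ∧
      (leavesIn I.graph D K K).ncard ≤ (leavesIn I.graph D U K).ncard + 1 := by
    intro K hK
    obtain ⟨a, b, hb, hab, rfl⟩ := exists_edge_of_isBranch hD hU hv hK
    have h1 := hlight a b hb hab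
    have h2 := ncard_leaves_le hD hc hU hab
    have h3 := hU.coverCost _ hab
    refine ⟨h1, by linarith, ?_⟩
    exact (Set.ncard_le_ncard (leavesIn_side_subset hD hU hab) (Set.toFinite _)).trans
      (Set.ncard_insert_le _ _)
  refine ⟨v, ⟨hv, fun K hK => ?_⟩, fun K hK => ⟨(key K hK).1.le, (key K hK).2.1.le⟩⟩
  obtain ⟨h1, h2, h3⟩ := key K hK
  refine ⟨(h1.le.trans h4).trans (Nat.le_ceil _), h3.trans ?_⟩
  -- The strict bound on the leaves makes room for the one new leaf.
  exact Nat.lt_ceil.2 h2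

end Simplicity

/-! ### Primal-dual covering of heavy edges by up-links -/

section PrimalDual

variable {V : Type*} {I : WTAP V} {r : V}

/-- The link `ij` is an up-link: it joins `i` to its ancestor `j`. -/
def WTAP.Up (I : WTAP V) (r i j : V) : Prop := s(i, j) ∈ I.links ∧ Anc I.graph r j i

/-- The subtree below `w` contains `i`, but not `j`. -/
def Crosses (G : SimpleGraph V) (r i j w : V) : Prop := Anc G r w i ∧ ¬ Anc G r w j

/-- The subtree below `w` contains exactly one end of `l`. -/
def Separates (G : SimpleGraph V) (r w : V) (l : Sym2 V) : Prop :=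
  (∃ p ∈ l, Anc G r w p) ∧ ∃ q ∈ l, ¬ Anc G r w q

theorem separates_mk {G : SimpleGraph V} {w p q : V} :
    Separates G r w s(p, q) ↔ Crosses G r p q w ∨ Crosses G r q p w := by
  simp only [Separates, Crosses, Sym2.mem_iff, exists_eq_or_imp, exists_eq_left]
  tauto

/-- `a` is the lowest common ancestor. The up-link from `p` to `a` is a shadow that crosses the same
subtrees from the side of `p`; if `a = p`, there are none. -/
theorem exists_up [Finite V] (hs : I.ShadowComplete) {p q : V} (h : s(p, q) ∈ I.links) :
    ∃ a, (∀ g, Crosses I.graph r p q g ↔ Crosses I.graph r p a g) ∧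
      (a ≠ p → I.Up r p a ∧ I.cost s(p, a) ≤ I.cost s(p, q)) := by
  obtain ⟨a, ha, hg⟩ := exists_lca I.isTree r p q
  refine ⟨a, fun g => and_congr_right fun h => not_congr (hg g h).symm, fun hne => ?_⟩
  have h1 := hs _ h s(p, a) (by simpa using hne.symm) ?_
  · exact ⟨⟨h1.1, ha⟩, h1.2⟩
  · intro e he
    obtain ⟨g, hge⟩ := exists_mem_pathEdges_iff I.isTree r (pathEdges_subset _ he)
    rw [hge] at he ⊢
    by_cases h2 : Anc I.graph r g p
    · rwa [← hg g h2]
    · exact absurd ⟨fun h => absurd h h2, fun h3 => h3.trans I.isTree ha⟩ he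

/-- The value of the links that cross the subtree below `w`. -/
noncomputable def WTAP.crossing [Fintype V] (I : WTAP V) (r : V) (x : Sym2 V → ℝ) (w : V) : ℝ :=
  open Classical in ∑ i, ∑ j, if Crosses I.graph r i j w then
    (if s(i, j) ∈ I.links then x s(i, j) else 0) else 0

-- Of the two orientations of a separated link exactly one crosses, so summing over ordered pairs
-- counts it once.
open Classical in
theorem crossing_eq [Fintype V] (x : Sym2 V → ℝ) (w : V) :
    I.crossing r x w = ∑ l ∈ I.links, if Separates I.graph r w l then x l else 0 := by
  unfold WTAP.crossing
  rw [← Finset.sum_filter, ← Fintype.sum_prod_type'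
    (f := fun i j => if Crosses I.graph r i j w then
      (if s(i, j) ∈ I.links then x s(i, j) else 0) else 0)]
  simp_rw [← ite_and]
  rw [← Finset.sum_filter]
  refine Finset.sum_bij (fun p _ => s(p.1, p.2)) ?_ ?_ ?_ ?_
  · rintro ⟨i, j⟩ h
    simp only [Finset.mem_filter, Finset.mem_univ, true_and] at h ⊢
    exact ⟨h.2, separates_mk.2 (Or.inl h.1)⟩
  · rintro ⟨i, j⟩ h ⟨i', j'⟩ h' heq
    simp only [Finset.mem_filter, Finset.mem_univ, true_and] at h h'
    rcases Sym2.eq_iff.1 heq with ⟨rfl, rfl⟩ | ⟨rfl, rfl⟩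
    · rfl
    · exact absurd h.1.1 h'.1.2
  · intro l hl
    obtain ⟨h1, h2⟩ := Finset.mem_filter.1 hl
    induction l using Sym2.ind with
    | _ p q =>
      rcases separates_mk.1 h2 with h3 | h3
      · exact ⟨(p, q), by simp [h1, h3], rfl⟩
      · exact ⟨(q, p), by simp [h3, Sym2.eq_swap (a := q), h1], Sym2.eq_swap⟩
  · simp

/-- Guarantees that the bottom-up phase finds a candidate at every heavy node. -/
theorem exists_up_of_crossing_pos [Fintype V] (hs : I.ShadowComplete) {x : Sym2 V → ℝ} {w : V}
    (h : 0 < I.crossing r x w) : ∃ i j, I.Up r i j ∧ Crosses I.graph r i j w := by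
  classical
  obtain ⟨i, -, hi⟩ := Finset.exists_ne_zero_of_sum_ne_zero h.ne'
  obtain ⟨j, -, hj⟩ := Finset.exists_ne_zero_of_sum_ne_zero hi
  have h1 : Crosses I.graph r i j w := by
    by_contra h; rw [if_neg h] at hj; exact hj rfl
  have h2 : s(i, j) ∈ I.links := by
    by_contra h; rw [if_pos h1, if_neg h] at hj; exact hj rfl
  obtain ⟨a, ha, ha'⟩ := exists_up (r := r) hs h2
  have h3 := (ha w).1 h1
  exact ⟨i, a, (ha' (by rintro rfl; exact h3.2 h3.1)).1, h3⟩

/-- The state of the bottom-up phase after the nodes in `A` have been processed: `y` is a feasible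
dual solution with slacks `sl`, and the up-link `b w` is tight for each processed `w` in `H`. -/
structure WTAP.Dual [Fintype V] (I : WTAP V) (r : V) (H A : Set V) (sl : V → V → ℝ)
    (b : V → V × V) (y : V → ℝ) : Prop where
  nonneg : ∀ w, 0 ≤ y w
  support : ∀ w, y w ≠ 0 → w ∈ A ∧ w ∈ H
  slack : open Classical in ∀ i j, I.Up r i j →
    sl i j = I.cost s(i, j) - ∑ w, if Crosses I.graph r i j w then y w else 0
  slack_nonneg : ∀ i j, I.Up r i j → 0 ≤ sl i j
  chosen : ∀ w ∈ A, w ∈ H → I.Up r (b w).1 (b w).2 ∧ Crosses I.graph r (b w).1 (b w).2 w ∧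
    sl (b w).1 (b w).2 = 0 ∧
    ∀ g, Crosses I.graph r (b w).1 (b w).2 g → Anc I.graph r g w → g ≠ w → y g = 0

theorem dual_init [Fintype V] (hc : ∀ l ∈ I.links, 1 ≤ I.cost l) {H : Set V} {sl : V → V → ℝ}
    {b : V → V × V} (hsl : ∀ i j, I.Up r i j → sl i j = I.cost s(i, j)) :
    I.Dual r H ∅ sl b 0 :=
  ⟨fun _ => le_rfl, fun w h => absurd rfl h, fun i j h => by simp [hsl i j h],
    fun i j h => by rw [hsl i j h]; linarith [hc _ h.1], fun w h => absurd h (Set.notMem_empty w)⟩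

theorem WTAP.Dual.insert_of_notMem [Fintype V] {H A : Set V} {sl : V → V → ℝ} {b : V → V × V}
    {y : V → ℝ} (h : I.Dual r H A sl b y) {w : V} (hw : w ∉ H) : I.Dual r H (insert w A) sl b y :=
  ⟨h.nonneg, fun g hg => ⟨Or.inr (h.support g hg).1, (h.support g hg).2⟩, h.slack, h.slack_nonneg, by
    rintro g (rfl | hg) hgH
    · exact absurd hgH hw
    · exact h.chosen g hg hgH⟩

/-- The dual variable of `w` rises from zero by the least slack of an up-link crossing `w`, so no
slack becomes negative and the minimizer `b' w` becomes tight. Processing deeper nodes first leaves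
the strict ancestors of `w` at zero. -/
theorem WTAP.Dual.insert_of_mem [Fintype V] {H A : Set V} {sl sl' : V → V → ℝ} {b b' : V → V × V}
    {y : V → ℝ} (h : I.Dual r H A sl b y) {w : V} (hw : w ∈ H) (hwA : w ∉ A)
    (hdist : ∀ g ∈ A, I.graph.dist r w ≤ I.graph.dist r g) (hb : ∀ g, g ≠ w → b' g = b g)
    (hup : I.Up r (b' w).1 (b' w).2) (hcr : Crosses I.graph r (b' w).1 (b' w).2 w)
    (hmin : ∀ i j, I.Up r i j → Crosses I.graph r i j w → sl (b' w).1 (b' w).2 ≤ sl i j)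
    (hsl : ∀ i j, I.Up r i j → Crosses I.graph r i j w →
      sl' i j = sl i j - sl (b' w).1 (b' w).2)
    (hsl' : ∀ i j, I.Up r i j → ¬ Crosses I.graph r i j w → sl' i j = sl i j) :
    ∃ y', I.Dual r H (insert w A) sl' b' y' := by
  classical
  set m := sl (b' w).1 (b' w).2 with hm
  have hm0 : 0 ≤ m := h.slack_nonneg _ _ hup
  have hyw : y w = 0 := by
    by_contra h1
    exact hwA (h.support w h1).1
  have hsum : ∀ i j, (∑ g, if Crosses I.graph r i j g then y g + (if g = w then m else 0) else 0) =
      (∑ g, if Crosses I.graph r i j g then y g else 0) +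
        if Crosses I.graph r i j w then m else 0 := by
    intro i j
    have : ∀ g, (if Crosses I.graph r i j g then y g + (if g = w then m else 0) else 0) =
        (if Crosses I.graph r i j g then y g else 0) +
          if g = w then (if Crosses I.graph r i j w then m else 0) else 0 := by
      intro g
      by_cases hg : g = w
      · subst hg; split_ifs <;> simp
      · simp [hg]
    simp_rw [this, Finset.sum_add_distrib]
    simp
  have hslack_nonneg : ∀ i j, I.Up r i j → 0 ≤ sl' i j := by
    intro i j hij
    by_cases hc : Crosses I.graph r i j w
    · rw [hsl i j hij hc]
      linarith [hmin i j hij hc]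
    · rw [hsl' i j hij hc]
      exact h.slack_nonneg i j hij
  refine ⟨fun g => y g + if g = w then m else 0, ?_, ?_, ?_, hslack_nonneg, ?_⟩
  · intro g
    have := h.nonneg g
    split_ifs <;> positivity
  · intro g hg
    by_cases hgw : g = w
    · subst hgw; exact ⟨Or.inl rfl, hw⟩
    · simp only [hgw, if_false, add_zero] at hg
      exact ⟨Or.inr (h.support g hg).1, (h.support g hg).2⟩
  · intro i j hij
    rw [hsum]
    by_cases hc : Crosses I.graph r i j w
    · rw [hsl i j hij hc, h.slack i j hij, if_pos hc]; ring
    · rw [hsl' i j hij hc, h.slack i j hij, if_neg hc]; ring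
  · rintro g hgA hgH
    by_cases hgw : g = w
    · subst hgw
      refine ⟨hup, hcr, by rw [hsl _ _ hup hcr, sub_self], fun g' _ hg' hne => ?_⟩
      simp only [hne, if_false, add_zero]
      by_contra h1
      exact absurd (hg'.dist_lt I.isTree hne) (not_lt.2 (hdist g' (h.support g' h1).1))
    · have hgA' := hgA.resolve_left hgw
      obtain ⟨h1, h2, h3, h4⟩ := h.chosen g hgA' hgH
      rw [hb g hgw]
      -- An earlier choice that crosses `w` already has slack zero, so there is no raise at all.
      -- Thus it stays tight, and no crossed strict ancestor gets a positive variable.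
      have hmz : Crosses I.graph r (b g).1 (b g).2 w → m = 0 := fun hc =>
        le_antisymm (h3 ▸ hmin _ _ h1 hc) hm0
      refine ⟨h1, h2, ?_, fun g' hg' ha hne => ?_⟩
      · by_cases hc : Crosses I.graph r (b g).1 (b g).2 w
        · rw [hsl _ _ h1 hc, h3, hmz hc, sub_zero]
        · rw [hsl' _ _ h1 hc, h3]
      · rw [h4 g' hg' ha hne, zero_add]
        split_ifs with h5
        · exact hmz (h5 ▸ hg')
        · rfl

/-- The state of the top-down phase after the nodes in `A` have been processed and
the up-links of the nodes in `T` have been selected. -/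
structure Selection (G : SimpleGraph V) (r : V) (H A : Set V) (b : V → V × V) (T : Set V) :
    Prop where
  subset : T ⊆ A ∩ H
  covered : ∀ w ∈ A, w ∈ H → ∃ g ∈ T, Crosses G r (b g).1 (b g).2 w
  indep : ∀ g ∈ T, ∀ w ∈ T, Anc G r g w → g ≠ w → ¬ Crosses G r (b g).1 (b g).2 w

theorem selection_init {G : SimpleGraph V} {H : Set V} {b : V → V × V} :
    Selection G r H ∅ b ∅ :=
  ⟨by simp, by simp, by simp⟩

theorem Selection.insert_of_covered {G : SimpleGraph V} {H A : Set V} {b : V → V × V} {T : Set V}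
    (h : Selection G r H A b T) {w : V}
    (hw : w ∈ H → ∃ g ∈ T, Crosses G r (b g).1 (b g).2 w) :
    Selection G r H (insert w A) b T :=
  ⟨fun g hg => ⟨Or.inr (h.subset hg).1, (h.subset hg).2⟩, by
    rintro g (rfl | hg) hgH
    · exact hw hgH
    · exact h.covered g hg hgH, h.indep⟩

/-- Nodes processed earlier are not deeper than `w`, so none lies strictly below it; and no earlier
up-link crosses `w`. Independence persists. -/
theorem Selection.insert_of_not_covered {G : SimpleGraph V} (hG : G.IsTree) {H A : Set V}
    {b : V → V × V} {T : Set V} (h : Selection G r H A b T) {w : V} (hw : w ∈ H)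
    (hcr : Crosses G r (b w).1 (b w).2 w) (hdist : ∀ g ∈ A, G.dist r g ≤ G.dist r w)
    (hn : ¬ ∃ g ∈ T, Crosses G r (b g).1 (b g).2 w) :
    Selection G r H (insert w A) b (insert w T) := by
  refine ⟨?_, ?_, ?_⟩
  · rintro g (rfl | hg)
    · exact ⟨Or.inl rfl, hw⟩
    · exact ⟨Or.inr (h.subset hg).1, (h.subset hg).2⟩
  · rintro g (rfl | hg) hgH
    · exact ⟨g, Or.inl rfl, hcr⟩
    · obtain ⟨g', hg', h'⟩ := h.covered g hg hgH
      exact ⟨g', Or.inr hg', h'⟩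
  · rintro g (rfl | hg) z (rfl | hz) ha hne
    · exact absurd rfl hne
    · exact absurd (ha.dist_lt hG hne) (not_lt.2 (hdist z (h.subset hz).1))
    · exact fun h' => hn ⟨g, hg, h'⟩
    · exact h.indep g hg z hz ha hne

/-- The cost of the selected up-links is at most the value of the dual solution. -/
theorem sum_selection_le [Fintype V] {H : Set V} {sl : V → V → ℝ} {b : V → V × V} {y : V → ℝ}
    (h : I.Dual r H Set.univ sl b y) {T : Finset V} (hT : Selection I.graph r H Set.univ b T) :
    ∑ w ∈ T, I.cost s((b w).1, (b w).2) ≤ ∑ g, y g := by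
  classical
  have h1 : ∀ w ∈ T, I.cost s((b w).1, (b w).2) =
      ∑ g, if Crosses I.graph r (b w).1 (b w).2 g then y g else 0 := by
    intro w hw
    obtain ⟨h2, -, h3, -⟩ := h.chosen w trivial (hT.subset hw).2
    have := h.slack _ _ h2
    linarith
  rw [Finset.sum_congr rfl h1, Finset.sum_comm]
  refine Finset.sum_le_sum fun g _ => ?_
  by_cases hy : y g = 0
  · simp [hy]
  rw [← Finset.sum_filter, Finset.sum_const, nsmul_eq_mul]
  refine mul_le_of_le_one_left (h.nonneg g) ?_
  rw [Nat.cast_le_one, Finset.card_le_one]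
  -- If selected up-links of `w` and `w'` both cross `g` with `y g ≠ 0`, then neither node lies
  -- strictly below `g`, so both are ancestors of `g` and comparable. The up-link of the upper one
  -- then crosses the lower one, against independence.
  suffices key : ∀ w ∈ T, Crosses I.graph r (b w).1 (b w).2 g →
      ∀ w' ∈ T, Crosses I.graph r (b w').1 (b w').2 g → Anc I.graph r w w' → w = w' by
    have hanc : ∀ w ∈ T, Crosses I.graph r (b w).1 (b w).2 g → Anc I.graph r w g := by
      intro w hw hc
      obtain ⟨-, h2, -, h3⟩ := h.chosen w trivial (hT.subset hw).2
      rcases Anc.total I.isTree hc.1 h2.1 with h4 | h4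
      · by_cases hne : g = w
        · subst hne; exact h4
        · exact absurd (h3 g hc h4 hne) hy
      · exact h4
    intro w hw w' hw'
    rw [Finset.mem_filter] at hw hw'
    rcases Anc.total I.isTree (hanc w hw.1 hw.2) (hanc w' hw'.1 hw'.2) with h4 | h4
    · exact key w hw.1 hw.2 w' hw'.1 hw'.2 h4
    · exact (key w' hw'.1 hw'.2 w hw.1 hw.2 h4).symm
  intro w hw hc w' hw' hc' ha
  by_contra hne
  refine hT.indep w hw w' hw' ha hne ⟨?_, fun h5 => ?_⟩
  · obtain ⟨-, h2, -, h3⟩ := h.chosen w' trivial (hT.subset hw').2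
    refine Anc.trans I.isTree ?_ hc.1
    rcases Anc.total I.isTree hc'.1 h2.1 with h4 | h4
    · by_cases hne : g = w'
      · subst hne; exact h4
      · exact absurd (h3 g hc' h4 hne) hy
    · exact h4
  · exact (h.chosen w trivial (hT.subset hw).2).2.1.2 (ha.trans I.isTree h5)

/-- One half of a link is dominated by an up-link of no larger cost, whose dual constraint is
nonnegativity of its slack. -/
theorem sum_crosses_le [Fintype V] (hs : I.ShadowComplete) (hc : ∀ l ∈ I.links, 1 ≤ I.cost l)
    {H A : Set V} {sl : V → V → ℝ} {b : V → V × V} {y : V → ℝ}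
    (h : I.Dual r H A sl b y) {p q : V} (hpq : s(p, q) ∈ I.links) :
    open Classical in (∑ g, if Crosses I.graph r p q g then y g else 0) ≤ I.cost s(p, q) := by
  classical
  obtain ⟨a, ha, ha'⟩ := exists_up (r := r) hs hpq
  simp_rw [ha]
  by_cases hne : a = p
  · subst hne
    have : ∀ g, ¬ Crosses I.graph r a a g := fun g hg => hg.2 hg.1
    simp only [this, if_false, Finset.sum_const_zero]
    linarith [hc _ hpq]
  · obtain ⟨h1, h2⟩ := ha' hne
    have h3 := h.slack _ _ h1
    have h4 := h.slack_nonneg _ _ h1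
    linarith

/-- Weak duality, with a factor two since a link consists of two up-links. -/
theorem dual_value_le [Fintype V] (hs : I.ShadowComplete) (hc : ∀ l ∈ I.links, 1 ≤ I.cost l)
    {x : Sym2 V → ℝ} (hx : ∀ l ∈ I.links, 0 ≤ x l) {θ : ℝ} {A : Set V}
    {sl : V → V → ℝ} {b : V → V × V} {y : V → ℝ}
    (h : I.Dual r {w | θ ≤ I.crossing r x w} A sl b y) :
    θ * ∑ g, y g ≤ 2 * I.fracCost x := by
  classical
  calc θ * ∑ g, y g = ∑ g, θ * y g := Finset.mul_sum _ _ _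
    _ ≤ ∑ g, I.crossing r x g * y g := by
        refine Finset.sum_le_sum fun g _ => ?_
        by_cases hy : y g = 0
        · simp [hy]
        · exact mul_le_mul_of_nonneg_right (h.support g hy).2 (h.nonneg g)
    _ = ∑ l ∈ I.links, x l * ∑ g, if Separates I.graph r g l then y g else 0 := by
        simp_rw [crossing_eq, Finset.sum_mul, Finset.mul_sum]
        rw [Finset.sum_comm]
        refine Finset.sum_congr rfl fun l _ => Finset.sum_congr rfl fun g _ => ?_
        split_ifs <;> simp
    _ ≤ ∑ l ∈ I.links, x l * (2 * I.cost l) := by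
        refine Finset.sum_le_sum fun l hl => mul_le_mul_of_nonneg_left ?_ (hx l hl)
        induction l using Sym2.ind with
        | _ p q =>
          have h1 := sum_crosses_le hs hc h hl
          have h2 := sum_crosses_le hs hc h (Sym2.eq_swap (a := p) ▸ hl)
          rw [Sym2.eq_swap (a := q)] at h2
          refine le_trans (le_of_eq ?_) ((add_le_add h1 h2).trans_eq (two_mul _).symm)
          rw [← Finset.sum_add_distrib]
          refine Finset.sum_congr rfl fun g _ => ?_
          rw [separates_mk]
          by_cases h3 : Crosses I.graph r p q g
          · have : ¬ Crosses I.graph r q p g := fun h4 => h4.2 h3.1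
            simp [h3, this]
          · simp [h3]
    _ = 2 * I.fracCost x := by
        unfold WTAP.fracCost
        rw [Finset.mul_sum]
        exact Finset.sum_congr rfl fun l _ => by ring

/-- The selected up-links form a cheap cover of the heavily covered edges. -/
theorem selection_covers [Fintype V] (hs : I.ShadowComplete)
    (hc : ∀ l ∈ I.links, 1 ≤ I.cost l) {x : Sym2 V → ℝ} (hx : ∀ l ∈ I.links, 0 ≤ x l) {ε : ℝ}
    (hε : 0 < ε) {sl : V → V → ℝ} {b : V → V × V} {y : V → ℝ}
    (h : I.Dual r {w | 2 / ε ≤ I.crossing r x w} Set.univ sl b y) {T : Finset V}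
    (hT : Selection I.graph r {w | 2 / ε ≤ I.crossing r x w} Set.univ b T)
    {S : Finset (Sym2 V)} (hS : ∀ l, l ∈ S ↔ ∃ w ∈ T, l = s((b w).1, (b w).2)) :
    S ⊆ I.links ∧ I.Covers S (I.heavy ε x) ∧ I.setCost S ≤ ε * I.fracCost x := by
  classical
  have hlinks : ∀ w ∈ T, s((b w).1, (b w).2) ∈ I.links := fun w hw =>
    (h.chosen w trivial (hT.subset hw).2).1.1
  refine ⟨?_, ?_, ?_⟩
  · intro l hl
    obtain ⟨w, hw, rfl⟩ := (hS l).1 hl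
    exact hlinks w hw
  · rintro e ⟨he, hheavy⟩
    obtain ⟨g, hg⟩ := exists_mem_pathEdges_iff I.isTree r he
    have hg' : ∀ l, (pathEdges I.graph l ∩ {e}).Nonempty ↔ Separates I.graph r g l := by
      intro l
      induction l using Sym2.ind with
      | _ p q =>
        rw [Set.inter_singleton_nonempty, hg, separates_mk]
        unfold Crosses
        tauto
    rw [sum_cov] at hheavy
    simp_rw [hg', ← crossing_eq] at hheavy
    obtain ⟨w, hw, hcr⟩ := hT.covered g trivial hheavy
    refine ⟨_, (hS _).2 ⟨w, hw, rfl⟩, ?_⟩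
    have := (hg' s((b w).1, (b w).2)).2 (separates_mk.2 (Or.inl hcr))
    simpa using this
  · have h1 : I.setCost S ≤ ∑ w ∈ T, I.cost s((b w).1, (b w).2) := by
      have : S = T.image fun w => s((b w).1, (b w).2) := by
        ext l
        simp [hS, eq_comm]
      rw [this]
      -- Several nodes may have chosen the same link; merging them does not increase the cost.
      exact Finset.sum_image_le_of_nonneg fun l hl => by
        obtain ⟨w, hw, rfl⟩ := Finset.mem_image.1 hl
        linarith [hc _ (hlinks w hw)]
    have h2 := sum_selection_le h hT
    have h3 := dual_value_le hs hc hx h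
    have h4 : ε * (2 / ε * ∑ g, y g) = 2 * ∑ g, y g := by field_simp
    have h5 := mul_le_mul_of_nonneg_left h3 hε.le
    linarith

end PrimalDual

/-! ### Program logic: frame rule, sequencing, branching and loops -/

section Machine

@[simp] theorem Store.nat_setNat_of_ne {s : Store} {a b i j k : ℕ} (h : b ≠ a) :
    (s.setNat a i j k).nat b = s.nat b := by
  ext i' j'
  simp [Store.setNat, h]

theorem Store.nat_setNat_self {s : Store} {a i j k : ℕ} (i' j' : ℕ) :
    (s.setNat a i j k).nat a i' j' = if i' = i ∧ j' = j then k else s.nat a i' j' := by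
  simp [Store.setNat]

@[simp] theorem Store.real_setNat {s : Store} {a i j k : ℕ} :
    (s.setNat a i j k).real = s.real := rfl

@[simp] theorem Store.nat_setReal {s : Store} {a i j : ℕ} {k : ℝ} :
    (s.setReal a i j k).nat = s.nat := rfl

@[simp] theorem Store.real_setReal_of_ne {s : Store} {a b i j : ℕ} {k : ℝ} (h : b ≠ a) :
    (s.setReal a i j k).real b = s.real b := by
  ext i' j'
  simp [Store.setReal, h]

theorem Store.real_setReal_self {s : Store} {a i j : ℕ} {k : ℝ} (i' j' : ℕ) :
    (s.setReal a i j k).real a i' j' = if i' = i ∧ j' = j then k else s.real a i' j' := by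
  simp [Store.setReal]

/-- The natural arrays to which a program writes. -/
def Prog.natWrites : Prog → List ℕ
  | setNat a _ _ _ => [a]
  | setReal _ _ _ _ => []
  | seq p q => p.natWrites ++ q.natWrites
  | ite _ p q => p.natWrites ++ q.natWrites
  | .while _ p => p.natWrites

/-- The real arrays to which a program writes. -/
def Prog.realWrites : Prog → List ℕ
  | setNat _ _ _ _ => []
  | setReal a _ _ _ => [a]
  | seq p q => p.realWrites ++ q.realWrites
  | ite _ p q => p.realWrites ++ q.realWrites
  | .while _ p => p.realWrites

/-- The frame rule. As the list of written arrays is computable, its side conditions are settled by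
`decide`. -/
theorem Run.nat_eq {p : Prog} {s s' : Store} {t : ℕ} (h : Run p s t s') :
    ∀ a ∉ p.natWrites, s'.nat a = s.nat a := by
  induction h <;> intro a ha <;> simp_all [Prog.natWrites]

theorem Run.real_eq {p : Prog} {s s' : Store} {t : ℕ} (h : Run p s t s') :
    ∀ a ∉ p.realWrites, s'.real a = s.real a := by
  induction h <;> intro a ha <;> simp_all [Prog.realWrites]

/-- Started with memory `s`, the program `p` halts after at most `T` steps, with a
memory that satisfies `Q`. -/
def Halts (p : Prog) (s : Store) (T : ℕ) (Q : Store → Prop) : Prop :=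
  ∃ t s', Run p s t s' ∧ t ≤ T ∧ Q s'

theorem Halts.mono {p : Prog} {s : Store} {T : ℕ} {Q Q' : Store → Prop} (h : Halts p s T Q)
    (hQ : ∀ s', Q s' → (∀ a ∉ p.natWrites, s'.nat a = s.nat a) →
      (∀ a ∉ p.realWrites, s'.real a = s.real a) → Q' s') : Halts p s T Q' := by
  obtain ⟨t, s', hr, ht, h⟩ := h
  exact ⟨t, s', hr, ht, hQ s' h hr.nat_eq hr.real_eq⟩

theorem Halts.setNat {s : Store} {a : ℕ} {i j e : NatExpr} {Q : Store → Prop}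
    (h : Q (s.setNat a (i.eval s) (j.eval s) (e.eval s))) : Halts (.setNat a i j e) s 1 Q :=
  ⟨1, _, Run.setNat s a i j e, le_rfl, h⟩

theorem Halts.setReal {s : Store} {a : ℕ} {i j : NatExpr} {e : RealExpr} {Q : Store → Prop}
    (h : Q (s.setReal a (i.eval s) (j.eval s) (e.eval s))) : Halts (.setReal a i j e) s 1 Q :=
  ⟨1, _, Run.setReal s a i j e, le_rfl, h⟩

theorem Halts.seq {p q : Prog} {s : Store} {T T' : ℕ} {Q Q' : Store → Prop} (h : Halts p s T Q)
    (h' : ∀ s', Q s' → (∀ a ∉ p.natWrites, s'.nat a = s.nat a) →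
      (∀ a ∉ p.realWrites, s'.real a = s.real a) → Halts q s' T' Q') :
    Halts (.seq p q) s (T + T') Q' := by
  obtain ⟨t, s', hr, ht, hQ⟩ := h
  obtain ⟨t', s'', hr', ht', hQ'⟩ := h' s' hQ hr.nat_eq hr.real_eq
  exact ⟨t + t', s'', hr.seq hr', by omega, hQ'⟩

theorem Halts.ite {b : Test} {p q : Prog} {s : Store} {T : ℕ} {Q : Store → Prop}
    (h : b.Holds s → Halts p s T Q) (h' : ¬ b.Holds s → Halts q s T Q) :
    Halts (.ite b p q) s (T + 1) Q := by
  by_cases hb : b.Holds s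
  · obtain ⟨t, s', hr, ht, hQ⟩ := h hb
    exact ⟨t + 1, s', Run.ite_pos hb hr, by omega, hQ⟩
  · obtain ⟨t, s', hr, ht, hQ⟩ := h' hb
    exact ⟨t + 1, s', Run.ite_neg hb hr, by omega, hQ⟩

/-- Execute `p` if the test holds. -/
def Prog.when (b : Test) (p : Prog) : Prog := .ite b p (.while (.not (.natLe (.const 0) (.const 0))) p)

theorem Halts.when {b : Test} {p : Prog} {s : Store} {T : ℕ} {Q : Store → Prop}
    (h : b.Holds s → Halts p s T Q) (h' : ¬ b.Holds s → Q s) :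
    Halts (.when b p) s (T + 2) Q := by
  refine Halts.ite (T := T + 1) (fun hb => ?_) fun hb => ?_
  · obtain ⟨t, s', hr, ht, hQ⟩ := h hb
    exact ⟨t, s', hr, by omega, hQ⟩
  -- The idle branch is a loop with a false test; it takes one step.
  · exact ⟨1, s, Run.while_neg (by simp [Test.Holds]), by omega, h' hb⟩

/-- The variable that is stored in the entry `(0, 0)` of the natural array `c`. -/
def NatExpr.var (c : ℕ) : NatExpr := .get c (.const 0) (.const 0)

/-- Execute `p` for all values of the variable `c` that are less than the variable `0`. -/
def Prog.for (c : ℕ) (p : Prog) : Prog :=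
  .seq (.setNat c (.const 0) (.const 0) (.const 0))
    (.while (.natLe (.add (.var c) (.const 1)) (.var 0))
      (.seq p (.setNat c (.const 0) (.const 0) (.add (.var c) (.const 1)))))

/-- A bound on the time of a loop. -/
def loopTime (n T : ℕ) : ℕ := n * (T + 2) + 2

/-- The invariant must be blind to the counter, which the loop itself writes; the body may write
neither the counter nor array `0`, which holds the bound. -/
theorem Halts.for {c : ℕ} {p : Prog} {s : Store} {n T : ℕ} {Inv : ℕ → Store → Prop}
    (hc : c ∉ p.natWrites) (h0 : 0 ∉ p.natWrites) (hc0 : c ≠ 0) (hn : s.nat 0 0 0 = n)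
    (hset : ∀ k m s', Inv k s' → Inv k (s'.setNat c 0 0 m)) (hinit : Inv 0 s)
    (hbody : ∀ k < n, ∀ s', Inv k s' → s'.nat c 0 0 = k →
      (∀ a, a ≠ c → a ∉ p.natWrites → s'.nat a = s.nat a) →
      (∀ a ∉ p.realWrites, s'.real a = s.real a) → Halts p s' T (Inv (k + 1))) :
    Halts (.for c p) s (loopTime n T) (Inv n) := by
  have key : ∀ m k s', k + m = n → Inv k s' → s'.nat c 0 0 = k →
      (∀ a, a ≠ c → a ∉ p.natWrites → s'.nat a = s.nat a) →
      (∀ a ∉ p.realWrites, s'.real a = s.real a) →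
      Halts (.while (.natLe (.add (.var c) (.const 1)) (.var 0))
        (.seq p (.setNat c (.const 0) (.const 0) (.add (.var c) (.const 1))))) s'
        (m * (T + 2) + 1) (Inv n) := by
    intro m
    induction m with
    | zero =>
      intro k s' hk hI hck hN hR
      obtain rfl : k = n := hk
      refine ⟨1, s', Run.while_neg ?_, by omega, hI⟩
      simp [Test.Holds, NatExpr.eval, NatExpr.var, hck, hN 0 hc0.symm h0, hn]
    | succ m ih =>
      intro k s' hk hI hck hN hR
      obtain ⟨t, s₁, hr, ht, hI₁⟩ := hbody k (by omega) s' hI hck hN hR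
      have hck₁ : s₁.nat c 0 0 = k := by rw [hr.nat_eq c hc, hck]
      obtain ⟨t₂, s₂, hr₂, ht₂, hI₂⟩ := ih (k + 1) (s₁.setNat c 0 0 (k + 1)) (by omega)
        (hset _ _ _ hI₁) (by simp [Store.nat_setNat_self])
        (fun a ha hap => by rw [Store.nat_setNat_of_ne ha, hr.nat_eq a hap, hN a ha hap])
        (fun a ha => by rw [Store.real_setNat, hr.real_eq a ha, hR a ha])
      refine ⟨t + 1 + t₂ + 1, s₂, Run.while_pos ?_ (Run.seq hr (Run.setNat _ _ _ _ _)) ?_, ?_, hI₂⟩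
      · simp [Test.Holds, NatExpr.eval, NatExpr.var, hck, hN 0 hc0.symm h0, hn]
        omega
      · simpa [NatExpr.eval, NatExpr.var, hck₁] using hr₂
      · rw [Nat.succ_mul]
        omega
  obtain ⟨t, s', hr, ht, hI⟩ := key n 0 (s.setNat c 0 0 0) (by omega) (hset _ _ _ hinit)
    (by simp [Store.nat_setNat_self]) (fun a ha _ => Store.nat_setNat_of_ne ha) (fun _ _ => rfl)
  exact ⟨1 + t, s', Run.seq (Run.setNat _ _ _ _ _) hr, by unfold loopTime; omega, hI⟩

/-- Indexing the invariant by the set of visited nodes hides the numbering; the body has to work for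
every such set. -/
theorem Halts.forNodes {V : Type*} [Fintype V] [DecidableEq V] {n : ℕ} (σ : V ≃ Fin n) {c : ℕ}
    {p : Prog} {s : Store} {T : ℕ} (Inv : Finset V → Store → Prop)
    (hc : c ∉ p.natWrites) (h0 : 0 ∉ p.natWrites) (hc0 : c ≠ 0) (hn : s.nat 0 0 0 = n)
    (hset : ∀ A m s', Inv A s' → Inv A (s'.setNat c 0 0 m)) (hinit : Inv ∅ s)
    (hbody : ∀ u, ∀ A, u ∉ A → ∀ s', Inv A s' → s'.nat c 0 0 = σ u →
      (∀ a, a ≠ c → a ∉ p.natWrites → s'.nat a = s.nat a) →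
      (∀ a ∉ p.realWrites, s'.real a = s.real a) → Halts p s' T (Inv (insert u A))) :
    Halts (.for c p) s (loopTime n T) (Inv Finset.univ) := by
  have h1 := Halts.for (T := T)
    (Inv := fun k => Inv (Finset.univ.filter fun u => (σ u : ℕ) < k)) hc h0 hc0 hn
    (fun k m s' => hset _ m s') (by simpa using hinit) (by
      intro k hk s' hI hck hN hR
      have h2 := hbody (σ.symm ⟨k, hk⟩) _ (by simp) s' hI (by simpa using hck) hN hR
      have h3 : (Finset.univ.filter fun u => (σ u : ℕ) < k + 1) =
          insert (σ.symm ⟨k, hk⟩) (Finset.univ.filter fun u => (σ u : ℕ) < k) := by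
        ext u
        simp only [Finset.mem_filter, Finset.mem_univ, true_and, Finset.mem_insert,
          Equiv.eq_symm_apply, Fin.ext_iff]
        omega
      rwa [h3])
  have h4 : (Finset.univ.filter fun u => (σ u : ℕ) < n) = Finset.univ := by
    ext u
    simp
  rwa [h4] at h1

theorem matrixOf_apply {V R : Type*} [Zero R] {n : ℕ} (σ : V ≃ Fin n) (f : Sym2 V → R) (u v : V) :
    matrixOf σ f (σ u) (σ v) = f s(u, v) := by
  simp [matrixOf]

end Machine

/-! ### Distances by repeated relaxation -/

section Distances

open SimpleGraph NatExpr

variable {V : Type*}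

/-- Set the entries of the array `5` to zero on the diagonal and to the number of nodes elsewhere. -/
def distInit : Prog :=
  .for 10 (.for 11 (.ite (.and (.natLe (var 10) (var 11)) (.natLe (var 11) (var 10)))
    (.setNat 5 (var 10) (var 11) (.const 0)) (.setNat 5 (var 10) (var 11) (var 0))))

/-- Improve the distance of the nodes `10` and `11` by a path whose last edge starts at `13`. -/
def relax : Prog :=
  .when (.and (.natLe (.const 1) (.get 1 (var 13) (var 11)))
      (.natLe (.add (.get 5 (var 10) (var 13)) (.const 1)) (.get 5 (var 10) (var 11))))
    (.setNat 5 (var 10) (var 11) (.add (.get 5 (var 10) (var 13)) (.const 1)))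

/-- Compute the distances of the nodes in the array `5`. -/
def distProg : Prog :=
  .seq distInit (.for 12 (.for 10 (.for 11 (.for 13 relax))))

theorem distInit_halts [Fintype V] {n : ℕ} (σ : V ≃ Fin n) {s : Store} (hn : s.nat 0 0 0 = n) :
    Halts distInit s (loopTime n (loopTime n 2)) fun s' =>
      ∀ u v, (u = v → s'.nat 5 (σ u) (σ v) = 0) ∧ (u ≠ v → s'.nat 5 (σ u) (σ v) = n) := by
  classical
  refine (Halts.forNodes σ (fun A s' => ∀ u ∈ A, ∀ v, (u = v → s'.nat 5 (σ u) (σ v) = 0) ∧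
    (u ≠ v → s'.nat 5 (σ u) (σ v) = n)) (by decide) (by decide) (by decide) hn
    (fun A m s' h => by simpa using h) (by simp) ?_).mono fun s' h _ _ => by simpa using h
  intro u A hu s₁ h₁ hu₁ hN₁ _
  have hn₁ := hN₁ 0 (by decide) (by decide)
  refine (Halts.forNodes σ (fun B s' =>
    (∀ u ∈ A, ∀ v, (u = v → s'.nat 5 (σ u) (σ v) = 0) ∧ (u ≠ v → s'.nat 5 (σ u) (σ v) = n)) ∧
    ∀ v ∈ B, (u = v → s'.nat 5 (σ u) (σ v) = 0) ∧ (u ≠ v → s'.nat 5 (σ u) (σ v) = n))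
    (by decide) (by decide) (by decide) (by rw [hn₁, hn])
    (fun A m s' h => by simpa using h) ⟨h₁, by simp⟩ ?_).mono fun s' h _ _ => ?_
  · intro v B hv s₂ h₂ hv₂ hN₂ _
    have hu₂ : s₂.nat 10 0 0 = σ u := by rw [hN₂ 10 (by decide) (by decide), hu₁]
    have hn₂ : s₂.nat 0 0 0 = n := by rw [hN₂ 0 (by decide) (by decide), hn₁, hn]
    have key : ∀ m, ((u = v → m = 0) ∧ (u ≠ v → m = n)) →
      (∀ u' ∈ A, ∀ v', (u' = v' → (s₂.setNat 5 (σ u) (σ v) m).nat 5 (σ u') (σ v') = 0) ∧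
        (u' ≠ v' → (s₂.setNat 5 (σ u) (σ v) m).nat 5 (σ u') (σ v') = n)) ∧
      ∀ v' ∈ insert v B, (u = v' → (s₂.setNat 5 (σ u) (σ v) m).nat 5 (σ u) (σ v') = 0) ∧
        (u ≠ v' → (s₂.setNat 5 (σ u) (σ v) m).nat 5 (σ u) (σ v') = n) := by
      intro m hm
      refine ⟨fun u' hu' v' => ?_, fun v' hv' => ?_⟩
      · have : u' ≠ u := by rintro rfl; exact hu hu'
        simpa [Store.nat_setNat_self, Fin.val_inj, this] using h₂.1 u' hu' v'
      · by_cases hvv : v' = v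
        · subst hvv
          simpa [Store.nat_setNat_self] using hm
        · simpa [Store.nat_setNat_self, Fin.val_inj, hvv] using
            h₂.2 v' ((Finset.mem_insert.1 hv').resolve_left hvv)
    refine Halts.ite (fun hb => Halts.setNat ?_) (fun hb => Halts.setNat ?_)
    · simp only [Test.Holds, eval, var, hu₂, hv₂] at hb
      simp only [eval, var, hu₂, hv₂]
      have : u = v := σ.injective (Fin.ext (by omega))
      exact key 0 ⟨fun _ => rfl, fun h => absurd this h⟩
    · simp only [Test.Holds, eval, var, hu₂, hv₂] at hb
      simp only [eval, var, hu₂, hv₂, hn₂]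
      exact key n ⟨fun h => absurd (by simp [h]) hb, fun h => rfl⟩
  · intro u' hu' v
    rcases Finset.mem_insert.1 hu' with rfl | hu'
    · exact h.2 v (Finset.mem_univ v)
    · exact h.1 u' hu' v

theorem dist_lt_card [Fintype V] {G : SimpleGraph V} (hG : G.IsTree) (u v : V) :
    G.dist u v < Fintype.card V := by
  obtain ⟨p, hp, hl⟩ := hG.1.exists_path_of_dist u v
  rw [← hl]
  exact hp.length_lt

theorem exists_adj_dist_lt {G : SimpleGraph V} (hG : G.Connected) {u v : V} (hne : u ≠ v) :
    ∃ k, G.Adj k v ∧ G.dist u k < G.dist u v := by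
  obtain ⟨p, hp⟩ := hG.exists_walk_length_eq_dist v u
  cases p with
  | nil => exact absurd rfl hne
  | @cons _ k _ h q =>
    refine ⟨k, h.symm, ?_⟩
    rw [dist_comm, dist_comm (u := u), ← hp, Walk.length_cons]
    exact Nat.lt_succ_of_le (dist_le q)

/-- The array `5` holds upper bounds on the distances that are at most `d`. -/
def DistBounds {n : ℕ} (G : SimpleGraph V) (σ : V ≃ Fin n) (d : V → V → ℕ) (s : Store) : Prop :=
  ∀ u v, G.dist u v ≤ s.nat 5 (σ u) (σ v) ∧ s.nat 5 (σ u) (σ v) ≤ d u v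

theorem relax_halts {n : ℕ} {G : SimpleGraph V} (hG : G.IsTree) (σ : V ≃ Fin n) {d : V → V → ℕ}
    {s : Store} (hd : DistBounds G σ d s)
    (hadj : s.nat 1 = matrixOf σ (indicatorOf G.edgeSet)) {i j k : V} (hi : s.nat 10 0 0 = σ i)
    (hj : s.nat 11 0 0 = σ j) (hk : s.nat 13 0 0 = σ k) :
    Halts relax s 3 fun s' => DistBounds G σ (fun u v => s.nat 5 (σ u) (σ v)) s' ∧
      (G.Adj k j → s'.nat 5 (σ i) (σ j) ≤ d i k + 1) := by
  have h1 : s.nat 1 (σ k) (σ j) = indicatorOf G.edgeSet s(k, j) := by rw [hadj, matrixOf_apply]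
  refine Halts.when (fun hb => Halts.setNat ?_) fun hb => ?_
  · simp only [Test.Holds, eval, var, hi, hj, hk, h1] at hb
    simp only [eval, var, hi, hj, hk]
    have hkj : G.Adj k j := by
      have h2 := hb.1
      unfold indicatorOf at h2
      split_ifs at h2 with h3
      · exact h3
      · omega
    refine ⟨fun u v => ?_, fun _ => ?_⟩
    · rw [Store.nat_setNat_self]
      split_ifs with h2
      · obtain ⟨rfl, rfl⟩ : u = i ∧ v = j := by simpa [Fin.val_inj] using h2
        refine ⟨?_, hb.2⟩
        have h3 := hG.1.dist_triangle (u := u) (v := k) (w := v)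
        rw [dist_eq_one_iff_adj.2 hkj] at h3
        have h4 := (hd u k).1
        omega
      · exact ⟨(hd u v).1, le_rfl⟩
    · simp only [Store.nat_setNat_self, and_self, if_true]
      have := (hd i k).2
      omega
  · simp only [Test.Holds, eval, var, hi, hj, hk, h1] at hb
    refine ⟨fun u v => ⟨(hd u v).1, le_rfl⟩, fun hkj => ?_⟩
    have h2 : indicatorOf G.edgeSet s(k, j) = 1 := if_pos hkj
    rw [h2] at hb
    have := (hd i k).2
    omega

theorem DistBounds.trans {n : ℕ} {G : SimpleGraph V} {σ : V ≃ Fin n} {d : V → V → ℕ}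
    {s s' : Store} (h : DistBounds G σ d s)
    (h' : DistBounds G σ (fun u v => s.nat 5 (σ u) (σ v)) s') : DistBounds G σ d s' :=
  fun u v => ⟨(h' u v).1, (h' u v).2.trans (h u v).2⟩

/-- Each round improves the bounds by all paths that are longer by one edge. -/
theorem relax_round_halts [Fintype V] {n : ℕ} {G : SimpleGraph V} (hG : G.IsTree) (σ : V ≃ Fin n)
    {d : V → V → ℕ} {s : Store} (hd : DistBounds G σ d s) (hn : s.nat 0 0 0 = n)
    (hadj : s.nat 1 = matrixOf σ (indicatorOf G.edgeSet)) :
    Halts (.for 10 (.for 11 (.for 13 relax))) s (loopTime n (loopTime n (loopTime n 3))) fun s' =>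
      DistBounds G σ d s' ∧ ∀ i j k, G.Adj k j → s'.nat 5 (σ i) (σ j) ≤ d i k + 1 := by
  classical
  refine (Halts.forNodes σ (fun A s' => DistBounds G σ d s' ∧ ∀ i ∈ A, ∀ j k, G.Adj k j →
      s'.nat 5 (σ i) (σ j) ≤ d i k + 1) (by decide) (by decide) (by decide) hn
    (fun A m s' h => by simpa [DistBounds] using h) ⟨hd, by simp⟩ ?_).mono
    fun s' h _ _ => by simpa using h
  intro i A _ s₁ h₁ hi₁ hN₁ _
  have hn₁ : s₁.nat 0 0 0 = n := by rw [hN₁ 0 (by decide) (by decide), hn]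
  have ha₁ : s₁.nat 1 = _ := (hN₁ 1 (by decide) (by decide)).trans hadj
  -- Each inner invariant compares with the memory at the start of its own loop. Entries only
  -- decrease, so bounds reached earlier persist.
  refine (Halts.forNodes σ (fun B s' => DistBounds G σ (fun u v => s₁.nat 5 (σ u) (σ v)) s' ∧
      ∀ j ∈ B, ∀ k, G.Adj k j → s'.nat 5 (σ i) (σ j) ≤ d i k + 1)
    (by decide) (by decide) (by decide) hn₁ (fun A m s' h => by simpa [DistBounds] using h)
    ⟨fun u v => ⟨(h₁.1 u v).1, le_rfl⟩, by simp⟩ ?_).mono fun s' h _ _ => ?_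
  · intro j B _ s₂ h₂ hj₂ hN₂ _
    have hn₂ : s₂.nat 0 0 0 = n := by rw [hN₂ 0 (by decide) (by decide), hn₁]
    have ha₂ : s₂.nat 1 = _ := (hN₂ 1 (by decide) (by decide)).trans ha₁
    have hi₂ : s₂.nat 10 0 0 = σ i := by rw [hN₂ 10 (by decide) (by decide), hi₁]
    refine (Halts.forNodes σ (fun C s' => DistBounds G σ (fun u v => s₂.nat 5 (σ u) (σ v)) s' ∧
        ∀ k ∈ C, G.Adj k j → s'.nat 5 (σ i) (σ j) ≤ d i k + 1)
      (by decide) (by decide) (by decide) hn₂ (fun A m s' h => by simpa [DistBounds] using h)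
      ⟨fun u v => ⟨(h₂.1 u v).1, le_rfl⟩, by simp⟩ ?_).mono fun s' h _ _ => ?_
    · intro k C _ s₃ h₃ hk₃ hN₃ _
      have ha₃ : s₃.nat 1 = _ := (hN₃ 1 (by decide) (by decide)).trans ha₂
      have hi₃ : s₃.nat 10 0 0 = σ i := by rw [hN₃ 10 (by decide) (by decide), hi₂]
      have hj₃ : s₃.nat 11 0 0 = σ j := by rw [hN₃ 11 (by decide) (by decide), hj₂]
      refine (relax_halts hG σ (h₁.1.trans (h₂.1.trans h₃.1)) ha₃ hi₃ hj₃ hk₃).mono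
        fun s' h _ _ => ⟨h₃.1.trans h.1, fun k' hk' hkj => ?_⟩
      rcases Finset.mem_insert.1 hk' with rfl | hk'
      · exact h.2 hkj
      · exact (h.1 i j).2.trans (h₃.2 k' hk' hkj)
    · refine ⟨h₂.1.trans h.1, fun j' hj' k hkj => ?_⟩
      rcases Finset.mem_insert.1 hj' with rfl | hj'
      · exact h.2 k (Finset.mem_univ k) hkj
      · exact (h.1 i j').2.trans (h₂.2 j' hj' k hkj)
  · refine ⟨h₁.1.trans h.1, fun i' hi' j k hkj => ?_⟩
    rcases Finset.mem_insert.1 hi' with rfl | hi'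
    · exact h.2 j (Finset.mem_univ j) k hkj
    · exact (h.1 i' j).2.trans (h₁.2 i' hi' j k hkj)

/-- After `t` rounds the entries of pairs at distance at most `t` are exact, and all distances are
less than `n`. -/
theorem distProg_halts [Fintype V] {n : ℕ} {G : SimpleGraph V} (hG : G.IsTree) (σ : V ≃ Fin n)
    {s : Store} (hn : s.nat 0 0 0 = n) (hadj : s.nat 1 = matrixOf σ (indicatorOf G.edgeSet)) :
    Halts distProg s (loopTime n (loopTime n 2) +
      loopTime n (loopTime n (loopTime n (loopTime n 3)))) fun s' =>
        ∀ u v, s'.nat 5 (σ u) (σ v) = G.dist u v := by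
  have hcard : Fintype.card V = n := by simpa using Fintype.card_congr σ
  have hlt : ∀ u v, G.dist u v < n := fun u v => hcard ▸ dist_lt_card hG u v
  refine (distInit_halts σ hn).seq fun s₀ h₀ hN₀ _ => ?_
  have hn₀ : s₀.nat 0 0 0 = n := by rw [hN₀ 0 (by decide), hn]
  have ha₀ : s₀.nat 1 = _ := (hN₀ 1 (by decide)).trans hadj
  refine (Halts.for (Inv := fun t s' => ∀ u v, G.dist u v ≤ s'.nat 5 (σ u) (σ v) ∧
      (G.dist u v ≤ t → s'.nat 5 (σ u) (σ v) ≤ G.dist u v)) (by decide) (by decide) (by decide)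
    hn₀ (fun k m s' h => by simpa using h) (fun u v => ?_) ?_).mono fun s' h _ _ u v =>
      le_antisymm ((h u v).2 (hlt u v).le) (h u v).1
  · by_cases huv : u = v
    · subst huv
      simp [(h₀ u u).1 rfl]
    · rw [(h₀ u v).2 huv]
      refine ⟨(hlt u v).le, fun h => ?_⟩
      have := hG.1.pos_dist_of_ne huv
      omega
  · intro t ht s₁ h₁ _ hN₁ _
    have hn₁ : s₁.nat 0 0 0 = n := by rw [hN₁ 0 (by decide) (by decide), hn₀]
    have ha₁ : s₁.nat 1 = _ := (hN₁ 1 (by decide) (by decide)).trans ha₀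
    refine (relax_round_halts hG σ (d := fun u v => s₁.nat 5 (σ u) (σ v))
      (fun u v => ⟨(h₁ u v).1, le_rfl⟩) hn₁ ha₁).mono fun s' h _ _ u v => ⟨(h.1 u v).1, fun htd => ?_⟩
    by_cases hle : G.dist u v ≤ t
    · exact (h.1 u v).2.trans ((h₁ u v).2 hle)
    · have hne : u ≠ v := by rintro rfl; simp at hle
      obtain ⟨k, hk, hd⟩ := exists_adj_dist_lt hG.1 hne
      have h2 := h.2 u v k hk
      have h3 := (h₁ u k).2 (by omega)
      omega

end Distances

/-! ### Correctness and running time of the primal-dual program -/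

section Algorithm

open SimpleGraph NatExpr

variable {V : Type*} {I : WTAP V} {r : V} {n : ℕ} {σ : V ≃ Fin n}

/-- The memory holds the links and the distances of the nodes; the root is the first node. -/
structure Prepared (I : WTAP V) (r : V) (σ : V ≃ Fin n) (s : Store) : Prop where
  card : s.nat 0 0 0 = n
  links : s.nat 2 = matrixOf σ (indicatorOf {l | l ∈ I.links})
  dist : ∀ u v, s.nat 5 (σ u) (σ v) = I.graph.dist u v
  root : (σ r : ℕ) = 0

theorem Prepared.congr {s s' : Store} (h : Prepared I r σ s) (h0 : s'.nat 0 = s.nat 0)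
    (h2 : s'.nat 2 = s.nat 2) (h5 : s'.nat 5 = s.nat 5) : Prepared I r σ s' :=
  ⟨by rw [h0, h.card], by rw [h2, h.links], by rw [h5]; exact h.dist, h.root⟩

/-- The test whether `a` is an ancestor of `b`. -/
def ancTest (a b : NatExpr) : Test :=
  .natLe (.add (.get 5 (.const 0) a) (.get 5 a b)) (.get 5 (.const 0) b)

def crossTest (i j w : NatExpr) : Test := .and (ancTest w i) (.not (ancTest w j))

def linkTest (i j : NatExpr) : Test := .natLe (.const 1) (.get 2 i j)

def upTest (i j : NatExpr) : Test := .and (linkTest i j) (ancTest j i)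

def eqTest (e f : NatExpr) : Test := .and (.natLe e f) (.natLe f e)

theorem eqTest_holds {s : Store} {e f : NatExpr} : (eqTest e f).Holds s ↔ e.eval s = f.eval s := by
  simp only [eqTest, Test.Holds]
  omega

theorem ancTest_holds {s : Store} (h : Prepared I r σ s) {a b : NatExpr} {u v : V}
    (ha : a.eval s = σ u) (hb : b.eval s = σ v) : (ancTest a b).Holds s ↔ Anc I.graph r u v := by
  simp only [ancTest, Test.Holds, eval, ha, hb, ← h.root, h.dist, Anc]

/-- The root has number zero, so row zero of array `5` holds the depths. -/
theorem depth_eval {s : Store} (h : Prepared I r σ s) {c : ℕ} {w : V} (hw : s.nat c 0 0 = σ w) :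
    (NatExpr.get 5 (.const 0) (var c)).eval s = I.graph.dist r w := by
  rw [← h.dist, h.root, ← hw]
  rfl

theorem crossTest_holds {s : Store} (h : Prepared I r σ s) {a b c : NatExpr} {i j w : V}
    (ha : a.eval s = σ i) (hb : b.eval s = σ j) (hc : c.eval s = σ w) :
    (crossTest a b c).Holds s ↔ Crosses I.graph r i j w := by
  simp only [crossTest, Test.Holds, ancTest_holds h hc ha, ancTest_holds h hc hb, Crosses]

theorem linkTest_holds {s : Store} (h : Prepared I r σ s) {a b : NatExpr} {i j : V}
    (ha : a.eval s = σ i) (hb : b.eval s = σ j) : (linkTest a b).Holds s ↔ s(i, j) ∈ I.links := by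
  simp only [linkTest, Test.Holds, eval, ha, hb, h.links, matrixOf_apply, indicatorOf,
    Set.mem_ofPred_eq]
  split_ifs with h1 <;> simp [h1]

theorem upTest_holds {s : Store} (h : Prepared I r σ s) {a b : NatExpr} {i j : V}
    (ha : a.eval s = σ i) (hb : b.eval s = σ j) : (upTest a b).Holds s ↔ I.Up r i j := by
  simp only [upTest, Test.Holds, linkTest_holds h ha hb, ancTest_holds h hb ha, WTAP.Up]

/-! ### The heavily covered subtrees -/

/-- Add up the values of the links that cross the subtree below the node `12`. -/
def crossingProg : Prog :=
  .for 10 (.for 11 (.when (crossTest (var 10) (var 11) (var 12))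
    (.setReal 3 (.const 0) (.const 0)
      (.add (.get 3 (.const 0) (.const 0)) (.get 1 (var 10) (var 11))))))

/-- Mark the nodes below which the crossing links have a large total value. -/
def heavyProg : Prog :=
  .for 12 (.seq (.setReal 3 (.const 0) (.const 0) .zero) (.seq crossingProg
    (.ite (.realLe (.get 2 (.const 0) (.const 0)) (.get 3 (.const 0) (.const 0)))
      (.setNat 6 (var 12) (.const 0) (.const 1)) (.setNat 6 (var 12) (.const 0) (.const 0)))))

/-- The real array `1` holds the vector `x`. -/
def HoldsVector (I : WTAP V) (σ : V ≃ Fin n) (x : Sym2 V → ℝ) (s : Store) : Prop :=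
  open Classical in s.real 1 = matrixOf σ fun l => if l ∈ I.links then x l else 0

theorem crossingProg_halts [Fintype V] {s : Store} (h : Prepared I r σ s) {x : Sym2 V → ℝ}
    (hx : HoldsVector I σ x s) {w : V} (hw : s.nat 12 0 0 = σ w) (h0 : s.real 3 0 0 = 0) :
    Halts crossingProg s (loopTime n (loopTime n 3)) fun s' =>
      s'.real 3 0 0 = I.crossing r x w := by
  classical
  let f : V → V → ℝ := fun i j => if Crosses I.graph r i j w then
    (if s(i, j) ∈ I.links then x s(i, j) else 0) else 0
  refine (Halts.forNodes σ (fun A s' => s'.real 3 0 0 = ∑ i ∈ A, ∑ j, f i j) (by decide)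
    (by decide) (by decide) h.card (fun A m s' h => by simpa using h) (by simpa using h0) ?_).mono
    fun s' h' _ _ => h'
  intro i A hi s₁ h₁ hi₁ hN₁ hR₁
  have hp₁ := h.congr (hN₁ 0 (by decide) (by decide)) (hN₁ 2 (by decide) (by decide))
    (hN₁ 5 (by decide) (by decide))
  have hw₁ : s₁.nat 12 0 0 = σ w := by rw [hN₁ 12 (by decide) (by decide), hw]
  have hx₁ : s₁.real 1 = s.real 1 := hR₁ 1 (by decide)
  refine (Halts.forNodes σ (fun B s' => s'.real 3 0 0 = s₁.real 3 0 0 + ∑ j ∈ B, f i j) (by decide)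
    (by decide) (by decide) hp₁.card (fun A m s' h => by simpa using h) (by simp) ?_).mono
    fun s' h' _ _ => ?_
  · intro j B hj s₂ h₂ hj₂ hN₂ hR₂
    have hp₂ := hp₁.congr (hN₂ 0 (by decide) (by decide)) (hN₂ 2 (by decide) (by decide))
      (hN₂ 5 (by decide) (by decide))
    have hw₂ : s₂.nat 12 0 0 = σ w := by rw [hN₂ 12 (by decide) (by decide), hw₁]
    have hi₂ : s₂.nat 10 0 0 = σ i := by rw [hN₂ 10 (by decide) (by decide), hi₁]
    have hx₂ : s₂.real 1 = s.real 1 := (hR₂ 1 (by decide)).trans hx₁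
    have htest : (crossTest (var 10) (var 11) (var 12)).Holds s₂ ↔ Crosses I.graph r i j w :=
      crossTest_holds hp₂ hi₂ hj₂ hw₂
    refine Halts.when (fun hb => Halts.setReal ?_) fun hb => ?_
    · simp only [RealExpr.eval, eval, var, hi₂, hj₂, Store.real_setReal_self, and_self, if_true]
      rw [h₂, hx₂, hx, matrixOf_apply, Finset.sum_insert hj]
      simp only [f, if_pos (htest.1 hb)]
      ring
    · rw [h₂, Finset.sum_insert hj]
      simp only [f, if_neg (mt htest.2 hb)]
      ring
  · rw [Finset.sum_insert hi, h', h₁]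
    ring

theorem heavyProg_halts [Fintype V] {s : Store} (h : Prepared I r σ s) {x : Sym2 V → ℝ}
    (hx : HoldsVector I σ x s) :
    Halts heavyProg s (loopTime n (1 + (loopTime n (loopTime n 3) + 2))) fun s' =>
      ∀ w, 1 ≤ s'.nat 6 (σ w) 0 ↔ s.real 2 0 0 ≤ I.crossing r x w := by
  classical
  refine (Halts.forNodes σ (fun A s' => ∀ w ∈ A, 1 ≤ s'.nat 6 (σ w) 0 ↔
    s.real 2 0 0 ≤ I.crossing r x w) (by decide)
    (by decide) (by decide) h.card (fun A m s' h => by simpa using h) (by simp) ?_).mono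
    fun s' h' _ _ => by simpa using h'
  intro w A hw s₁ h₁ hw₁ hN₁ hR₁
  have hp₁ := h.congr (hN₁ 0 (by decide) (by decide)) (hN₁ 2 (by decide) (by decide))
    (hN₁ 5 (by decide) (by decide))
  refine Halts.seq (Q := fun s' => s'.real 3 0 0 = 0)
    (Halts.setReal (by simp [RealExpr.eval, Store.real_setReal_self, eval])) ?_
  intro s₂ h₂ hN₂ hR₂
  have hp₂ := hp₁.congr (hN₂ 0 (by decide)) (hN₂ 2 (by decide)) (hN₂ 5 (by decide))
  have hw₂ : s₂.nat 12 0 0 = σ w := by rw [hN₂ 12 (by decide), hw₁]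
  have hx₂ : HoldsVector I σ x s₂ := by
    unfold HoldsVector
    rw [hR₂ 1 (by decide), hR₁ 1 (by decide), hx]
  refine (crossingProg_halts hp₂ hx₂ hw₂ h₂).seq ?_
  intro s₃ h₃ hN₃ hR₃
  have hw₃ : s₃.nat 12 0 0 = σ w := by rw [hN₃ 12 (by decide), hw₂]
  have hθ : s₃.real 2 0 0 = s.real 2 0 0 := by
    rw [hR₃ 2 (by decide), hR₂ 2 (by decide), hR₁ 2 (by decide)]
  have h6 : s₃.nat 6 = s₁.nat 6 := (hN₃ 6 (by decide)).trans (hN₂ 6 (by decide))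
  have key : ∀ m, (1 ≤ m ↔ s.real 2 0 0 ≤ I.crossing r x w) → ∀ w' ∈ insert w A,
      1 ≤ (s₃.setNat 6 (σ w) 0 m).nat 6 (σ w') 0 ↔ s.real 2 0 0 ≤ I.crossing r x w' := by
    intro m hm w' hw'
    by_cases hww : w' = w
    · subst hww
      simpa [Store.nat_setNat_self] using hm
    · simpa [Store.nat_setNat_self, Fin.val_inj, hww, h6] using
        h₁ w' ((Finset.mem_insert.1 hw').resolve_left hww)
  refine Halts.ite (fun hb => Halts.setNat ?_) (fun hb => Halts.setNat ?_)
  · simp only [Test.Holds, RealExpr.eval, eval, h₃, hθ] at hb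
    simp only [eval, var, hw₃]
    exact key 1 (by simpa using hb)
  · simp only [Test.Holds, RealExpr.eval, eval, h₃, hθ] at hb
    simp only [eval, var, hw₃]
    exact key 0 (by simpa using hb)

/-! ### The bottom-up phase -/

def selFst (w : NatExpr) : NatExpr := .get 7 w (.const 0)

def selSnd (w : NatExpr) : NatExpr := .get 8 w (.const 0)

/-- Replace the up-link of the node `12` by the pair of the nodes `10` and `11`, if this pair is
a better up-link. -/
def improveProg : Prog :=
  .when (.and (.and (upTest (var 10) (var 11)) (crossTest (var 10) (var 11) (var 12)))
      (.not (.and (linkTest (selFst (var 12)) (selSnd (var 12)))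
        (.realLe (.get 0 (selFst (var 12)) (selSnd (var 12))) (.get 0 (var 10) (var 11))))))
    (.seq (.setNat 7 (var 12) (.const 0) (var 10)) (.setNat 8 (var 12) (.const 0) (var 11)))

/-- Find an up-link with the least slack that crosses the subtree below the node `12`. -/
def pickProg : Prog :=
  .seq (.seq (.setNat 7 (var 12) (.const 0) (.const 0)) (.setNat 8 (var 12) (.const 0) (.const 0)))
    (.for 10 (.for 11 improveProg))

/-- The arrays `7` and `8` hold the pairs `b w`. -/
def HoldsPairs (σ : V ≃ Fin n) (b : V → V × V) (s : Store) : Prop :=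
  ∀ w, s.nat 7 (σ w) 0 = σ (b w).1 ∧ s.nat 8 (σ w) 0 = σ (b w).2

open Classical in
theorem HoldsPairs.update {b : V → V × V} {s : Store} (h : HoldsPairs σ b s) (w i j : V) :
    HoldsPairs σ (Function.update b w (i, j))
      ((s.setNat 7 (σ w) 0 (σ i)).setNat 8 (σ w) 0 (σ j)) := by
  intro g
  by_cases hg : g = w
  · subst hg
    simp [Store.nat_setNat_self]
  · simpa [Store.nat_setNat_self, Fin.val_inj, hg] using h g

open Classical in
/-- The pair of `w` is the best up-link among the pairs in `R`, and the other pairs are as in `b`. -/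
def IsBest (I : WTAP V) (r : V) (σ : V ≃ Fin n) (sl : V → V → ℝ) (b : V → V × V) (w : V)
    (R : V → V → Prop) (s : Store) : Prop :=
  ∃ i₀ j₀, HoldsPairs σ (Function.update b w (i₀, j₀)) s ∧
    (s(i₀, j₀) ∈ I.links → I.Up r i₀ j₀ ∧ Crosses I.graph r i₀ j₀ w) ∧
    ∀ i j, R i j → I.Up r i j → Crosses I.graph r i j w →
      s(i₀, j₀) ∈ I.links ∧ sl i₀ j₀ ≤ sl i j

theorem IsBest.mono {sl : V → V → ℝ} {b : V → V × V} {w : V} {R R' : V → V → Prop} {s : Store}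
    (h : IsBest I r σ sl b w R s) (hR : ∀ i j, R' i j → R i j) : IsBest I r σ sl b w R' s := by
  obtain ⟨i₀, j₀, h1, h2, h3⟩ := h
  exact ⟨i₀, j₀, h1, h2, fun i j hij => h3 i j (hR i j hij)⟩

theorem IsBest.setNat {sl : V → V → ℝ} {b : V → V × V} {w : V} {R : V → V → Prop} {s : Store}
    (h : IsBest I r σ sl b w R s) {c m : ℕ} (h7 : 7 ≠ c) (h8 : 8 ≠ c) :
    IsBest I r σ sl b w R (s.setNat c 0 0 m) := by
  obtain ⟨i₀, j₀, h1, h2, h3⟩ := h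
  exact ⟨i₀, j₀, fun g => by simpa [h7, h8] using h1 g, h2, h3⟩

theorem improveProg_halts {s : Store} (h : Prepared I r σ s) {sl : V → V → ℝ}
    (hsl : ∀ i j, s.real 0 (σ i) (σ j) = sl i j) {b : V → V × V} {w i j : V} {R : V → V → Prop}
    (hR : IsBest I r σ sl b w R s) (hi : s.nat 10 0 0 = σ i) (hj : s.nat 11 0 0 = σ j)
    (hw : s.nat 12 0 0 = σ w) :
    Halts improveProg s 4 (IsBest I r σ sl b w fun i' j' => R i' j' ∨ i' = i ∧ j' = j) := by
  classical
  obtain ⟨i₀, j₀, h1, h2, h3⟩ := hR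
  have hw' := h1 w
  rw [Function.update_self] at hw'
  have he1 : (selFst (var 12)).eval s = σ i₀ := by
    simp only [selFst, eval, var, hw]
    exact hw'.1
  have he2 : (selSnd (var 12)).eval s = σ j₀ := by
    simp only [selSnd, eval, var, hw]
    exact hw'.2
  have hup : (upTest (var 10) (var 11)).Holds s ↔ I.Up r i j := upTest_holds h hi hj
  have hcr : (crossTest (var 10) (var 11) (var 12)).Holds s ↔ Crosses I.graph r i j w :=
    crossTest_holds h hi hj hw
  have hlt := linkTest_holds h he1 he2
  have hi' : (var 10).eval s = σ i := hi
  have hj' : (var 11).eval s = σ j := hj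
  refine Halts.when (fun hb => ?_) fun hb => ?_
  · refine Halts.seq (T := 1) (T' := 1) (Q := fun s' => s' = s.setNat 7 (σ w) 0 (σ i)) (Halts.setNat ?_) ?_
    · simp only [eval, var, hw, hi]
    · rintro s₁ rfl - -
      refine Halts.setNat ?_
      have h4 := h1.update w i j
      rw [Function.update_idem] at h4
      have h5 : (var 12).eval (s.setNat 7 (σ w) 0 (σ i)) = σ w := by simp [eval, var, hw]
      have h6 : (var 11).eval (s.setNat 7 (σ w) 0 (σ i)) = σ j := by simp [eval, var, hj]
      simp only [h5, h6, eval]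
      simp only [Test.Holds, hup, hcr, hlt, RealExpr.eval, he1, he2, hi', hj', hsl] at hb
      refine ⟨i, j, h4, fun _ => hb.1, ?_⟩
      rintro i' j' (h7 | ⟨rfl, rfl⟩) h8 h9
      · obtain ⟨h10, h11⟩ := h3 i' j' h7 h8 h9
        refine ⟨hb.1.1.1, le_trans ?_ h11⟩
        by_contra h12
        exact hb.2 ⟨h10, (not_le.1 h12).le⟩
      · exact ⟨h8.1, le_rfl⟩
  · simp only [Test.Holds, hup, hcr, hlt, RealExpr.eval, he1, he2, hi', hj', hsl] at hb
    refine ⟨i₀, j₀, h1, h2, ?_⟩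
    rintro i' j' (h7 | ⟨rfl, rfl⟩) h8 h9
    · exact h3 i' j' h7 h8 h9
    · by_contra h10
      exact hb ⟨⟨h8, h9⟩, h10⟩

theorem pickProg_halts [Fintype V] {s : Store} (h : Prepared I r σ s) {sl : V → V → ℝ}
    (hsl : ∀ i j, s.real 0 (σ i) (σ j) = sl i j) {b : V → V × V} (hb : HoldsPairs σ b s) {w : V}
    (hw : s.nat 12 0 0 = σ w) :
    Halts pickProg s (1 + 1 + loopTime n (loopTime n 4))
      (IsBest I r σ sl b w fun _ _ => True) := by
  classical
  refine Halts.seq (Q := IsBest I r σ sl b w fun _ _ => False) (Halts.seq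
    (Q := fun s' => s' = s.setNat 7 (σ w) 0 (σ r)) (Halts.setNat ?_) ?_) ?_
  · simp only [eval, var, hw, h.root]
  · rintro s₁ rfl - -
    -- The pair `(r, r)` encodes that there is no candidate yet, as a loop is no link.
    refine Halts.setNat ⟨r, r, ?_, fun hr => absurd (Sym2.mk_isDiag_iff.2 rfl) (I.loopless _ hr), fun _ _ h => h.elim⟩
    have h4 := hb.update w r r
    have h5 : (var 12).eval (s.setNat 7 (σ w) 0 (σ r)) = σ w := by simp [eval, var, hw]
    simp only [h5, eval]
    simpa only [h.root] using h4
  · intro s₁ h₁ hN₁ hR₁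
    have hp₁ := h.congr (hN₁ 0 (by decide)) (hN₁ 2 (by decide)) (hN₁ 5 (by decide))
    have hw₁ : s₁.nat 12 0 0 = σ w := by rw [hN₁ 12 (by decide), hw]
    have hs₁ : s₁.real 0 = s.real 0 := hR₁ 0 (by decide)
    refine (Halts.forNodes σ (fun A => IsBest I r σ sl b w fun i _ => i ∈ A) (by decide)
      (by decide) (by decide) hp₁.card (fun A m s' h => h.setNat (by decide) (by decide))
      (h₁.mono (by simp)) ?_).mono fun s' h' _ _ => h'.mono (by simp)
    intro i A _ s₂ h₂ hi₂ hN₂ hR₂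
    have hp₂ := hp₁.congr (hN₂ 0 (by decide) (by decide)) (hN₂ 2 (by decide) (by decide))
      (hN₂ 5 (by decide) (by decide))
    have hw₂ : s₂.nat 12 0 0 = σ w := by rw [hN₂ 12 (by decide) (by decide), hw₁]
    have hs₂ : s₂.real 0 = s.real 0 := (hR₂ 0 (by decide)).trans hs₁
    refine (Halts.forNodes σ (fun B => IsBest I r σ sl b w fun i' j' => i' ∈ A ∨ i' = i ∧ j' ∈ B)
      (by decide) (by decide) (by decide) hp₂.card
      (fun A m s' h => h.setNat (by decide) (by decide)) (h₂.mono (by simp)) ?_).mono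
      fun s' h' _ _ => h'.mono fun i' j' => by simp; tauto
    intro j B _ s₃ h₃ hj₃ hN₃ hR₃
    have hp₃ := hp₂.congr (hN₃ 0 (by decide) (by decide)) (hN₃ 2 (by decide) (by decide))
      (hN₃ 5 (by decide) (by decide))
    have hw₃ : s₃.nat 12 0 0 = σ w := by rw [hN₃ 12 (by decide) (by decide), hw₂]
    have hi₃ : s₃.nat 10 0 0 = σ i := by rw [hN₃ 10 (by decide) (by decide), hi₂]
    have hs₃ : s₃.real 0 = s.real 0 := (hR₃ 0 (by decide)).trans hs₂
    refine (improveProg_halts hp₃ (by rw [hs₃]; exact hsl) h₃ hi₃ hj₃ hw₃).mono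
      fun s' h' _ _ => h'.mono fun i' j' => ?_
    simp only [Finset.mem_insert]
    tauto

/-- Reduce the slacks of all pairs that cross the subtree below the node `12` by the slack
of the up-link of this node. -/
def reduceProg : Prog :=
  .seq (.setReal 3 (.const 0) (.const 0) (.get 0 (selFst (var 12)) (selSnd (var 12))))
    (.for 10 (.for 11 (.when (crossTest (var 10) (var 11) (var 12))
      (.setReal 0 (var 10) (var 11)
        (.sub (.get 0 (var 10) (var 11)) (.get 3 (.const 0) (.const 0)))))))

/-- The real array `0` holds the slacks `sl`, reduced by `m` at the pairs in `R`. -/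
def Reduced (σ : V ≃ Fin n) (sl : V → V → ℝ) (m : ℝ) (R : V → V → Prop) (s : Store) : Prop :=
  ∀ i j, (R i j → s.real 0 (σ i) (σ j) = sl i j - m) ∧ (¬ R i j → s.real 0 (σ i) (σ j) = sl i j)

theorem Reduced.congr {sl : V → V → ℝ} {m : ℝ} {R R' : V → V → Prop} {s : Store}
    (h : Reduced σ sl m R s) (hR : ∀ i j, R' i j ↔ R i j) : Reduced σ sl m R' s :=
  fun i j => by rw [hR]; exact h i j

theorem reduceProg_halts [Fintype V] {s : Store} (h : Prepared I r σ s) {sl : V → V → ℝ}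
    (hsl : ∀ i j, s.real 0 (σ i) (σ j) = sl i j) {b : V → V × V} (hb : HoldsPairs σ b s) {w : V}
    (hw : s.nat 12 0 0 = σ w) :
    Halts reduceProg s (1 + loopTime n (loopTime n 3))
      (Reduced σ sl (sl (b w).1 (b w).2) fun i j => Crosses I.graph r i j w) := by
  classical
  set m := sl (b w).1 (b w).2 with hm
  -- The slack to be subtracted is saved first, because the loop also changes the entry it comes
  -- from.
  refine Halts.seq (Q := fun s' => s'.real 3 0 0 = m) (Halts.setReal ?_) ?_
  · simp only [RealExpr.eval, eval, selFst, selSnd, var, hw, (hb w).1, (hb w).2, hsl,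
      Store.real_setReal_self, and_self, if_true, hm]
  intro s₁ h₁ hN₁ hR₁
  have hp₁ := h.congr (hN₁ 0 (by decide)) (hN₁ 2 (by decide)) (hN₁ 5 (by decide))
  have hw₁ : s₁.nat 12 0 0 = σ w := by rw [hN₁ 12 (by decide), hw]
  have hs₁ : s₁.real 0 = s.real 0 := hR₁ 0 (by decide)
  refine (Halts.forNodes σ (fun A s' => s'.real 3 0 0 = m ∧
    Reduced σ sl m (fun i j => i ∈ A ∧ Crosses I.graph r i j w) s') (by decide)
    (by decide) (by decide) hp₁.card (fun A m s' h => by simpa [Reduced] using h)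
    ⟨h₁, fun i j => by simp [hs₁, hsl]⟩ ?_).mono fun s' h' _ _ => h'.2.congr (by simp)
  intro i A hiA s₂ h₂ hi₂ hN₂ hR₂
  have hp₂ := hp₁.congr (hN₂ 0 (by decide) (by decide)) (hN₂ 2 (by decide) (by decide))
    (hN₂ 5 (by decide) (by decide))
  have hw₂ : s₂.nat 12 0 0 = σ w := by rw [hN₂ 12 (by decide) (by decide), hw₁]
  refine (Halts.forNodes σ (fun B s' => s'.real 3 0 0 = m ∧
    Reduced σ sl m (fun i' j' => (i' ∈ A ∨ i' = i ∧ j' ∈ B) ∧ Crosses I.graph r i' j' w) s')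
    (by decide) (by decide) (by decide) hp₂.card (fun A m s' h => by simpa [Reduced] using h)
    ⟨h₂.1, h₂.2.congr (by simp)⟩ ?_).mono
    fun s' h' _ _ => ⟨h'.1, h'.2.congr fun i' j' => by simp; tauto⟩
  intro j B hjB s₃ h₃ hj₃ hN₃ hR₃
  have hp₃ := hp₂.congr (hN₃ 0 (by decide) (by decide)) (hN₃ 2 (by decide) (by decide))
    (hN₃ 5 (by decide) (by decide))
  have hw₃ : s₃.nat 12 0 0 = σ w := by rw [hN₃ 12 (by decide) (by decide), hw₂]
  have hi₃ : s₃.nat 10 0 0 = σ i := by rw [hN₃ 10 (by decide) (by decide), hi₂]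
  have htest : (crossTest (var 10) (var 11) (var 12)).Holds s₃ ↔ Crosses I.graph r i j w :=
    crossTest_holds hp₃ hi₃ hj₃ hw₃
  have hij := (h₃.2 i j).2 (by simp [hiA, hjB])
  refine Halts.when (fun hb => Halts.setReal ?_) fun hb => ⟨h₃.1, h₃.2.congr fun i' j' => ?_⟩
  · simp only [RealExpr.eval, eval, var, hi₃, hj₃, h₃.1, hij]
    refine ⟨by simp [h₃.1], fun i' j' => ?_⟩
    by_cases heq : i' = i ∧ j' = j
    · obtain ⟨rfl, rfl⟩ := heq
      have := htest.1 hb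
      simp [Store.real_setReal_self, this]
    · have h4 : ¬ ((σ i' : ℕ) = σ i ∧ (σ j' : ℕ) = σ j) := by
        simpa [Fin.val_inj] using heq
      have h5 := h₃.2 i' j'
      rw [Store.real_setReal_self, if_neg h4]
      have h6 : (i' ∈ A ∨ i' = i ∧ j' ∈ insert j B) ↔ (i' ∈ A ∨ i' = i ∧ j' ∈ B) := by
        rw [Finset.mem_insert]
        tauto
      simp only [h6]
      exact h5
  · rw [Finset.mem_insert]
    have h4 := mt htest.2 hb
    constructor
    · rintro ⟨h5 | ⟨rfl, rfl | h5⟩, h6⟩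
      · exact ⟨Or.inl h5, h6⟩
      · exact absurd h6 h4
      · exact ⟨Or.inr ⟨rfl, h5⟩, h6⟩
    · rintro ⟨h5 | ⟨rfl, h5⟩, h6⟩
      · exact ⟨Or.inl h5, h6⟩
      · exact ⟨Or.inr ⟨rfl, Or.inr h5⟩, h6⟩

def heavyTest (w : NatExpr) : Test := .natLe (.const 1) (.get 6 w (.const 0))

/-- Process the marked nodes in the order of decreasing distance from the root. -/
def upProg : Prog :=
  .for 14 (.for 12 (.when (.and (heavyTest (var 12))
      (eqTest (.add (.add (.get 5 (.const 0) (var 12)) (var 14)) (.const 1)) (var 0)))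
    (.seq pickProg reduceProg)))

/-- The memory holds a state of the bottom-up phase. -/
def HoldsDual [Fintype V] (I : WTAP V) (r : V) (σ : V ≃ Fin n) (H A : Set V) (s : Store) : Prop :=
  ∃ b y, HoldsPairs σ b s ∧ I.Dual r H A (fun i j => s.real 0 (σ i) (σ j)) b y

theorem HoldsDual.setNat [Fintype V] {H A : Set V} {s : Store} (h : HoldsDual I r σ H A s) {c m : ℕ}
    (h7 : 7 ≠ c) (h8 : 8 ≠ c) : HoldsDual I r σ H A (s.setNat c 0 0 m) := by
  obtain ⟨b, y, h1, h2⟩ := h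
  exact ⟨b, y, fun g => by simpa [h7, h8] using h1 g, h2⟩

/-- The processing of one node in the bottom-up phase. -/
theorem raise_halts [Fintype V] {H A : Set V} (hup : ∀ w ∈ H, ∃ i j, I.Up r i j ∧ Crosses I.graph r i j w)
    {s : Store} (h : Prepared I r σ s) (hd : HoldsDual I r σ H A s) {w : V} (hwH : w ∈ H)
    (hwA : w ∉ A) (hdist : ∀ g ∈ A, I.graph.dist r w ≤ I.graph.dist r g)
    (hw : s.nat 12 0 0 = σ w) :
    Halts (.seq pickProg reduceProg) s
      (1 + 1 + loopTime n (loopTime n 4) + (1 + loopTime n (loopTime n 3)))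
      (HoldsDual I r σ H (insert w A)) := by
  classical
  obtain ⟨b, y, hb, hy⟩ := hd
  refine (pickProg_halts h (fun _ _ => rfl) hb hw).seq fun s₁ h₁ hN₁ hR₁ => ?_
  have hp₁ := h.congr (hN₁ 0 (by decide)) (hN₁ 2 (by decide)) (hN₁ 5 (by decide))
  have hw₁ : s₁.nat 12 0 0 = σ w := by rw [hN₁ 12 (by decide), hw]
  have hs₁ : s₁.real 0 = s.real 0 := hR₁ 0 (by decide)
  obtain ⟨i₀, j₀, h2, h3, h4⟩ := h₁
  refine (reduceProg_halts hp₁ (fun i j => by rw [hs₁]) h2 hw₁).mono fun s' h' hN' _ => ?_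
  obtain ⟨i, j, hij, hcr⟩ := hup w hwH
  obtain ⟨h5, -⟩ := h4 i j trivial hij hcr
  obtain ⟨h6, h7⟩ := h3 h5
  have hbw : Function.update b w (i₀, j₀) w = (i₀, j₀) := Function.update_self ..
  obtain ⟨y', hy'⟩ := hy.insert_of_mem (sl' := fun i j => s'.real 0 (σ i) (σ j))
    (b' := Function.update b w (i₀, j₀)) hwH hwA hdist
    (fun g hg => Function.update_of_ne hg _ _) (by rw [hbw]; exact h6) (by rw [hbw]; exact h7)
    (fun i j h8 h9 => by rw [hbw]; exact (h4 i j trivial h8 h9).2)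
    (fun i j _ h9 => (h' i j).1 h9) (fun i j _ h9 => (h' i j).2 h9)
  refine ⟨_, y', fun g => ?_, hy'⟩
  rw [hN' 7 (by decide), hN' 8 (by decide)]
  exact h2 g

theorem upProg_halts [Fintype V] {H : Set V} (hup : ∀ w ∈ H, ∃ i j, I.Up r i j ∧ Crosses I.graph r i j w)
    {s : Store} (h : Prepared I r σ s) (hd : HoldsDual I r σ H ∅ s)
    (hH : ∀ w, 1 ≤ s.nat 6 (σ w) 0 ↔ w ∈ H) :
    Halts upProg s (loopTime n (loopTime n
        (1 + 1 + loopTime n (loopTime n 4) + (1 + loopTime n (loopTime n 3)) + 2)))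
      (HoldsDual I r σ H Set.univ) := by
  classical
  have hcard : Fintype.card V = n := by simpa using Fintype.card_congr σ
  have hlt : ∀ v, I.graph.dist r v < n := fun v => hcard ▸ dist_lt_card I.isTree r v
  -- Round `d` treats the nodes of depth `n - 1 - d`, so an increasing counter runs through the
  -- depths downwards.
  refine (Halts.for (Inv := fun d => HoldsDual I r σ H {w | n ≤ I.graph.dist r w + d}) (by decide)
    (by decide) (by decide) h.card (fun d m s' h => h.setNat (by decide) (by decide)) ?_ ?_).mono
    fun s' h' _ _ => ?_
  · have : {w | n ≤ I.graph.dist r w + 0} = ∅ := by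
      ext w
      simpa using hlt w
    rwa [this]
  · intro d _ s₁ h₁ hd₁ hN₁ _
    have hp₁ := h.congr (hN₁ 0 (by decide) (by decide)) (hN₁ 2 (by decide) (by decide))
      (hN₁ 5 (by decide) (by decide))
    have h6₁ : s₁.nat 6 = s.nat 6 := hN₁ 6 (by decide) (by decide)
    refine (Halts.forNodes σ (fun A => HoldsDual I r σ H {w | n ≤ I.graph.dist r w + d ∨
      w ∈ A ∧ I.graph.dist r w + d + 1 = n}) (by decide) (by decide) (by decide) hp₁.card
      (fun d m s' h => h.setNat (by decide) (by decide)) (by simpa using h₁) ?_).mono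
      fun s' h' _ _ => ?_
    · intro w A hwA s₂ h₂ hw₂ hN₂ _
      have hp₂ := hp₁.congr (hN₂ 0 (by decide) (by decide)) (hN₂ 2 (by decide) (by decide))
        (hN₂ 5 (by decide) (by decide))
      have h6₂ : s₂.nat 6 = s.nat 6 := (hN₂ 6 (by decide) (by decide)).trans h6₁
      have hd₂ : s₂.nat 14 0 0 = d := by rw [hN₂ 14 (by decide) (by decide), hd₁]
      have htest : (heavyTest (var 12)).Holds s₂ ↔ w ∈ H := by
        simp only [heavyTest, Test.Holds, eval, var, hw₂, h6₂, hH]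
      have htest' : (eqTest (.add (.add (.get 5 (.const 0) (var 12)) (var 14)) (.const 1))
          (var 0)).Holds s₂ ↔ I.graph.dist r w + d + 1 = n := by
        rw [eqTest_holds]
        have hdepth := depth_eval hp₂ hw₂
        simp only [eval, var] at hdepth
        simp only [eval, var, hdepth, hd₂, hp₂.card]
      have hins : I.graph.dist r w + d + 1 = n →
          {w' | n ≤ I.graph.dist r w' + d ∨ w' ∈ insert w A ∧ I.graph.dist r w' + d + 1 = n} =
          insert w {w' | n ≤ I.graph.dist r w' + d ∨ w' ∈ A ∧ I.graph.dist r w' + d + 1 = n} := by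
        intro hdw
        ext g
        simp only [Finset.mem_insert, Set.mem_insert_iff, Set.mem_ofPred_eq]
        by_cases hg : g = w
        · subst hg; simp [hdw]
        · simp [hg]
      have hsame : ¬ I.graph.dist r w + d + 1 = n →
          {w' | n ≤ I.graph.dist r w' + d ∨ w' ∈ insert w A ∧ I.graph.dist r w' + d + 1 = n} =
          {w' | n ≤ I.graph.dist r w' + d ∨ w' ∈ A ∧ I.graph.dist r w' + d + 1 = n} := by
        intro hdw
        ext g
        simp only [Finset.mem_insert, Set.mem_ofPred_eq]
        by_cases hg : g = w
        · subst hg; simp [hdw]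
        · simp [hg]
      refine Halts.when (fun hb => ?_) fun hb => ?_
      · simp only [Test.Holds, htest, htest'] at hb
        rw [hins hb.2]
        refine raise_halts hup hp₂ h₂ hb.1 ?_ ?_ hw₂
        · rintro (h3 | h3)
          · omega
          · exact hwA h3.1
        · rintro g (h3 | h3) <;> omega
      · simp only [Test.Holds, htest, htest'] at hb
        by_cases hdw : I.graph.dist r w + d + 1 = n
        · rw [hins hdw]
          obtain ⟨b, y, h3, h4⟩ := h₂
          exact ⟨b, y, h3, h4.insert_of_notMem fun h5 => hb ⟨h5, hdw⟩⟩
        · rwa [hsame hdw]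
    · convert h' using 1
      ext w
      simp only [Finset.mem_univ, true_and, Set.mem_ofPred_eq]
      omega
  · convert h' using 1
    ext w
    simp

/-! ### The top-down phase -/

/-- Output the up-link of the node `12` and mark the nodes whose subtrees it crosses. -/
def selectProg : Prog :=
  .seq (.setNat 4 (selFst (var 12)) (selSnd (var 12)) (.const 1))
    (.for 13 (.when (crossTest (selFst (var 12)) (selSnd (var 12)) (var 13))
      (.setNat 9 (var 13) (.const 0) (.const 1))))

/-- Process the marked nodes in the order of increasing distance from the root. -/
def downProg : Prog :=
  .for 14 (.for 12 (.when (.and (.and (heavyTest (var 12))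
      (eqTest (.get 5 (.const 0) (var 12)) (var 14)))
      (.natLe (.get 9 (var 12) (.const 0)) (.const 0))) selectProg))

/-- The array `4` holds the up-links of the nodes in `T`, and the array `9` the nodes whose
subtrees they cross. -/
def HoldsSelection (I : WTAP V) (r : V) (σ : V ≃ Fin n) (b : V → V × V) (T : Set V)
    (s : Store) : Prop :=
  (∀ i j, s.nat 4 (σ i) (σ j) ≠ 0 ↔ ∃ w ∈ T, b w = (i, j)) ∧
    ∀ g, s.nat 9 (σ g) 0 ≠ 0 ↔ ∃ w ∈ T, Crosses I.graph r (b w).1 (b w).2 g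

theorem selectProg_halts [Fintype V] {s : Store} (h : Prepared I r σ s) {b : V → V × V}
    (hb : HoldsPairs σ b s) {T : Set V} (hT : HoldsSelection I r σ b T s) {w : V}
    (hw : s.nat 12 0 0 = σ w) :
    Halts selectProg s (1 + loopTime n 3) (HoldsSelection I r σ b (insert w T)) := by
  classical
  refine Halts.seq (Q := fun s' => (∀ i j, s'.nat 4 (σ i) (σ j) ≠ 0 ↔ ∃ w' ∈ insert w T, b w' = (i, j)) ∧
    s'.nat 9 = s.nat 9) (Halts.setNat ⟨fun i j => ?_, by simp⟩) ?_
  · simp only [eval, selFst, selSnd, var, hw, (hb w).1, (hb w).2, Store.nat_setNat_self]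
    rw [Set.exists_mem_insert]
    by_cases hij : b w = (i, j)
    · simp [hij]
    · have h1 : ¬ ((σ i : ℕ) = σ (b w).1 ∧ (σ j : ℕ) = σ (b w).2) := by
        rintro ⟨h1, h2⟩
        apply hij
        rw [Fin.val_inj, σ.apply_eq_iff_eq] at h1 h2
        rw [h1, h2]
      rw [if_neg h1, hT.1]
      simp [hij]
  intro s₁ h₁ hN₁ _
  have hp₁ := h.congr (hN₁ 0 (by decide)) (hN₁ 2 (by decide)) (hN₁ 5 (by decide))
  have hw₁ : s₁.nat 12 0 0 = σ w := by rw [hN₁ 12 (by decide), hw]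
  have hb₁ : HoldsPairs σ b s₁ := by
    intro g
    rw [hN₁ 7 (by decide), hN₁ 8 (by decide)]
    exact hb g
  refine (Halts.forNodes σ (fun A s' => ∀ g, s'.nat 9 (σ g) 0 ≠ 0 ↔
      (∃ w' ∈ T, Crosses I.graph r (b w').1 (b w').2 g) ∨
        g ∈ A ∧ Crosses I.graph r (b w).1 (b w).2 g) (by decide) (by decide) (by decide)
    hp₁.card (fun A m s' h => by simpa using h) (by simpa [h₁.2] using hT.2) ?_).mono
    fun s' h' hN' _ => ⟨by rw [hN' 4 (by decide)]; exact h₁.1, fun g => ?_⟩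
  · intro g A _ s₂ h₂ hg₂ hN₂ _
    have hp₂ := hp₁.congr (hN₂ 0 (by decide) (by decide)) (hN₂ 2 (by decide) (by decide))
      (hN₂ 5 (by decide) (by decide))
    have hw₂ : s₂.nat 12 0 0 = σ w := by rw [hN₂ 12 (by decide) (by decide), hw₁]
    have h7₂ : s₂.nat 7 = s₁.nat 7 := hN₂ 7 (by decide) (by decide)
    have h8₂ : s₂.nat 8 = s₁.nat 8 := hN₂ 8 (by decide) (by decide)
    have htest : (crossTest (selFst (var 12)) (selSnd (var 12)) (var 13)).Holds s₂ ↔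
        Crosses I.graph r (b w).1 (b w).2 g := by
      refine crossTest_holds hp₂ ?_ ?_ hg₂
      · simp only [eval, selFst, var, hw₂, h7₂, (hb₁ w).1]
      · simp only [eval, selSnd, var, hw₂, h8₂, (hb₁ w).2]
    refine Halts.when (fun hc => Halts.setNat fun g' => ?_) fun hc g' => ?_
    · simp only [eval, var, hg₂, Store.nat_setNat_self]
      by_cases hgg : g' = g
      · subst hgg
        simp [htest.1 hc]
      · simpa [Fin.val_inj, hgg] using h₂ g'
    · rw [h₂, Finset.mem_insert]
      by_cases hgg : g' = g
      · subst hgg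
        simp [mt htest.2 hc]
      · simp [hgg]
  · rw [h', Set.exists_mem_insert]
    simp only [Finset.mem_univ, true_and]
    exact or_comm

/-- The memory holds a state of the top-down phase. -/
def HoldsSelected (I : WTAP V) (r : V) (σ : V ≃ Fin n) (H A : Set V) (b : V → V × V)
    (s : Store) : Prop :=
  ∃ T, HoldsSelection I r σ b T s ∧ Selection I.graph r H A b T

theorem HoldsSelected.setNat {H A : Set V} {b : V → V × V} {s : Store}
    (h : HoldsSelected I r σ H A b s) {c m : ℕ} (h4 : 4 ≠ c) (h9 : 9 ≠ c) :
    HoldsSelected I r σ H A b (s.setNat c 0 0 m) := by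
  obtain ⟨T, h1, h2⟩ := h
  exact ⟨T, by simpa [HoldsSelection, h4, h9] using h1, h2⟩

theorem downProg_halts [Fintype V] {H : Set V} {b : V → V × V}
    (hcr : ∀ w ∈ H, Crosses I.graph r (b w).1 (b w).2 w) {s : Store} (h : Prepared I r σ s)
    (hb : HoldsPairs σ b s) (hT : HoldsSelection I r σ b ∅ s)
    (hH : ∀ w, 1 ≤ s.nat 6 (σ w) 0 ↔ w ∈ H) :
    Halts downProg s (loopTime n (loopTime n (1 + loopTime n 3 + 2)))
      (HoldsSelected I r σ H Set.univ b) := by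
  classical
  have hcard : Fintype.card V = n := by simpa using Fintype.card_congr σ
  have hlt : ∀ v, I.graph.dist r v < n := fun v => hcard ▸ dist_lt_card I.isTree r v
  -- Round `d` treats the nodes of depth `d`, from the root to the leaves.
  refine (Halts.for (Inv := fun d => HoldsSelected I r σ H {w | I.graph.dist r w < d} b) (by decide)
    (by decide) (by decide) h.card (fun d m s' h => h.setNat (by decide) (by decide)) ?_ ?_).mono
    fun s' h' _ _ => ?_
  · have : {w | I.graph.dist r w < 0} = ∅ := by simp
    rw [this]
    exact ⟨∅, hT, selection_init⟩
  · intro d _ s₁ h₁ hd₁ hN₁ _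
    have hp₁ := h.congr (hN₁ 0 (by decide) (by decide)) (hN₁ 2 (by decide) (by decide))
      (hN₁ 5 (by decide) (by decide))
    have h6₁ : s₁.nat 6 = s.nat 6 := hN₁ 6 (by decide) (by decide)
    have h7₁ : s₁.nat 7 = s.nat 7 := hN₁ 7 (by decide) (by decide)
    have h8₁ : s₁.nat 8 = s.nat 8 := hN₁ 8 (by decide) (by decide)
    refine (Halts.forNodes σ (fun A => HoldsSelected I r σ H {w | I.graph.dist r w < d ∨
      w ∈ A ∧ I.graph.dist r w = d} b) (by decide) (by decide) (by decide) hp₁.card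
      (fun d m s' h => h.setNat (by decide) (by decide)) (by simpa using h₁) ?_).mono
      fun s' h' _ _ => ?_
    · intro w A hwA s₂ h₂ hw₂ hN₂ _
      have hp₂ := hp₁.congr (hN₂ 0 (by decide) (by decide)) (hN₂ 2 (by decide) (by decide))
        (hN₂ 5 (by decide) (by decide))
      have h6₂ : s₂.nat 6 = s.nat 6 := (hN₂ 6 (by decide) (by decide)).trans h6₁
      have hb₂ : HoldsPairs σ b s₂ := by
        intro g
        rw [hN₂ 7 (by decide) (by decide), hN₂ 8 (by decide) (by decide), h7₁, h8₁]
        exact hb g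
      have hd₂ : s₂.nat 14 0 0 = d := by rw [hN₂ 14 (by decide) (by decide), hd₁]
      have htest : (heavyTest (var 12)).Holds s₂ ↔ w ∈ H := by
        simp only [heavyTest, Test.Holds, eval, var, hw₂, h6₂, hH]
      have htest' : (eqTest (.get 5 (.const 0) (var 12)) (var 14)).Holds s₂ ↔
          I.graph.dist r w = d := by
        rw [eqTest_holds]
        rw [depth_eval hp₂ hw₂]
        simp only [eval, var, hd₂]
      obtain ⟨T, h3, h4⟩ := h₂
      have htest'' : (Test.natLe (.get 9 (var 12) (.const 0)) (.const 0)).Holds s₂ ↔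
          ¬ ∃ g ∈ T, Crosses I.graph r (b g).1 (b g).2 w := by
        simp only [Test.Holds, eval, var, hw₂, ← h3.2, nonpos_iff_eq_zero, not_not]
      have hins : I.graph.dist r w = d →
          {w' | I.graph.dist r w' < d ∨ w' ∈ insert w A ∧ I.graph.dist r w' = d} =
          insert w {w' | I.graph.dist r w' < d ∨ w' ∈ A ∧ I.graph.dist r w' = d} := by
        intro hdw
        ext g
        simp only [Finset.mem_insert, Set.mem_insert_iff, Set.mem_ofPred_eq]
        by_cases hg : g = w
        · subst hg; simp [hdw]
        · simp [hg]
      have hsame : ¬ I.graph.dist r w = d →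
          {w' | I.graph.dist r w' < d ∨ w' ∈ insert w A ∧ I.graph.dist r w' = d} =
          {w' | I.graph.dist r w' < d ∨ w' ∈ A ∧ I.graph.dist r w' = d} := by
        intro hdw
        ext g
        simp only [Finset.mem_insert, Set.mem_ofPred_eq]
        by_cases hg : g = w
        · subst hg; simp [hdw]
        · simp [hg]
      refine Halts.when (fun hc => ?_) fun hc => ?_
      · replace hc := (and_congr (and_congr htest htest') htest'').1 hc
        rw [hins hc.1.2]
        refine (selectProg_halts hp₂ hb₂ h3 hw₂).mono fun s' h' _ _ => ⟨_, h', ?_⟩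
        refine h4.insert_of_not_covered I.isTree hc.1.1 (hcr w hc.1.1) ?_ hc.2
        rintro g (h5 | h5) <;> omega
      · replace hc := mt (and_congr (and_congr htest htest') htest'').2 hc
        by_cases hdw : I.graph.dist r w = d
        · rw [hins hdw]
          exact ⟨T, h3, h4.insert_of_covered fun h5 => by tauto⟩
        · rw [hsame hdw]
          exact ⟨T, h3, h4⟩
    · convert h' using 1
      ext w
      simp only [Finset.mem_univ, true_and, Set.mem_ofPred_eq]
      omega
  · convert h' using 1
    ext w
    simpa using hlt w

end Algorithm

open NatExpr

/-! ### The two programs and their polynomial time bounds -/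

section Algorithms

/-- The function is given by a polynomial. -/
def IsPolynomial (f : ℕ → ℕ) : Prop := ∃ q : Polynomial ℕ, ∀ n, q.eval n = f n

theorem IsPolynomial.const (k : ℕ) : IsPolynomial fun _ => k := ⟨Polynomial.C k, by simp⟩

theorem IsPolynomial.add {f g : ℕ → ℕ} (hf : IsPolynomial f) (hg : IsPolynomial g) :
    IsPolynomial fun n => f n + g n := by
  obtain ⟨p, hp⟩ := hf
  obtain ⟨q, hq⟩ := hg
  exact ⟨p + q, by simp [hp, hq]⟩

theorem IsPolynomial.loopTime {f : ℕ → ℕ} (hf : IsPolynomial f) :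
    IsPolynomial fun n => loopTime n (f n) := by
  obtain ⟨p, hp⟩ := hf
  exact ⟨Polynomial.X * (p + 2) + 2, by simp [hp, TreeAug.loopTime]⟩

variable {V : Type*} {n : ℕ} {σ : V ≃ Fin n}

/-- Copy the array `3` to the output. -/
def copyProg : Prog := .for 10 (.for 11 (.setNat 4 (var 10) (var 11) (.get 3 (var 10) (var 11))))

def copyTime (n : ℕ) : ℕ := loopTime n (loopTime n 1)

theorem isPolynomial_copyTime : IsPolynomial copyTime := (IsPolynomial.const 1).loopTime.loopTime

theorem copyProg_computes [Fintype V] (I : WTAP V) (σ : V ≃ Fin n) {F : Finset (Sym2 V)}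
    (x : Sym2 V → ℝ) (θ : ℝ) : Computes copyProg (I.input σ F x θ) (copyTime n) σ F := by
  classical
  set s := I.input σ F x θ with hs
  have hn : s.nat 0 0 0 = n := by simp [hs, WTAP.input]
  have h3 : s.nat 3 = matrixOf σ (indicatorOf (F : Set (Sym2 V))) := rfl
  have h : Halts copyProg s (copyTime n) fun s' => ∀ i j, s'.nat 4 (σ i) (σ j) =
      indicatorOf (F : Set (Sym2 V)) s(i, j) := by
    refine (Halts.forNodes σ (fun A s' => ∀ i ∈ A, ∀ j, s'.nat 4 (σ i) (σ j) =
      indicatorOf (F : Set (Sym2 V)) s(i, j)) (by decide) (by decide) (by decide) hn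
      (fun A m s' h => by simpa using h) (by simp) ?_).mono fun s' h' _ _ => by simpa using h'
    intro i A _ s₁ h₁ hi₁ hN₁ _
    have hn₁ : s₁.nat 0 0 0 = n := by rw [hN₁ 0 (by decide) (by decide), hn]
    refine (Halts.forNodes σ (fun B s' => ∀ i' j', i' ∈ A ∨ i' = i ∧ j' ∈ B →
      s'.nat 4 (σ i') (σ j') = indicatorOf (F : Set (Sym2 V)) s(i', j'))
      (by decide) (by decide) (by decide) hn₁ (fun A m s' h => by simpa using h)
      (fun i' j' h => h₁ i' (by simpa using h) j') ?_).mono fun s' h' _ _ i' hi' j' => h' i' j' ?_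
    · intro j B _ s₂ h₂ hj₂ hN₂ _
      have hi₂ : s₂.nat 10 0 0 = σ i := by rw [hN₂ 10 (by decide) (by decide), hi₁]
      have h3₂ : s₂.nat 3 = _ :=
        ((hN₂ 3 (by decide) (by decide)).trans (hN₁ 3 (by decide) (by decide))).trans h3
      refine Halts.setNat fun i' j' hij => ?_
      simp only [eval, var, hi₂, hj₂, h3₂, matrixOf_apply, Store.nat_setNat_self, Fin.val_inj,
        σ.apply_eq_iff_eq]
      split_ifs with heq
      · rw [heq.1, heq.2]
      · refine h₂ i' j' ?_
        rw [Finset.mem_insert] at hij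
        tauto
    · rw [Finset.mem_insert] at hi'
      simp only [Finset.mem_univ, and_true]
      exact hi'.symm
  obtain ⟨t, s', hr, ht, hQ⟩ := h
  refine ⟨t, s', hr, ht, ?_⟩
  ext l
  simp only [Store.output, hQ, indicatorOf, Set.mem_ofPred_eq]
  constructor
  · rintro ⟨u, v, rfl, h⟩
    simpa using h
  · intro hl
    induction l using Sym2.ind with
    | _ u v => exact ⟨u, v, rfl, by simpa using hl⟩

/-- The primal-dual algorithm for the heavily covered edges. -/
def coverProg : Prog := .seq distProg (.seq heavyProg (.seq upProg downProg))

def coverTime (n : ℕ) : ℕ :=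
  (loopTime n (loopTime n 2) + loopTime n (loopTime n (loopTime n (loopTime n 3)))) +
  (loopTime n (1 + (loopTime n (loopTime n 3) + 2)) +
  (loopTime n (loopTime n
    (1 + 1 + loopTime n (loopTime n 4) + (1 + loopTime n (loopTime n 3)) + 2)) +
  loopTime n (loopTime n (1 + loopTime n 3 + 2))))

theorem isPolynomial_coverTime : IsPolynomial coverTime := by
  have c := IsPolynomial.const
  refine (((c 2).loopTime.loopTime).add (c 3).loopTime.loopTime.loopTime.loopTime).add
    ((((c 1).add ((c 3).loopTime.loopTime.add (c 2))).loopTime).add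
      (IsPolynomial.add (IsPolynomial.loopTime (IsPolynomial.loopTime ?_))
        (((c 1).add (c 3).loopTime).add (c 2)).loopTime.loopTime))
  exact ((((c 1).add (c 1)).add (c 4).loopTime.loopTime).add
    ((c 1).add (c 3).loopTime.loopTime)).add (c 2)

theorem coverProg_computes [Fintype V] {I : WTAP V} (hs : I.ShadowComplete)
    (hc : ∀ l ∈ I.links, 1 ≤ I.cost l) {x : Sym2 V → ℝ} (hx : ∀ l ∈ I.links, 0 ≤ x l) {ε : ℝ}
    (hε : 0 < ε) (σ : V ≃ Fin n) :
    ∃ S : Finset (Sym2 V), Computes coverProg (I.input σ ∅ x (2 / ε)) (coverTime n) σ S ∧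
      S ⊆ I.links ∧ I.Covers S (I.heavy ε x) ∧ I.setCost S ≤ ε * I.fracCost x := by
  classical
  have hne := I.isTree.1.nonempty
  have hpos : 0 < n := (σ hne.some).pos
  set r := σ.symm ⟨0, hpos⟩ with hr
  have hroot : (σ r : ℕ) = 0 := by simp [hr]
  set H := {w | 2 / ε ≤ I.crossing r x w} with hH
  have hup : ∀ w ∈ H, ∃ i j, I.Up r i j ∧ Crosses I.graph r i j w := fun w hw =>
    exists_up_of_crossing_pos hs (lt_of_lt_of_le (by positivity) hw)
  set s := I.input σ ∅ x (2 / ε) with hsdef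
  have hn : s.nat 0 0 0 = n := by simp [hsdef, WTAP.input]
  have key : Halts coverProg s (coverTime n) fun s' => ∃ sl b y,
      I.Dual r H Set.univ sl b y ∧ HoldsSelected I r σ H Set.univ b s' := by
    refine (distProg_halts I.isTree σ hn rfl).seq fun s₁ h₁ hN₁ hR₁ => ?_
    have hp₁ : Prepared I r σ s₁ :=
      ⟨by rw [hN₁ 0 (by decide), hn], by rw [hN₁ 2 (by decide)]; rfl, h₁, hroot⟩
    have hx₁ : HoldsVector I σ x s₁ := by
      unfold HoldsVector
      rw [hR₁ 1 (by decide)]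
      rfl
    refine (heavyProg_halts hp₁ hx₁).seq fun s₂ h₂ hN₂ hR₂ => ?_
    have hp₂ := hp₁.congr (hN₂ 0 (by decide)) (hN₂ 2 (by decide)) (hN₂ 5 (by decide))
    have hθ : s₁.real 2 0 0 = 2 / ε := by
      rw [hR₁ 2 (by decide)]
      simp [hsdef, WTAP.input]
    rw [hθ] at h₂
    have hd₂ : HoldsDual I r σ H ∅ s₂ := by
      -- Arrays `7` and `8` are still zero, that is, they hold the root for every node; nothing has
      -- been processed, so the pairs are irrelevant.
      refine ⟨fun _ => (r, r), 0, fun w => ?_, dual_init hc fun i j hij => ?_⟩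
      · rw [hN₂ 7 (by decide), hN₁ 7 (by decide), hN₂ 8 (by decide), hN₁ 8 (by decide), hroot]
        exact ⟨rfl, rfl⟩
      · rw [hR₂ 0 (by decide), hR₁ 0 (by decide)]
        have h0 : s.real 0 = matrixOf σ fun l => if l ∈ I.links then I.cost l else 0 := rfl
        rw [h0, matrixOf_apply, if_pos hij.1]
    refine (upProg_halts hup hp₂ hd₂ h₂).seq fun s₃ h₃ hN₃ hR₃ => ?_
    have hp₃ := hp₂.congr (hN₃ 0 (by decide)) (hN₃ 2 (by decide)) (hN₃ 5 (by decide))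
    obtain ⟨b, y, hb, hy⟩ := h₃
    refine (downProg_halts (fun w hw => (hy.chosen w trivial hw).2.1) hp₃ hb ⟨fun i j => ?_,
      fun g => ?_⟩ (by rw [hN₃ 6 (by decide)]; exact h₂)).mono fun s' h' _ _ => ⟨_, b, y, hy, h'⟩
    · rw [hN₃ 4 (by decide), hN₂ 4 (by decide), hN₁ 4 (by decide)]
      simp [hsdef, WTAP.input]
    · rw [hN₃ 9 (by decide), hN₂ 9 (by decide), hN₁ 9 (by decide)]
      simp [hsdef, WTAP.input]
  obtain ⟨t, s', hrun, ht, sl, b, y, hy, T, hT, hsel⟩ := key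
  have hT' : Selection I.graph r H Set.univ b (T.toFinite.toFinset : Finset V) := by
    rwa [Set.Finite.coe_toFinset]
  refine ⟨T.toFinite.toFinset.image fun w => s((b w).1, (b w).2), ⟨t, s', hrun, ht, ?_⟩,
    selection_covers hs hc hx hε hy hT' fun l => by simp [eq_comm]⟩
  ext l
  simp only [Store.output, hT.1, Set.mem_ofPred_eq, Finset.mem_image, Set.Finite.mem_toFinset]
  constructor
  · rintro ⟨u, v, rfl, w, hw, hbw⟩
    exact ⟨w, hw, by rw [hbw]⟩
  · rintro ⟨w, hw, rfl⟩
    exact ⟨_, _, rfl, w, hw, rfl⟩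

end Algorithms

/-! ### Links for the split edges and the final estimates -/

section Main

variable {V : Type*} {I : WTAP V}

/-- In a shadow-complete instance with a feasible vector, each tree edge is a link. -/
theorem edge_mem_links (hs : I.ShadowComplete) {x : Sym2 V → ℝ}
    (hx : I.OddCutFeasible ∅ Set.univ x) {e : Sym2 V} (he : e ∈ I.graph.edgeSet) :
    e ∈ I.links := by
  induction e using Sym2.ind with
  | _ a b =>
    have hab : I.graph.Adj a b := he
    -- One side of `ab` has the odd cut `{ab}`. Its constraint forces some link to cover `ab`, and
    -- the edge itself is a shadow of that link.
    have hcut : cut I.graph ∅ Set.univ {w | Conn I.graph s(a, b) a w} = {s(a, b)} := by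
      ext f
      rw [Set.mem_singleton_iff]
      constructor
      · rintro ⟨hf, p, q, hp, hq, rfl⟩
        by_contra hne
        exact hq (Reachable.trans hp (conn_of_adj hf.1 hne))
      · rintro rfl
        exact ⟨⟨he, by simp, fun w _ => Set.mem_univ w⟩, a, b, Reachable.refl _,
          not_conn_edge I.isTree hab, rfl⟩
    have h1 := hx.2 {w | Conn I.graph s(a, b) a w}
      ⟨Set.subset_univ _, fun w hw => by simpa [node_empty] using hw⟩ (by simp [hcut])
    rw [hcut, Set.ncard_singleton] at h1
    have h2 : ∑ l ∈ I.linksIn Set.univ,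
        (⌈((pathEdges I.graph l ∩ {s(a, b)}).ncard : ℝ) / 2⌉₊ : ℝ) * x l ≠ 0 := by
      intro h
      rw [h] at h1
      norm_num at h1
    obtain ⟨l, hl, hl0⟩ := Finset.exists_ne_zero_of_sum_ne_zero h2
    have hmem : s(a, b) ∈ pathEdges I.graph l := by
      by_contra h
      have h3 : pathEdges I.graph l ∩ {s(a, b)} = ∅ := by simpa using h
      rw [h3] at hl0
      simp at hl0
    refine (hs l (mem_linksIn.1 hl).1 s(a, b) (by simpa using hab.ne) fun f hf => ?_).1
    rw [mem_pathEdges I.isTree] at hf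
    have : s(a, b) = f := by
      by_contra hne
      exact hf (conn_of_adj hab hne)
    rwa [← this]

theorem covers_edges {F : Finset (Sym2 V)} (hF : (F : Set (Sym2 V)) ⊆ I.graph.edgeSet) :
    I.Covers F F := by
  intro e he
  refine ⟨e, he, ?_⟩
  induction e using Sym2.ind with
  | _ a b =>
    rw [mem_pathEdges I.isTree]
    exact not_conn_edge I.isTree (hF he)

theorem fracCost_nonneg (hc : ∀ l ∈ I.links, 1 ≤ I.cost l) {x : Sym2 V → ℝ}
    (hx : ∀ l ∈ I.links, 0 ≤ x l) : 0 ≤ I.fracCost x :=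
  Finset.sum_nonneg fun l hl => mul_nonneg (by linarith [hc l hl]) (hx l hl)

/-- With `k` pieces of total cost `T`, the lower bound on the pieces gives `k * 4M/ε² ≤ T`. The
fewer than `k` splits therefore add at most `ε T / 2`, and their edges, at price `M` each, cost at
most `ε² T / 4`. -/
theorem WTAP.ThinDecomp.sum_bounds [Finite V] (hs : I.ShadowComplete) {M ε : ℝ} (hM : 1 ≤ M)
    (hε : 0 < ε) (hε1 : ε ≤ 1) (hc : ∀ l ∈ I.links, 1 ≤ I.cost l) {γ : ℕ} {D : Set (Sym2 V)}
    (hD : D ⊆ I.graph.edgeSet) {U : Set V} {x : Sym2 V → ℝ} (hU : I.IsPiece γ D (2 * M / ε) U x)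
    {P : List (Set V × (Sym2 V → ℝ))} {E : Set (Sym2 V)}
    (h : I.ThinDecomp (4 * M / ε ^ 2) D U x P E) :
    (P.map fun H => I.fracCost H.2).sum ≤ (1 + ε) * I.fracCost x ∧
      E.ncard * M ≤ 1 * ε * (P.map fun H => I.fracCost H.2).sum := by
  have h1 := h.sum_fracCost_le hs hc hD hU
  have h2 := h.ncard_edges_lt
  have hF := fracCost_nonneg hc hU.nonneg
  rcases h.le_fracCost hs hc hD hU with rfl | h3
  · have h4 : E.ncard = 0 := by simpa using h2
    simp only [List.map_cons, List.map_nil, List.sum_cons, List.sum_nil, add_zero, h4,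
      Nat.cast_zero, zero_mul]
    exact ⟨by nlinarith, by positivity⟩
  · have h4 : (P.length : ℝ) * (4 * M / ε ^ 2) ≤ (P.map fun H => I.fracCost H.2).sum := by
      have := List.card_nsmul_le_sum (P.map fun H => I.fracCost H.2) (4 * M / ε ^ 2) (by
        intro c hc
        obtain ⟨H, hH, rfl⟩ := List.mem_map.1 hc
        exact h3 H hH)
      simpa using this
    set T := (P.map fun H => I.fracCost H.2).sum
    set k : ℝ := (P.length : ℝ) with hk
    have hT : 0 ≤ T := le_trans (by positivity) h4
    have h5 : k * (4 * M) ≤ T * ε ^ 2 := by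
      have h6 : k * (4 * M / ε ^ 2) = k * (4 * M) / ε ^ 2 := by ring
      rwa [h6, div_le_iff₀ (by positivity)] at h4
    have hE : (E.ncard : ℝ) + 1 ≤ k := by
      rw [hk]
      exact_mod_cast h2
    constructor
    · have h6 : k * (2 * M / ε) ≤ T * ε / 2 := by
        have h7 : k * (2 * M / ε) = k * (4 * M) / (2 * ε) := by field_simp; ring
        rw [h7, div_le_iff₀ (by positivity)]
        calc k * (4 * M) ≤ T * ε ^ 2 := h5
          _ = T * ε / 2 * (2 * ε) := by ring
      have h8 : 0 ≤ 2 * M / ε := by positivity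
      have h9 : T * (1 - ε / 2) ≤ I.fracCost x := by linarith
      have h10 : (1 + ε) * (T * (1 - ε / 2)) ≤ (1 + ε) * I.fracCost x :=
        mul_le_mul_of_nonneg_left h9 (by linarith)
      -- Uses `(1 + ε)(1 - ε/2) = 1 + ε(1 - ε)/2 ≥ 1`.
      nlinarith [mul_nonneg hT (mul_nonneg hε.le (sub_nonneg.2 hε1))]
    · have h6 : T * ε ^ 2 ≤ T * ε := by nlinarith [mul_nonneg hT (mul_nonneg hε.le (sub_nonneg.2 hε1))]
      nlinarith

end Main

end TreeAug

theorem lemma4 :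
    ∃ (C : ℝ) (q : Polynomial ℕ) (progH progS : Prog),
      ∀ (V : Type*) [Finite V] (I : WTAP V) (M ε : ℝ) (x : Sym2 V → ℝ),
        1 ≤ M → 0 < ε → ε ≤ 1 →
        (∀ l ∈ I.links, 1 ≤ I.cost l ∧ I.cost l ≤ M) →
        I.ShadowComplete →
        I.OddCutBundleFeasible ⌈28 * M / ε ^ 2⌉₊ x →
        -- a cheap cover of the heavily covered edges can be computed efficiently
        (∀ σ : V ≃ Fin (Nat.card V), ∃ Lh : Finset (Sym2 V),
          Computes progH (I.input σ ∅ x (2 / ε)) (q.eval (Nat.card V)) σ Lh ∧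
          Lh ⊆ I.links ∧ I.Covers Lh (I.heavy ε x) ∧
          I.setCost Lh ≤ ε * I.fracCost x) ∧
        -- for every cover of the heavily covered edges and every resulting decomposition
        ∀ Lh : Finset (Sym2 V), Lh ⊆ I.links → I.Covers Lh (I.heavy ε x) →
        ∀ (P : List (Set V × (Sym2 V → ℝ))) (Es : Set (Sym2 V)),
          I.ThinDecomp (4 * M / ε ^ 2) (I.contracted Lh) Set.univ x P Es →
          -- feasibility
          (∀ H ∈ P, I.OddCutFeasible (I.contracted Lh) H.1 H.2 ∧
            I.BundleFeasible ⌈28 * M / ε ^ 2⌉₊ (I.contracted Lh) H.1 H.2) ∧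
          -- disjoint supports
          P.Pairwise (fun H H' => Disjoint (I.supp H.2) (I.supp H'.2)) ∧
          -- simplicity
          (∀ H ∈ P, ∃ v : V,
            I.IsCenter ⌈10 * M / ε ^ 2⌉₊ (I.contracted Lh) H.1 H.2 v ∧
            ∀ K : Set V, IsBranch I.graph (I.contracted Lh) H.1 v K →
              I.costIn H.2 K ≤ 4 * M / ε ^ 2 ∧
              ((leavesIn I.graph (I.contracted Lh) H.1 K).ncard : ℝ) ≤ 10 * M / ε ^ 2) ∧
          -- cost increase
          (P.map fun H => I.fracCost H.2).sum ≤ (1 + ε) * I.fracCost x ∧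
          -- a cheap cover of the split edges can be computed efficiently
          (∀ σ : V ≃ Fin (Nat.card V), ∃ Ls : Finset (Sym2 V),
            Computes progS (I.input σ Es 0 0) (q.eval (Nat.card V)) σ Ls ∧
            Ls ⊆ I.links ∧ I.Covers Ls Es ∧
            I.setCost Ls ≤ C * ε * (P.map fun H => I.fracCost H.2).sum) := by
  -- The sum of the two time bounds is a common bound for both programs.
  obtain ⟨q, hq⟩ := isPolynomial_coverTime.add isPolynomial_copyTime
  refine ⟨1, q, coverProg, copyProg, fun V _ I M ε x hM hε hε1 hcost hs hx => ?_⟩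
  have : Fintype V := Fintype.ofFinite V
  have hc : ∀ l ∈ I.links, 1 ≤ I.cost l := fun l hl => (hcost l hl).1
  refine ⟨fun σ => ?_, fun Lh _ hLh P Es hP => ?_⟩
  · obtain ⟨S, ⟨t, s', hr, ht, ho⟩, h⟩ := coverProg_computes hs hc hx.1.1 hε σ
    exact ⟨S, ⟨t, s', hr, ht.trans (by rw [hq]; exact Nat.le_add_right _ _), ho⟩, h⟩
  have hD := contracted_subset (I := I) Lh
  have hU := isPiece_univ hM hcost hx hLh
  have hpieces := hP.forall_piece _ hU fun U y u v h ht => h.split hs hc hD ht.1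
  obtain ⟨hsum, hcard⟩ := hP.sum_bounds hs hM hε hε1 hc hD hU
  refine ⟨fun H hH => ⟨(hpieces H hH).1.oddCut, (hpieces H hH).1.bundle⟩, ?_, fun H hH =>
    (hpieces H hH).1.exists_isCenter hD hM hε hε1 hc (hpieces H hH).2, hsum, fun σ => ?_⟩
  · exact hP.pairwise_disjoint.imp_of_mem fun hH hH' hd =>
      disjoint_supp (hpieces _ hH).1.supported (hpieces _ hH').1.supported hd
  · obtain ⟨F, rfl⟩ : ∃ F : Finset (Sym2 V), (F : Set (Sym2 V)) = Es :=
      ⟨Es.toFinite.toFinset, by simp⟩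
    obtain ⟨t, s', hr, ht, ho⟩ := copyProg_computes I σ (F := F) 0 0
    have hF : F ⊆ I.links := fun e he => edge_mem_links hs hx.1 (hP.edges_subset he)
    refine ⟨F, ⟨t, s', hr, ht.trans (by rw [hq]; exact Nat.le_add_left _ _), ho⟩, hF,
      covers_edges hP.edges_subset, le_trans ?_ hcard⟩
    rw [Set.ncard_coe_finset, ← nsmul_eq_mul]
    exact Finset.sum_le_card_nsmul _ _ _ fun l hl => (hcost l (hF hl)).2
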